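/- Fix $\lambda>0$. Let $\mathbb H=\{z\in\mathbb C:\operatorname{Im} z>0\}$. For $N\in\mathbb N$, $N\ge 1$, put $\delta(N,\lambda)=1-\frac{2}{1+e^{\lambda/N}}$ and, for $0<\delta<1$, $$f_N(z)=e^{-iz/N},\quad f_N^{-1}(\zeta)=iN\log\zeta,\quad g(\zeta)=\frac{i(\zeta-1)}{\zeta+1},\quad g^{-1}(w)=\frac{i+w}{i-w},\quad \varphi^{\delta}(w)=\sqrt{w^2(1-\delta^2)-\delta^2},$$ where $\log$ is the principal logarithm and the square root takes values in $\mathbb H$. Let $S^{N,\delta}=f_N^{-1}\circ g^{-1}\circ\varphi^{\delta}\circ g\circ f_N$, the slit map of the cylinder of circumference $2\pi N$, and, for $x\in\mathbb R$ and $z\in\mathbb H$, let $$S^{N,\delta}_x(z)=\operatorname{Re} z+S^{N,\delta}(z-x)-\big(\operatorname{Re}(z-x)\bmod 2\pi N\big),$$ where $r\bmod 2\pi N$ denotes the representative of $r$ in $[-\pi N,\pi N)$; this is the slit map at $x$, lifted to $\mathbb H$. Let $\mathbf P$ be a Poisson point process of intensity $1$ on $\{(x,s):x\in\mathbb R,\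 s>0\}$, with expectation $\mathbf E$, and let $A_{t,N}$ be the (almost surely finite) set of its points in $[-\pi N,\pi N)\times(0,t]$. The backward cylindrical process $\tilde{\mathcal A}^{N,\delta}_t(z)$, $t\ge 0$, $z\in\mathbb H$, is the càdlàg jump process given by $$\tilde{\mathcal A}^{N,\delta}_t(z)=z+\sum_{(x,s)\in A_{t,N}}\Big[S^{N,\delta}_x\big(\tilde{\mathcal A}^{N,\delta}_{s-}(z)\big)-\tilde{\mathcal A}^{N,\delta}_{s-}(z)\Big].$$ All the processes, $N=1,2,\dots$, are driven by the same Poisson point process. **Theorem.** For every $t\ge 0$, every compact $K\subset\mathbb H$ and every $\varepsilon>0$ there is an $\tilde N\in\mathbb N$ such that for all $M>N>\tilde N$ the random variable $\sup_{s\le t}\sup_{z\in K}\big|\tilde{\mathcal A}^{N,\delta(N,\lambda)}_s(z)-\tilde{\mathcal A}^{M,\delta(M,\lambda)}_s(z)\big|^2$ is measurable (with respect to the completed probability space) and $$\mathbf E\Big[\sup_{s\le t}\ \sup_{z\in K}\big|\tilde{\mathcal A}^{N,\delta(N,\lambda)}_s(z)-\tilde{\mathcal A}^{M,\delta(M,\lambda)}_s(z)\big|^2\Big]<\varepsilon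 .$$ -/

import Mathlib

open MeasureTheory ProbabilityTheory
open scoped ENNReal

noncomputable section

namespace CHL

/-! ### The cylindrical slit map -/

/-- The scaling parameter `δ(N, λ) = 1 - 2 / (1 + e^{λ/N})`. -/
def slitParam (N : ℕ) (lam : ℝ) : ℝ := 1 - 2 / (1 + Real.exp (lam / N))

/-- `f_N(z) = e^{-iz/N}`, from the cylinder of circumference `2πN` to `{|ζ| > 1}`. -/
def fMap (N : ℕ) (z : ℂ) : ℂ := Complex.exp (-Complex.I * z / N)

/-- `f_N⁻¹(ζ) = iN log ζ` with the principal logarithm; its real part lies in `[-πN, πN)`. -/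
def fInv (N : ℕ) (ζ : ℂ) : ℂ := Complex.I * N * Complex.log ζ

/-- `g(ζ) = i(ζ - 1)/(ζ + 1)`, from `{|ζ| > 1}` to the upper half-plane. -/
def gMap (ζ : ℂ) : ℂ := Complex.I * (ζ - 1) / (ζ + 1)

/-- `g⁻¹(w) = (i + w)/(i - w)`. -/
def gInv (w : ℂ) : ℂ := (Complex.I + w) / (Complex.I - w)

/-- `φ^δ(w) = √(w²(1 - δ²) - δ²)`, with the branch of the square root that takes values in the
upper half-plane: for `Im w > 0` and `0 < δ < 1` the number `δ² - w²(1 - δ²)` is off the cut of the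
principal square root, whose real part is then positive, so that `i` times it has positive
imaginary part. -/
def phiMap (δ : ℝ) (w : ℂ) : ℂ :=
  Complex.I * ((δ : ℂ) ^ 2 - w ^ 2 * (1 - (δ : ℂ) ^ 2)) ^ (1 / 2 : ℂ)

/-- The slit map `S^{N,δ} = f_N⁻¹ ∘ g⁻¹ ∘ φ^δ ∘ g ∘ f_N` of the cylinder, with values in the
fundamental domain `-πN ≤ Re < πN`. -/
def cylSlit (N : ℕ) (δ : ℝ) (z : ℂ) : ℂ := fInv N (gInv (phiMap δ (gMap (fMap N z))))

/-- The representative of the real number `r` modulo `2πN` in `[-πN, πN)`. -/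
def cylRep (N : ℕ) (r : ℝ) : ℝ :=
  r - 2 * Real.pi * N * (⌊(r + Real.pi * N) / (2 * Real.pi * N)⌋ : ℝ)

/-- The slit map `S^{N,δ}_x` at `x`, lifted to the upper half-plane:
`S_x(z) = Re z + S(z - x) - (Re (z - x) mod 2πN)`, so that `S_x(z) - z` is continuous on the upper
half-plane and `2πN`-periodic in `z`. -/
def slitAt (N : ℕ) (δ : ℝ) (x : ℝ) (z : ℂ) : ℂ :=
  (z.re : ℂ) + cylSlit N δ (z - x) - (cylRep N (z.re - x) : ℂ)

/-! ### The backward cylindrical process -/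

open Classical in
/-- The value at the starting point `z` of the backward process driven by the finite set `F` of
points `(x, s)` (position `x`, time `s`):
`Ã(z) = z + ∑_{(x,s) ∈ F} [S_x(Ã_{s-}(z)) - Ã_{s-}(z)]`,
where the left limit `Ã_{s-}` is the process driven by the points of `F` with time `< s`. -/
def backwardFlow (N : ℕ) (δ : ℝ) (F : Finset (ℝ × ℝ)) (z : ℂ) : ℂ :=
  z + ∑ p ∈ F.attach,
    (slitAt N δ p.1.1 (backwardFlow N δ (F.filter fun q => q.2 < p.1.2) z)
      - backwardFlow N δ (F.filter fun q => q.2 < p.1.2) z)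
termination_by F.card
decreasing_by
  all_goals
    exact Finset.card_lt_card
      (Finset.filter_ssubset.2 ⟨p.1, p.2, lt_irrefl _⟩)

open Classical in
theorem backwardFlow_eq (N : ℕ) (δ : ℝ) (F : Finset (ℝ × ℝ)) (z : ℂ) :
    backwardFlow N δ F z = z + ∑ p ∈ F,
      (slitAt N δ p.1 (backwardFlow N δ (F.filter fun q => q.2 < p.2) z)
        - backwardFlow N δ (F.filter fun q => q.2 < p.2) z) := by
  rw [backwardFlow, ← Finset.sum_attach F]

/-- The points of `A` that lie in `[-πN, πN) × (0, t]`. -/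
def pointsUpTo (A : Set (ℝ × ℝ)) (N : ℕ) (t : ℝ) : Set (ℝ × ℝ) :=
  A ∩ Set.Ico (-(Real.pi * N)) (Real.pi * N) ×ˢ Set.Ioc 0 t

open Classical in
/-- The backward cylindrical process `Ã_t^{N,δ}(z)` driven by the configuration `A` of points
`(x, s)`. For a Poisson process the set of points is almost surely finite; where it is infinite
the value is `z` by convention. -/
def backwardCHL (N : ℕ) (δ : ℝ) (A : Set (ℝ × ℝ)) (t : ℝ) (z : ℂ) : ℂ :=
  if h : (pointsUpTo A N t).Finite then backwardFlow N δ h.toFinset z else z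

/-! ### Poisson point processes -/

/-- The random set `A` of points of `X` is a Poisson point process with intensity measure `ν`:
the number of points in a set of finite measure `ν B` is Poisson distributed with mean `ν B`, and
the numbers of points in pairwise disjoint sets are independent. -/
structure IsPoissonPointProcess {X Ω : Type*} [MeasurableSpace X] [MeasurableSpace Ω]
    (ν : Measure X) (μ : Measure Ω) (A : Ω → Set X) : Prop where
  measurable_count : ∀ B : Set X, MeasurableSet B → Measurable fun ω => (A ω ∩ B).encard
  map_count : ∀ B : Set X, MeasurableSet B → ν B ≠ ∞ →
    μ.map (fun ω => (A ω ∩ B).encard)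
      = (poissonMeasure (ν B).toNNReal).map (Nat.cast : ℕ → ℕ∞)
  indep_count : ∀ (n : ℕ) (B : Fin n → Set X), (∀ i, MeasurableSet (B i)) →
    Pairwise (fun i j => Disjoint (B i) (B j)) →
    iIndepFun (fun i ω => (A ω ∩ B i).encard) μ

/-- Lebesgue measure on the set of all `(x, s)` with position `x` real and time `s > 0`. -/
def halfPlaneIntensity : Measure (ℝ × ℝ) := volume.restrict {p | 0 < p.2}

/-- `sup_{s ≤ t} sup_{z ∈ K} |Ã_s^{N,δ(N,λ)}(z) - Ã_s^{M,δ(M,λ)}(z)|²`, both processes being driven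
by the same configuration `A`. -/
def supSqDist (lam : ℝ) (N M : ℕ) (A : Set (ℝ × ℝ)) (t : ℝ) (K : Set ℂ) : ℝ≥0∞ :=
  ⨆ s ∈ Set.Icc 0 t, ⨆ z ∈ K,
    ‖backwardCHL N (slitParam N lam) A s z - backwardCHL M (slitParam M lam) A s z‖ₑ ^ 2

end CHL

end

/-!
Write `jump lam N z = S(z) - z` for the displacement of the slit map of the cylinder at the
parameter `δ(N, λ)`. Since slits push upwards, `Im (jump lam N z) ≥ 0`, so the flows never leave the
half-plane `{Im ≥ y}` in which they start. There the displacement is holomorphic and is controlled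
uniformly in `N`:

* it is at most a constant over `1 +` the distance to the slit (`IsLarge.norm_jump_le`), and by the
  Schwarz lemma it is Lipschitz with the same decay (`IsLarge.norm_jump_sub_le`); both bounds are
  square integrable in the position of the slit;
* it converges locally uniformly as `N → ∞` (`tendsto_jump`);
* its integral over all positions of the slit does not depend on the point, by the mean value
  property in `q = e^{iz/N}` (`IsLarge.integral_jump`), and converges as `N → ∞`
  (`exists_tendsto_driftConst`).

The displacement itself is not integrable in the position uniformly in `N`, but by the last item the
compensator of the flow is a deterministic linear drift. What has to be compared for two values of
`N` is therefore only the martingale part, where squares suffice: Doob's inequality and Grönwall's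
inequality bound the mean square of the supremum over time of the difference by the distance of the
drifts and the `L²` distance of the displacements at points of a large ball, the probability of
leaving the ball being controlled by second moments.

No stochastic integral is needed. The Poisson process enters through the numbers of its points in
the cells of a grid, which are independent with equal mean and variance
(`IsPoissonPointProcess.isCountArray_cellCount`). These counts drive a discretised flow `gridFlow`,
for which orthogonality of increments, a pathwise form of Doob's inequality and the discrete
Grönwall inequality give the estimate above (`GridJumps.exists_integrable_bound_sub`). For every
configuration with finitely many points the discretised flows converge to the backward flow at
dyadic times as the grid is refined (`IsLarge.tendsto_gridFlow`), and dyadic times see every value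
of the flow. Hence the supremum is measurable (`aemeasurable_supSqDist`), and the estimate passes to
the limit by Fatou's lemma.

The supremum over `K` is inside the expectation. The flows are holomorphic in the starting point, so
Cauchy's formula for the square of their difference bounds it on `K` by integrals over finitely many
circles (`exists_measure_enorm_sq_le`), and Tonelli's theorem reduces the claim to fixed starting
points (`lintegral_supSqDist_le`).
-/

noncomputable section

namespace CHL

/-! ### The half-plane slit map -/

section HalfPlane

variable {δ : ℝ} {w : ℂ}

/-- The number under the principal square root in `phiMap` is off the branch cut. -/
theorem sq_sub_mem_slitPlane (hδ : δ ∈ Set.Ioo (0 : ℝ) 1) (hw : 0 < w.im) :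
    (δ : ℂ) ^ 2 - w ^ 2 * (1 - (δ : ℂ) ^ 2) ∈ Complex.slitPlane := by
  obtain ⟨h0, h1⟩ := hδ
  have h2 : 0 < 1 - δ ^ 2 := by nlinarith
  have e : (δ : ℂ) ^ 2 - w ^ 2 * (1 - (δ : ℂ) ^ 2)
      = ((δ ^ 2 : ℝ) : ℂ) - w ^ 2 * ((1 - δ ^ 2 : ℝ) : ℂ) := by push_cast; ring
  rw [e, Complex.mem_slitPlane_iff]
  by_cases hx : w.re = 0
  · left
    simp only [Complex.sub_re, Complex.ofReal_re, Complex.mul_re, Complex.ofReal_im, pow_two w,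
      hx]
    have : 0 < w.im * w.im * (1 - δ ^ 2) := by positivity
    nlinarith [sq_nonneg δ]
  · right
    simp only [Complex.sub_im, Complex.ofReal_re, Complex.mul_im, Complex.ofReal_im, pow_two w]
    have : w.re * w.im * (1 - δ ^ 2) ≠ 0 := mul_ne_zero (mul_ne_zero hx hw.ne') h2.ne'
    intro h
    apply this
    linarith

theorem phiMap_sq (δ : ℝ) (w : ℂ) :
    phiMap δ w ^ 2 = w ^ 2 * (1 - (δ : ℂ) ^ 2) - (δ : ℂ) ^ 2 := by
  have := Complex.cpow_nat_inv_pow ((δ : ℂ) ^ 2 - w ^ 2 * (1 - (δ : ℂ) ^ 2)) two_ne_zero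
  rw [phiMap, mul_pow, Complex.I_sq, one_div]
  push_cast at this
  rw [this]
  ring

theorem re_cpow_half_pos {x : ℂ} (hx : x ∈ Complex.slitPlane) : 0 < (x ^ (1 / 2 : ℂ)).re := by
  have hx0 : x ≠ 0 := Complex.slitPlane_ne_zero hx
  rw [Complex.cpow_def_of_ne_zero hx0, Complex.exp_re]
  have h := Complex.mem_slitPlane_iff_arg.1 hx
  have e : (Complex.log x * (1 / 2 : ℂ)).im = x.arg / 2 := by
    rw [show (1 / 2 : ℂ) = ((1 / 2 : ℝ) : ℂ) by push_cast; ring, Complex.im_mul_ofReal,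
      Complex.log_im]
    ring
  rw [e]
  have h1 := Complex.neg_pi_lt_arg x
  have h2 := lt_of_le_of_ne (Complex.arg_le_pi x) h.1
  exact mul_pos (Real.exp_pos _) (Real.cos_pos_of_mem_Ioo ⟨by linarith, by linarith⟩)

theorem phiMap_im_pos (hδ : δ ∈ Set.Ioo (0 : ℝ) 1) (hw : 0 < w.im) : 0 < (phiMap δ w).im := by
  have := re_cpow_half_pos (sq_sub_mem_slitPlane hδ hw)
  simpa [phiMap, Complex.mul_im] using this

/-- `φ^δ(w)` lies in the same closed quadrant as `w`. -/
theorem phiMap_re_mul_im (δ : ℝ) (w : ℂ) :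
    (phiMap δ w).re * (phiMap δ w).im = (1 - δ ^ 2) * (w.re * w.im) := by
  have h := congrArg Complex.im (phiMap_sq δ w)
  have e : w ^ 2 * (1 - (δ : ℂ) ^ 2) - (δ : ℂ) ^ 2
      = w ^ 2 * ((1 - δ ^ 2 : ℝ) : ℂ) - ((δ ^ 2 : ℝ) : ℂ) := by push_cast; ring
  rw [e] at h
  simp only [Complex.sub_im, Complex.ofReal_re, Complex.mul_im, Complex.ofReal_im,
    pow_two (phiMap δ w), pow_two w] at h
  linarith

theorem phiMap_re_pos_iff (hδ : δ ∈ Set.Ioo (0 : ℝ) 1) (hw : 0 < w.im) :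
    0 < (phiMap δ w).re ↔ 0 < w.re := by
  have h := phiMap_re_mul_im δ w
  have h1 := phiMap_im_pos hδ hw
  have h2 : 0 < 1 - δ ^ 2 := by nlinarith [hδ.1, hδ.2]
  rw [← mul_pos_iff_of_pos_right h1, h, mul_pos_iff_of_pos_left h2, mul_pos_iff_of_pos_right hw]

/-- No cancellation occurs in `φ^δ(w) + w`, since both numbers lie in the same quadrant. -/
theorem norm_le_norm_phiMap_add (hδ : δ ∈ Set.Ioo (0 : ℝ) 1) (hw : 0 < w.im) :
    ‖w‖ ≤ ‖phiMap δ w + w‖ := by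
  have h := phiMap_re_mul_im δ w
  have h1 := phiMap_im_pos hδ hw
  have h2 : 0 < 1 - δ ^ 2 := by nlinarith [hδ.1, hδ.2]
  have h3 : 0 ≤ (phiMap δ w).re * w.re := by
    have : 0 ≤ ((phiMap δ w).re * w.re) * ((phiMap δ w).im) := by
      have : ((phiMap δ w).re * w.re) * ((phiMap δ w).im)
        = (1 - δ ^ 2) * w.im * w.re ^ 2 := by
        linear_combination w.re * h
      rw [this]; positivity
    exact nonneg_of_mul_nonneg_left this h1
  apply le_of_sq_le_sq _ (norm_nonneg _)
  rw [← Complex.normSq_eq_norm_sq, ← Complex.normSq_eq_norm_sq, Complex.normSq_apply,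
    Complex.normSq_apply, Complex.add_re, Complex.add_im]
  nlinarith [mul_pos h1 hw, sq_nonneg (phiMap δ w).re, sq_nonneg (phiMap δ w).im]

theorem norm_phiMap_sq_le (hδ : δ ∈ Set.Ioo (0 : ℝ) 1) (w : ℂ) :
    ‖phiMap δ w‖ ^ 2 ≤ ‖w‖ ^ 2 + 1 := by
  have h2 : 0 < 1 - δ ^ 2 := by nlinarith [hδ.1, hδ.2]
  have e : w ^ 2 * (1 - (δ : ℂ) ^ 2) - (δ : ℂ) ^ 2
      = w ^ 2 * ((1 - δ ^ 2 : ℝ) : ℂ) - ((δ ^ 2 : ℝ) : ℂ) := by push_cast; ring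
  rw [← norm_pow, phiMap_sq, e]
  refine (norm_sub_le _ _).trans ?_
  rw [norm_mul, Complex.norm_real, Complex.norm_real, norm_pow, Real.norm_of_nonneg h2.le,
    Real.norm_of_nonneg (sq_nonneg δ)]
  nlinarith [hδ.1, hδ.2, sq_nonneg ‖w‖, sq_nonneg δ]

theorem le_norm_phiMap_sq (hδ : δ ∈ Set.Ioo (0 : ℝ) 1) (w : ℂ) :
    (1 - δ ^ 2) * ‖w‖ ^ 2 - δ ^ 2 ≤ ‖phiMap δ w‖ ^ 2 := by
  have h2 : 0 < 1 - δ ^ 2 := by nlinarith [hδ.1, hδ.2]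
  have e : w ^ 2 * (1 - (δ : ℂ) ^ 2) - (δ : ℂ) ^ 2
      = w ^ 2 * ((1 - δ ^ 2 : ℝ) : ℂ) - ((δ ^ 2 : ℝ) : ℂ) := by push_cast; ring
  rw [← norm_pow (phiMap δ w), phiMap_sq, e]
  refine le_trans ?_ (norm_sub_norm_le _ _)
  rw [norm_mul, Complex.norm_real, Complex.norm_real, norm_pow, Real.norm_of_nonneg h2.le,
    Real.norm_of_nonneg (sq_nonneg δ)]
  linarith

theorem norm_sq_add_one_le_norm_add_I_sq (hw : 0 < w.im) : ‖w‖ ^ 2 + 1 ≤ ‖w + Complex.I‖ ^ 2 := by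
  rw [← Complex.normSq_eq_norm_sq, ← Complex.normSq_eq_norm_sq, Complex.normSq_apply,
    Complex.normSq_apply]
  simp
  nlinarith

theorem norm_phiMap_add_I_le (hδ : δ ∈ Set.Ioo (0 : ℝ) 1) (hw : 0 < w.im) :
    ‖phiMap δ w + Complex.I‖ ≤ 2 * ‖w + Complex.I‖ := by
  have h1 := norm_sq_add_one_le_norm_add_I_sq hw
  have h2 := norm_phiMap_sq_le hδ w
  have h3 : ‖phiMap δ w‖ ≤ ‖w + Complex.I‖ := le_of_sq_le_sq (h2.trans h1) (norm_nonneg _)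
  have h4 : (1 : ℝ) ≤ ‖w + Complex.I‖ :=
    le_of_sq_le_sq (by nlinarith [sq_nonneg ‖w‖]) (norm_nonneg _)
  calc _ ≤ ‖phiMap δ w‖ + ‖Complex.I‖ := norm_add_le _ _
    _ ≤ _ := by rw [Complex.norm_I]; linarith

/-- The excess `g⁻¹(φ^δ(w)) / g⁻¹(w) - 1`, in a form without cancellation. -/
def slitExcess (δ : ℝ) (w : ℂ) : ℂ :=
  2 * Complex.I * δ ^ 2 * (phiMap δ w + Complex.I)
    / ((1 - δ ^ 2) * (phiMap δ w + w) * (w + Complex.I))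

theorem add_I_ne_zero (hw : 0 < w.im) : w + Complex.I ≠ 0 := by
  intro h
  have := congrArg Complex.im h
  simp at this
  linarith

theorem phiMap_add_ne_zero (hδ : δ ∈ Set.Ioo (0 : ℝ) 1) (hw : 0 < w.im) : phiMap δ w + w ≠ 0 := by
  intro h
  have := congrArg Complex.im h
  simp at this
  linarith [phiMap_im_pos hδ hw]

theorem one_sub_sq_ne_zero (hδ : δ ∈ Set.Ioo (0 : ℝ) 1) : (1 - (δ : ℂ) ^ 2) ≠ 0 := by
  have h2 : 0 < 1 - δ ^ 2 := by nlinarith [hδ.1, hδ.2]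
  exact_mod_cast h2.ne'

theorem norm_slitExcess_le (hδ : δ ∈ Set.Ioo (0 : ℝ) 1) (hw : 0 < w.im) :
    ‖slitExcess δ w‖ ≤ 4 * δ ^ 2 / ((1 - δ ^ 2) * ‖w‖) := by
  have h2 : 0 < 1 - δ ^ 2 := by nlinarith [hδ.1, hδ.2]
  have hw0 : 0 < ‖w‖ := norm_pos_iff.2 (by rintro rfl; simp at hw)
  have hwI : 0 < ‖w + Complex.I‖ := norm_pos_iff.2 (add_I_ne_zero hw)
  have e : (1 - (δ : ℂ) ^ 2) = ((1 - δ ^ 2 : ℝ) : ℂ) := by push_cast; ring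
  rw [slitExcess, norm_div, norm_mul, norm_mul, norm_mul, norm_mul, norm_mul, e, Complex.norm_real,
    Complex.norm_I, norm_pow, Complex.norm_real, Real.norm_of_nonneg h2.le,
    Real.norm_of_nonneg hδ.1.le]
  have h3 := norm_le_norm_phiMap_add hδ hw
  have h4 := norm_phiMap_add_I_le hδ hw
  simp only [Complex.norm_ofNat, mul_one]
  rw [div_le_div_iff₀ (by have := hw0.trans_le h3; positivity) (by positivity)]
  calc 2 * δ ^ 2 * ‖phiMap δ w + Complex.I‖ * ((1 - δ ^ 2) * ‖w‖)
      ≤ 2 * δ ^ 2 * (2 * ‖w + Complex.I‖) * ((1 - δ ^ 2) * ‖phiMap δ w + w‖) := by gcongr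
    _ = _ := by ring

theorem I_sub_ne_zero_of_sq {u : ℂ} (hu : 1 + u ^ 2 ≠ 0) : Complex.I - u ≠ 0 := by
  intro h
  apply hu
  have : u = Complex.I := (sub_eq_zero.1 h).symm
  rw [this, Complex.I_sq]; ring

theorem one_add_phiMap_sq (δ : ℝ) (w : ℂ) :
    1 + phiMap δ w ^ 2 = (1 - (δ : ℂ) ^ 2) * (1 + w ^ 2) := by
  rw [phiMap_sq]; ring

/-- `g⁻¹ ∘ φ^δ = g⁻¹ · (1 + slitExcess)` on the upper half-plane. -/
theorem gInv_phiMap (hδ : δ ∈ Set.Ioo (0 : ℝ) 1) (hw : 0 < w.im) (hw1 : 1 + w ^ 2 ≠ 0) :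
    gInv (phiMap δ w) = gInv w * (1 + slitExcess δ w) := by
  have h1 := add_I_ne_zero hw
  have h2 := phiMap_add_ne_zero hδ hw
  have h3 := one_sub_sq_ne_zero hδ
  have h4 := I_sub_ne_zero_of_sq hw1
  have h5 : Complex.I - phiMap δ w ≠ 0 := I_sub_ne_zero_of_sq (by
    rw [one_add_phiMap_sq]; exact mul_ne_zero h3 hw1)
  have h6 := phiMap_sq δ w
  have hI := Complex.I_sq
  rw [gInv, gInv, slitExcess]
  generalize phiMap δ w = p at *
  generalize hd : (δ : ℂ) ^ 2 = d at *
  -- The claim is linear in `p²`, which is known.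
  have key : (p + Complex.I) * (Complex.I - w) * ((1 - d) * (p + w))
      = (Complex.I - p) * ((1 - d) * (p + w) * (w + Complex.I)
        + 2 * Complex.I * d * (p + Complex.I)) := by
    linear_combination (2 * Complex.I) * h6 - (2 * Complex.I * d) * hI
  rw [one_add_div (mul_ne_zero (mul_ne_zero h3 h2) h1), div_mul_div_comm,
    div_eq_div_iff h5 (mul_ne_zero h4 (mul_ne_zero (mul_ne_zero h3 h2) h1))]
  linear_combination (w + Complex.I) * key

theorem norm_one_add_sq_sq (w : ℂ) : ‖1 + w ^ 2‖ ^ 2 = (1 + ‖w‖ ^ 2) ^ 2 - 4 * w.im ^ 2 := by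
  rw [← Complex.normSq_eq_norm_sq, ← Complex.normSq_eq_norm_sq, Complex.normSq_apply,
    Complex.normSq_apply, pow_two w]
  simp only [Complex.add_re, Complex.one_re, Complex.mul_re, Complex.add_im, Complex.one_im,
    Complex.mul_im]
  ring

theorem norm_gInv_sq (w : ℂ) :
    ‖gInv w‖ ^ 2 = (1 + ‖w‖ ^ 2 + 2 * w.im) / (1 + ‖w‖ ^ 2 - 2 * w.im) := by
  rw [gInv, norm_div, div_pow, ← Complex.normSq_eq_norm_sq, ← Complex.normSq_eq_norm_sq,
    ← Complex.normSq_eq_norm_sq, Complex.normSq_apply, Complex.normSq_apply, Complex.normSq_apply]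
  simp only [Complex.add_re, Complex.add_im, Complex.sub_re, Complex.sub_im, Complex.I_re,
    Complex.I_im]
  congr 1 <;> ring

/-- The slit map pushes points away from the unit disc, that is, `|g⁻¹ ∘ φ^δ| ≥ |g⁻¹|`: with
`r(w) = Im w / (1 + |w|²)` one has `4 r(w)² = 1 - |1 + w²|² / (1 + |w|²)²`,
and `|1 + φ²| = (1 - δ²) |1 + w²|` while `1 + |φ|² ≥ (1 - δ²)(1 + |w|²)`. -/
theorem one_le_norm_one_add_slitExcess (hδ : δ ∈ Set.Ioo (0 : ℝ) 1) (hw : 0 < w.im)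
    (hw1 : 1 + w ^ 2 ≠ 0) : 1 ≤ ‖1 + slitExcess δ w‖ := by
  have h2 : 0 < 1 - δ ^ 2 := by nlinarith [hδ.1, hδ.2]
  have hp := phiMap_im_pos hδ hw
  have hp1 : 1 + phiMap δ w ^ 2 ≠ 0 := by
    rw [one_add_phiMap_sq]; exact mul_ne_zero (one_sub_sq_ne_zero hδ) hw1
  have e1 := norm_one_add_sq_sq w
  have e2 := norm_one_add_sq_sq (phiMap δ w)
  have e : (1 - (δ : ℂ) ^ 2) = ((1 - δ ^ 2 : ℝ) : ℂ) := by push_cast; ring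
  rw [one_add_phiMap_sq, e, norm_mul, Complex.norm_real, Real.norm_of_nonneg h2.le, mul_pow,
    e1] at e2
  have h3 := le_norm_phiMap_sq hδ w
  have hx1 : 0 < ‖1 + w ^ 2‖ ^ 2 := by have := norm_pos_iff.2 hw1; positivity
  have hx2 : 0 < ‖1 + phiMap δ w ^ 2‖ ^ 2 := by have := norm_pos_iff.2 hp1; positivity
  rw [norm_one_add_sq_sq] at hx1 hx2
  set A := 1 + ‖w‖ ^ 2 with hA
  set B := 1 + ‖phiMap δ w‖ ^ 2 with hB
  have hAp : 0 < A := by positivity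
  have hBp : 0 < B := by positivity
  set a := w.im
  set b := (phiMap δ w).im
  have hAB : (1 - δ ^ 2) * A ≤ B := by rw [hA, hB]; linarith
  have hAa : 0 < A - 2 * a := by nlinarith
  have hBb : 0 < B - 2 * b := by nlinarith
  -- `r(w) ≤ r(φ)`, compared through the squares.
  have hr : a * B ≤ b * A := by
    apply le_of_sq_le_sq _ (by positivity)
    have : ((1 - δ ^ 2) * A) ^ 2 ≤ B ^ 2 := by gcongr
    have h5 : (B ^ 2 - 4 * b ^ 2) * A ^ 2 ≤ (A ^ 2 - 4 * a ^ 2) * B ^ 2 := by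
      rw [← e2]
      nlinarith
    nlinarith
  have hg : ‖gInv w‖ ^ 2 ≤ ‖gInv (phiMap δ w)‖ ^ 2 := by
    rw [norm_gInv_sq, norm_gInv_sq, div_le_div_iff₀ hAa hBb]
    nlinarith
  have hg0 : 0 < ‖gInv w‖ ^ 2 := by
    rw [norm_gInv_sq]
    apply div_pos _ hAa
    positivity
  rw [gInv_phiMap hδ hw hw1, norm_mul, mul_pow] at hg
  have : 1 ≤ ‖1 + slitExcess δ w‖ ^ 2 := by
    by_contra! h
    nlinarith
  exact (one_le_sq_iff₀ (norm_nonneg _)).1 this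

theorem gInv_im (w : ℂ) :
    (gInv w).im = -2 * w.re / Complex.normSq (Complex.I - w) := by
  rw [gInv, Complex.div_im, Complex.normSq_apply]
  simp only [Complex.add_re, Complex.add_im, Complex.sub_re, Complex.sub_im, Complex.I_re,
    Complex.I_im]
  ring

theorem differentiableAt_phiMap (hδ : δ ∈ Set.Ioo (0 : ℝ) 1) (hw : 0 < w.im) :
    DifferentiableAt ℂ (phiMap δ) w := by
  unfold phiMap
  refine DifferentiableAt.const_mul (DifferentiableAt.cpow_const (by fun_prop) ?_) _
  exact sq_sub_mem_slitPlane hδ hw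

theorem differentiableAt_slitExcess (hδ : δ ∈ Set.Ioo (0 : ℝ) 1) (hw : 0 < w.im) :
    DifferentiableAt ℂ (slitExcess δ) w := by
  unfold slitExcess
  have := differentiableAt_phiMap hδ hw
  refine DifferentiableAt.div (by fun_prop) (by fun_prop) ?_
  exact mul_ne_zero (mul_ne_zero (one_sub_sq_ne_zero hδ) (phiMap_add_ne_zero hδ hw))
    (add_I_ne_zero hw)

/-- The principal logarithm is additive along `g⁻¹(φ^δ(w)) = g⁻¹(w) (1 + slitExcess)`, since both
`g⁻¹` values lie in the same half of the plane cut along the real axis and the last factor has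
positive real part. -/
theorem log_gInv_phiMap (hδ : δ ∈ Set.Ioo (0 : ℝ) 1) (hw : 0 < w.im) (hw1 : 1 + w ^ 2 ≠ 0)
    (hs : ‖slitExcess δ w‖ < 1) :
    Complex.log (gInv (phiMap δ w)) = Complex.log (gInv w) + Complex.log (1 + slitExcess δ w) := by
  have hp1 : 1 + phiMap δ w ^ 2 ≠ 0 := by
    rw [one_add_phiMap_sq]; exact mul_ne_zero (one_sub_sq_ne_zero hδ) hw1
  have hre : 0 < (1 + slitExcess δ w).re := by
    have := Complex.abs_re_le_norm (slitExcess δ w)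
    have := neg_abs_le (slitExcess δ w).re
    simp only [Complex.add_re, Complex.one_re]
    linarith
  have hm := gInv_phiMap hδ hw hw1
  have hs0 : 1 + slitExcess δ w ≠ 0 := by intro h; rw [h] at hre; simp at hre
  have hI : Complex.I + w ≠ 0 := by rw [add_comm]; exact add_I_ne_zero hw
  have hg0 : gInv w ≠ 0 := div_ne_zero hI (I_sub_ne_zero_of_sq hw1)
  have harg := abs_lt.1 (Complex.abs_arg_lt_pi_div_two_iff.2 (Or.inl hre))
  -- The sign of `Im g⁻¹` is opposite to that of the real part, which `φ^δ` preserves.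
  have hsgn : (gInv w).im < 0 ↔ (gInv (phiMap δ w)).im < 0 := by
    have n1 : 0 < Complex.normSq (Complex.I - w) := Complex.normSq_pos.2 (I_sub_ne_zero_of_sq hw1)
    have n2 : 0 < Complex.normSq (Complex.I - phiMap δ w) :=
      Complex.normSq_pos.2 (I_sub_ne_zero_of_sq hp1)
    rw [gInv_im, gInv_im, div_neg_iff, div_neg_iff]
    have := phiMap_re_pos_iff hδ hw
    constructor
    · rintro (h | h)
      · linarith [h.2]
      · right; exact ⟨by linarith [this.2 (by linarith [h.1])], n2⟩
    · rintro (h | h)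
      · linarith [h.2]
      · right; exact ⟨by linarith [this.1 (by linarith [h.1])], n1⟩
  have hang : ((gInv w).arg + (1 + slitExcess δ w).arg : Real.Angle)
      = ((gInv (phiMap δ w)).arg : Real.Angle) := by
    rw [hm, Complex.arg_mul_coe_angle hg0 hs0]
  rw [← Real.Angle.coe_add, Real.Angle.angle_eq_iff_two_pi_dvd_sub] at hang
  obtain ⟨k, hk⟩ := hang
  have hpi := Real.pi_pos
  have hmem : (gInv w).arg + (1 + slitExcess δ w).arg ∈ Set.Ioc (-Real.pi) Real.pi := by
    have a1 := Complex.neg_pi_lt_arg (gInv (phiMap δ w))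
    have a2 := Complex.arg_le_pi (gInv (phiMap δ w))
    have b1 := Complex.neg_pi_lt_arg (gInv w)
    have b2 := Complex.arg_le_pi (gInv w)
    -- The two arguments have the same sign, and the argument of the last factor is below `π/2`
    -- in absolute value, so the sum is off by less than `2π`.
    have hk0 : k = 0 := by
      by_cases h : (gInv w).im < 0
      · have c1 := Complex.arg_neg_iff.2 h
        have c2 := Complex.arg_neg_iff.2 (hsgn.1 h)
        have : (k : ℝ) < 1 := by by_contra! h'; nlinarith
        have : (-1 : ℝ) < k := by by_contra! h'; nlinarith
        have : k < 1 := by exact_mod_cast ‹(k : ℝ) < 1›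
        have : -1 < k := by exact_mod_cast ‹(-1 : ℝ) < k›
        omega
      · have c1 := Complex.arg_nonneg_iff.2 (not_lt.1 h)
        have c2 := Complex.arg_nonneg_iff.2 (not_lt.1 fun h' => h (hsgn.2 h'))
        have : (k : ℝ) < 1 := by by_contra! h'; nlinarith
        have : (-1 : ℝ) < k := by by_contra! h'; nlinarith
        have : k < 1 := by exact_mod_cast ‹(k : ℝ) < 1›
        have : -1 < k := by exact_mod_cast ‹(-1 : ℝ) < k›
        omega
    rw [hk0] at hk
    have : (gInv w).arg + (1 + slitExcess δ w).arg = (gInv (phiMap δ w)).arg := by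
      simp at hk; linarith
    rw [this]
    exact ⟨a1, a2⟩
  rw [hm]
  exact Complex.log_mul hg0 hs0 hmem

end HalfPlane

/-! ### Distance to the lattice of periods -/

section CylRep

variable {N : ℕ}

theorem pi_mul_natCast_pos (hN : 1 ≤ N) : 0 < Real.pi * N := by
  have : (0 : ℝ) < N := by exact_mod_cast hN
  exact mul_pos Real.pi_pos this

theorem cylRep_mem (hN : 1 ≤ N) (r : ℝ) :
    cylRep N r ∈ Set.Ico (-(Real.pi * N)) (Real.pi * N) := by
  have h := pi_mul_natCast_pos hN
  have h2 : 0 < 2 * Real.pi * N := by linarith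
  have h3 := Int.floor_le ((r + Real.pi * N) / (2 * Real.pi * N))
  have h4 := Int.lt_floor_add_one ((r + Real.pi * N) / (2 * Real.pi * N))
  rw [le_div_iff₀ h2] at h3
  rw [div_lt_iff₀ h2] at h4
  rw [cylRep]
  constructor <;> nlinarith

theorem abs_cylRep_le_pi (hN : 1 ≤ N) (r : ℝ) : |cylRep N r| ≤ Real.pi * N := by
  have := cylRep_mem hN r
  exact abs_le.2 ⟨this.1, this.2.le⟩

/-- `|cylRep N r|` is the distance of `r` to the lattice `2πNℤ`. -/
theorem abs_cylRep_le (hN : 1 ≤ N) (r : ℝ) (k : ℤ) : |cylRep N r| ≤ |r - 2 * Real.pi * N * k| := by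
  have h := pi_mul_natCast_pos hN
  have hm := cylRep_mem hN r
  set m := ⌊(r + Real.pi * N) / (2 * Real.pi * N)⌋ with hm'
  have e : r = cylRep N r + 2 * Real.pi * N * m := by rw [cylRep]; ring
  rcases eq_or_ne m k with hk | hk
  · rw [← hk]; apply le_of_eq; congr 1
  · have h1 : (1 : ℝ) ≤ |((m - k : ℤ) : ℝ)| := by
      rw [← Int.cast_abs]; exact_mod_cast Int.one_le_abs (sub_ne_zero.2 hk)
    have h2 : |2 * Real.pi * N * ((m - k : ℤ) : ℝ)| - |cylRep N r|
        ≤ |r - 2 * Real.pi * N * k| := by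
      have : r - 2 * Real.pi * N * k
          = 2 * Real.pi * N * ((m - k : ℤ) : ℝ) - (-cylRep N r) := by
        push_cast; linear_combination e
      rw [this, ← abs_neg (cylRep N r)]
      exact abs_sub_abs_le_abs_sub _ _
    have h3 := abs_cylRep_le_pi hN r
    rw [abs_mul, abs_of_pos (show 0 < 2 * Real.pi * N by linarith)] at h2
    nlinarith

theorem abs_cylRep_le_abs (hN : 1 ≤ N) (r : ℝ) : |cylRep N r| ≤ |r| := by
  simpa using abs_cylRep_le hN r 0

theorem abs_cylRep_le_add (hN : 1 ≤ N) (r s : ℝ) : |cylRep N r| ≤ |cylRep N s| + |r - s| := by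
  have h := abs_cylRep_le hN r ⌊(s + Real.pi * N) / (2 * Real.pi * N)⌋
  refine h.trans ?_
  have : r - 2 * Real.pi * N * (⌊(s + Real.pi * N) / (2 * Real.pi * N)⌋ : ℝ)
      = cylRep N s + (r - s) := by rw [cylRep]; ring
  rw [this]
  exact abs_add_le _ _

theorem continuous_abs_cylRep (hN : 1 ≤ N) : Continuous fun r => |cylRep N r| := by
  refine (LipschitzWith.of_dist_le_mul (K := 1) fun r s => ?_).continuous
  rw [Real.dist_eq, Real.dist_eq, NNReal.coe_one, one_mul, abs_sub_le_iff]
  have h1 := abs_cylRep_le_add hN r s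
  have h2 := abs_cylRep_le_add hN s r
  rw [abs_sub_comm s r] at h2
  constructor <;> linarith

theorem cylRep_add_period (hN : 1 ≤ N) (r : ℝ) : cylRep N (r + 2 * Real.pi * N) = cylRep N r := by
  have h := pi_mul_natCast_pos hN
  have e : (r + 2 * Real.pi * N + Real.pi * N) / (2 * Real.pi * N)
      = (r + Real.pi * N) / (2 * Real.pi * N) + 1 := by
    rw [show r + 2 * Real.pi * N + Real.pi * N = r + Real.pi * N + 2 * Real.pi * N by ring,
      add_div, div_self (by linarith : 2 * Real.pi * N ≠ 0)]
  rw [cylRep, cylRep, e, Int.floor_add_one]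
  push_cast
  ring

/-- A point of the window `[-πN, πN]` that is far from the origin is far from `u` modulo the
lattice of periods. -/
theorem abs_sub_le_abs_cylRep (hN : 1 ≤ N) {u x : ℝ} (hx : |x| ≤ Real.pi * N) :
    |x| - |u| ≤ |cylRep N (u - x)| := by
  have h := pi_mul_natCast_pos hN
  set m := ⌊(u - x + Real.pi * N) / (2 * Real.pi * N)⌋ with hm
  have e : cylRep N (u - x) = u - x - 2 * Real.pi * N * m := by rw [cylRep]
  rw [e]
  rcases eq_or_ne m 0 with h0 | h0
  · rw [h0]; simp only [Int.cast_zero, mul_zero, sub_zero]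
    rw [abs_sub_comm]; exact abs_sub_abs_le_abs_sub _ _
  · have h1 : (1 : ℝ) ≤ |(m : ℝ)| := by
      rw [← Int.cast_abs]; exact_mod_cast Int.one_le_abs h0
    have h2 : |2 * Real.pi * N * (m : ℝ)| = 2 * Real.pi * N * |(m : ℝ)| := by
      rw [abs_mul, abs_of_pos (show 0 < 2 * Real.pi * N by linarith)]
    have h3 : |2 * Real.pi * N * (m : ℝ)| - |u - x| ≤ |u - x - 2 * Real.pi * N * m| := by
      rw [abs_sub_comm (u - x)]; exact abs_sub_abs_le_abs_sub _ _
    have h4 : |u - x| ≤ |u| + |x| := abs_sub _ _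
    nlinarith

end CylRep

/-! ### The slit map of the cylinder -/

/-- The map `q ↦ i(1 - q)/(1 + q)` of the unit disc onto the upper half-plane; at
`q = e^{iz/N}` it is `g(f_N(z))`. -/
def discToHalf (q : ℂ) : ℂ := Complex.I * (1 - q) / (1 + q)

/-- The displacement `S(z) - z` of the slit map of the cylinder, as a function of
`q = e^{iz/N}` in the unit disc. -/
def slitJumpDisc (N : ℕ) (δ : ℝ) (q : ℂ) : ℂ :=
  Complex.I * N * Complex.log (1 + slitExcess δ (discToHalf q))

/-- The displacement `S(z) - z` of the slit map of the cylinder, as a periodic function on the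
upper half-plane. -/
def slitJump (N : ℕ) (δ : ℝ) (z : ℂ) : ℂ := slitJumpDisc N δ (Complex.exp (Complex.I * z / N))

section Disc

variable {q : ℂ}

theorem one_add_ne_zero_of_norm_lt_one (hq : ‖q‖ < 1) : 1 + q ≠ 0 := by
  intro h
  have : q = -1 := by linear_combination h
  rw [this] at hq; simp at hq

theorem one_sub_ne_zero_of_norm_lt_one (hq : ‖q‖ < 1) : 1 - q ≠ 0 := by
  intro h
  have : q = 1 := by linear_combination -h
  rw [this] at hq; simp at hq

theorem discToHalf_im_pos (hq : ‖q‖ < 1) : 0 < (discToHalf q).im := by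
  have h1 : 0 < Complex.normSq (1 + q) := Complex.normSq_pos.2 (one_add_ne_zero_of_norm_lt_one hq)
  have h2 : Complex.normSq q < 1 := by
    rw [Complex.normSq_eq_norm_sq]; nlinarith [norm_nonneg q]
  have : (discToHalf q).im = (1 - Complex.normSq q) / Complex.normSq (1 + q) := by
    rw [discToHalf, Complex.div_im, ← sub_div]
    congr 1
    simp [Complex.normSq_apply]
    ring
  rw [this]
  exact div_pos (by linarith) h1

theorem one_add_discToHalf_sq (hq : ‖q‖ < 1) (hq0 : q ≠ 0) : 1 + discToHalf q ^ 2 ≠ 0 := by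
  have h1 := one_add_ne_zero_of_norm_lt_one hq
  have : 1 + discToHalf q ^ 2 = 4 * q / (1 + q) ^ 2 := by
    rw [discToHalf, div_pow, mul_pow, Complex.I_sq]
    field_simp
    ring
  rw [this]
  exact div_ne_zero (mul_ne_zero (by norm_num) hq0) (pow_ne_zero _ h1)

theorem gInv_discToHalf (hq : ‖q‖ < 1) (hq0 : q ≠ 0) : gInv (discToHalf q) = q⁻¹ := by
  have h1 := one_add_ne_zero_of_norm_lt_one hq
  have h4 := I_sub_ne_zero_of_sq (one_add_discToHalf_sq hq hq0)
  rw [gInv, div_eq_iff h4, discToHalf]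
  field_simp
  ring

/-- Together with `norm_slitExcess_le` this bounds the excess by the distance to the tip `q = 1`. -/
theorem norm_one_sub_le_discToHalf (hq : ‖q‖ < 1) : ‖1 - q‖ / 2 ≤ ‖discToHalf q‖ := by
  have h1 := norm_pos_iff.2 (one_add_ne_zero_of_norm_lt_one hq)
  rw [discToHalf, norm_div, norm_mul, Complex.norm_I, one_mul]
  have : ‖1 + q‖ ≤ 2 := by
    have := norm_add_le 1 q
    rw [norm_one] at this; linarith
  gcongr

theorem norm_slitExcess_discToHalf_le {δ : ℝ} (hδ : δ ∈ Set.Ioc (0 : ℝ) (1 / 2)) (hq : ‖q‖ < 1) :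
    ‖slitExcess δ (discToHalf q)‖ ≤ 11 * δ ^ 2 / ‖1 - q‖ := by
  have h0 := norm_pos_iff.2 (one_sub_ne_zero_of_norm_lt_one hq)
  have h1 := norm_slitExcess_le ⟨hδ.1, lt_of_le_of_lt hδ.2 (by norm_num)⟩ (discToHalf_im_pos hq)
  have h2 := norm_one_sub_le_discToHalf hq
  refine h1.trans ?_
  have h3 : 3 / 4 ≤ 1 - δ ^ 2 := by nlinarith [hδ.1, hδ.2]
  have h4 : 3 / 4 * (‖1 - q‖ / 2) ≤ (1 - δ ^ 2) * ‖discToHalf q‖ := by gcongr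
  rw [div_le_div_iff₀ (lt_of_lt_of_le (by positivity) h4) h0]
  nlinarith [sq_nonneg δ]

theorem differentiableAt_slitJumpDisc {N : ℕ} {δ : ℝ} (hδ : δ ∈ Set.Ioo (0 : ℝ) 1) (hq : ‖q‖ < 1)
    (hs : ‖slitExcess δ (discToHalf q)‖ < 1) : DifferentiableAt ℂ (slitJumpDisc N δ) q := by
  have h1 : DifferentiableAt ℂ discToHalf q := by
    unfold discToHalf
    exact DifferentiableAt.div (by fun_prop) (by fun_prop) (one_add_ne_zero_of_norm_lt_one hq)
  have h2 : DifferentiableAt ℂ (fun q => slitExcess δ (discToHalf q)) q :=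
    (differentiableAt_slitExcess hδ (discToHalf_im_pos hq)).comp q h1
  unfold slitJumpDisc
  refine DifferentiableAt.const_mul (DifferentiableAt.clog (h2.const_add 1) ?_) _
  exact Complex.mem_slitPlane_of_norm_lt_one hs

end Disc

theorem norm_exp_I_mul_div (N : ℕ) (z : ℂ) :
    ‖Complex.exp (Complex.I * z / N)‖ = Real.exp (-z.im / N) := by
  rw [Complex.norm_exp]
  congr 1
  rw [show (N : ℂ) = ((N : ℝ) : ℂ) by simp, Complex.div_ofReal_re]
  simp

theorem norm_exp_I_mul_div_lt_one {N : ℕ} (hN : 1 ≤ N) {z : ℂ} (hz : 0 < z.im) :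
    ‖Complex.exp (Complex.I * z / N)‖ < 1 := by
  have : (0 : ℝ) < N := by exact_mod_cast hN
  rw [norm_exp_I_mul_div, Real.exp_lt_one_iff]
  exact div_neg_of_neg_of_pos (by linarith) this

theorem gMap_fMap (N : ℕ) (z : ℂ) :
    gMap (fMap N z) = discToHalf (Complex.exp (Complex.I * z / N)) := by
  have h0 := Complex.exp_ne_zero (Complex.I * z / N)
  have e : fMap N z = (Complex.exp (Complex.I * z / N))⁻¹ := by
    rw [fMap, ← Complex.exp_neg]; congr 1; ring
  rw [e, gMap, discToHalf, ← mul_div_mul_right _ _ h0]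
  congr 1
  · rw [mul_assoc, sub_mul, inv_mul_cancel₀ h0, one_mul]
  · rw [add_mul, inv_mul_cancel₀ h0, one_mul]

/-- The point of the fundamental domain over the same point of the cylinder. -/
theorem fInv_fMap {N : ℕ} (hN : 1 ≤ N) (z : ℂ) :
    fInv N (fMap N z) = cylRep N z.re + z.im * Complex.I := by
  have hN' : (0 : ℝ) < N := by exact_mod_cast hN
  have hNc : (N : ℂ) ≠ 0 := by exact_mod_cast hN'.ne'
  have hm := cylRep_mem hN z.re
  set m := ⌊(z.re + Real.pi * N) / (2 * Real.pi * N)⌋ with hm'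
  set z' : ℂ := cylRep N z.re + z.im * Complex.I with hz'
  have e : z = z' + 2 * Real.pi * N * m := by
    rw [hz', cylRep, ← hm']
    push_cast
    linear_combination -(Complex.re_add_im z)
  have e2 : fMap N z = Complex.exp (-Complex.I * z' / N) := by
    rw [fMap, e, Complex.exp_eq_exp_iff_exists_int]
    refine ⟨-m, ?_⟩
    push_cast
    field_simp
    ring
  have him : (-Complex.I * z' / N).im = -(cylRep N z.re) / N := by
    rw [show (N : ℂ) = ((N : ℝ) : ℂ) by simp, Complex.div_ofReal_im]
    simp [hz']
  rw [e2, fInv, Complex.log_exp]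
  · field_simp
    rw [Complex.I_sq]; ring
  · rw [him, lt_div_iff₀ hN']; linarith [hm.2]
  · rw [him, div_le_iff₀ hN']; linarith [hm.1]

/-- The lifted slit map at `x` moves `z` by `slitJump (z - x)`. -/
theorem slitAt_eq {N : ℕ} (hN : 1 ≤ N) {δ : ℝ} (hδ : δ ∈ Set.Ioo (0 : ℝ) 1) (x : ℝ) {z : ℂ}
    (hz : 0 < z.im)
    (hs : ‖slitExcess δ (discToHalf (Complex.exp (Complex.I * (z - x) / N)))‖ < 1) :
    slitAt N δ x z = z + slitJump N δ (z - x) := by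
  have hz' : 0 < (z - x).im := by simpa using hz
  have hq := norm_exp_I_mul_div_lt_one hN hz'
  have hq0 := Complex.exp_ne_zero (Complex.I * (z - x) / N)
  have h1 := log_gInv_phiMap hδ (discToHalf_im_pos hq) (one_add_discToHalf_sq hq hq0) hs
  have h2 := fInv_fMap hN (z - x)
  have e : fMap N (z - x) = (Complex.exp (Complex.I * (z - x) / N))⁻¹ := by
    rw [fMap, ← Complex.exp_neg]; congr 1; ring
  rw [e] at h2
  rw [slitAt, cylSlit, gMap_fMap, fInv, h1, gInv_discToHalf hq hq0, mul_add, slitJump, slitJumpDisc]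
  rw [fInv] at h2
  rw [h2]
  simp only [Complex.sub_re, Complex.ofReal_re, Complex.sub_im, Complex.ofReal_im, sub_zero]
  linear_combination Complex.re_add_im z

/-! ### Bounds on the displacement that are uniform in the circumference -/

/-- The displacement `S^{N,δ}(z) - z` at the parameter `δ = δ(N, λ)`. -/
def jump (lam : ℝ) (N : ℕ) (z : ℂ) : ℂ := slitJump N (slitParam N lam) z

/-- The range of `N` in which the displacement is under control on `{Im z ≥ y}`: there
`δ(N, λ) ≤ 1/2` and `|slitExcess| ≤ 1/2`. -/
structure IsLarge (lam y : ℝ) (N : ℕ) : Prop where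
  lam_pos : 0 < lam
  y_pos : 0 < y
  one_le : 1 ≤ N
  two_mul_lam_le : 2 * lam ≤ N
  y_le : y ≤ N
  -- Half of `N` bounds `11 λ² / (N |1 - q|)`, where `N |1 - q| ≥ y / 2`.
  excess_le : 44 * lam ^ 2 / y ≤ N

theorem eventually_isLarge {lam y : ℝ} (hlam : 0 < lam) (hy : 0 < y) :
    ∀ᶠ N : ℕ in Filter.atTop, IsLarge lam y N := by
  have h := tendsto_natCast_atTop_atTop (R := ℝ)
  filter_upwards [Filter.eventually_ge_atTop 1, h.eventually_ge_atTop (2 * lam),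
    h.eventually_ge_atTop y, h.eventually_ge_atTop (44 * lam ^ 2 / y)] with N h1 h2 h3 h4
  exact ⟨hlam, hy, h1, h2, h3, h4⟩

theorem slitParam_pos {lam : ℝ} (hlam : 0 < lam) {N : ℕ} (hN : 1 ≤ N) : 0 < slitParam N lam := by
  have hN' : (0 : ℝ) < N := by exact_mod_cast hN
  have := Real.add_one_lt_exp (div_pos hlam hN').ne'
  have h2 := div_pos hlam hN'
  rw [slitParam, sub_pos, div_lt_one (by positivity)]
  linarith

theorem natCast_mul_slitParam_eq (lam : ℝ) (N : ℕ) :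
    N * slitParam N lam
      = (N * (Real.exp (lam / N) - 1)) / (1 + Real.exp (lam / N)) := by
  have : 1 + Real.exp (lam / N) ≠ 0 := by positivity
  rw [slitParam]
  field_simp
  ring

theorem natCast_mul_exp_sub_one_le (lam : ℝ) {N : ℕ} (hN : 1 ≤ N) :
    N * (Real.exp (lam / N) - 1) ≤ lam * Real.exp (lam / N) := by
  have hN' : (0 : ℝ) < N := by exact_mod_cast hN
  have h := Real.add_one_le_exp (-(lam / N))
  have h1 : Real.exp (-(lam / N)) * Real.exp (lam / N) = 1 := by
    rw [← Real.exp_add]; simp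
  have h2 : (-(lam / N) + 1) * Real.exp (lam / N) ≤ 1 := by
    have := mul_le_mul_of_nonneg_right h (Real.exp_pos (lam / N)).le
    linarith
  have h3 : N * ((-(lam / N) + 1) * Real.exp (lam / N)) ≤ N * 1 := by gcongr
  have h4 : N * ((-(lam / N) + 1) * Real.exp (lam / N))
      = (N - lam) * Real.exp (lam / N) := by field_simp; ring
  linarith

theorem natCast_mul_slitParam_le {lam : ℝ} (hlam : 0 < lam) {N : ℕ} (hN : 1 ≤ N) :
    N * slitParam N lam ≤ lam := by
  rw [natCast_mul_slitParam_eq, div_le_iff₀ (by positivity)]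
  have := natCast_mul_exp_sub_one_le lam hN
  linarith

section Large

variable {lam y : ℝ} {N : ℕ}

theorem IsLarge.cast_pos (h : IsLarge lam y N) : (0 : ℝ) < N := by exact_mod_cast h.one_le

theorem IsLarge.slitParam_mem (h : IsLarge lam y N) :
    slitParam N lam ∈ Set.Ioc (0 : ℝ) (1 / 2) := by
  refine ⟨slitParam_pos h.lam_pos h.one_le, ?_⟩
  have h1 := natCast_mul_slitParam_le h.lam_pos h.one_le
  have h2 := h.two_mul_lam_le
  have := h.cast_pos
  nlinarith

theorem IsLarge.slitParam_mem' (h : IsLarge lam y N) : slitParam N lam ∈ Set.Ioo (0 : ℝ) 1 :=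
  ⟨h.slitParam_mem.1, lt_of_le_of_lt h.slitParam_mem.2 (by norm_num)⟩

theorem IsLarge.mul_one_sub_exp (h : IsLarge lam y N) : y / 2 ≤ N * (1 - Real.exp (-y / N)) := by
  have hN := h.cast_pos
  have h0 := h.y_pos
  have h1 := h.y_le
  have h2 := Real.add_one_le_exp (y / N)
  have h3 : Real.exp (-y / N) * Real.exp (y / N) = 1 := by
    rw [← Real.exp_add, neg_div]; simp
  have h4 : Real.exp (-y / N) * (y / N + 1) ≤ 1 := by
    have := mul_le_mul_of_nonneg_left h2 (Real.exp_pos (-y / N)).le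
    linarith
  have h5 : Real.exp (-y / N) * (y + N) ≤ N := by
    have : Real.exp (-y / N) * (y + N) = N * (Real.exp (-y / N) * (y / N + 1)) := by
      field_simp
    rw [this]; nlinarith
  have h6 := Real.exp_pos (-y / N)
  nlinarith

theorem IsLarge.mul_norm_one_sub (h : IsLarge lam y N) {q : ℂ} (hq : ‖q‖ ≤ Real.exp (-y / N)) :
    y / 2 ≤ N * ‖1 - q‖ := by
  refine h.mul_one_sub_exp.trans ?_
  have := h.cast_pos
  have h1 : 1 - ‖q‖ ≤ ‖1 - q‖ := by simpa using norm_sub_norm_le (1 : ℂ) q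
  gcongr
  linarith

theorem IsLarge.norm_lt_one (h : IsLarge lam y N) {q : ℂ} (hq : ‖q‖ ≤ Real.exp (-y / N)) :
    ‖q‖ < 1 := by
  refine hq.trans_lt ?_
  rw [Real.exp_lt_one_iff]
  exact div_neg_of_neg_of_pos (by linarith [h.y_pos]) h.cast_pos

theorem IsLarge.norm_slitExcess_le (h : IsLarge lam y N) {q : ℂ} (hq : ‖q‖ ≤ Real.exp (-y / N)) :
    N * ‖slitExcess (slitParam N lam) (discToHalf q)‖ ≤ 11 * lam ^ 2 / (N * ‖1 - q‖) := by
  have hN := h.cast_pos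
  have h1 := norm_slitExcess_discToHalf_le h.slitParam_mem (h.norm_lt_one hq)
  have h2 := natCast_mul_slitParam_le h.lam_pos h.one_le
  have h3 := norm_pos_iff.2 (one_sub_ne_zero_of_norm_lt_one (h.norm_lt_one hq))
  have h4 := h.slitParam_mem.1
  calc _ ≤ N * (11 * slitParam N lam ^ 2 / ‖1 - q‖) := by gcongr
    _ = 11 * (N * slitParam N lam) ^ 2 / (N * ‖1 - q‖) := by field_simp
    _ ≤ _ := by gcongr

theorem IsLarge.norm_slitExcess_le_half (h : IsLarge lam y N) {q : ℂ}
    (hq : ‖q‖ ≤ Real.exp (-y / N)) :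
    ‖slitExcess (slitParam N lam) (discToHalf q)‖ ≤ 1 / 2 := by
  have hN := h.cast_pos
  have hy := h.y_pos
  have h1 := h.norm_slitExcess_le hq
  have h2 := h.mul_norm_one_sub hq
  have h3 := h.excess_le
  rw [div_le_iff₀ hy] at h3
  have h4 : 11 * lam ^ 2 / (N * ‖1 - q‖) ≤ 11 * lam ^ 2 / (y / 2) := by gcongr
  have h5 : 11 * lam ^ 2 / (y / 2) ≤ N * (1 / 2) := by
    rw [div_le_iff₀ (by positivity)]; linarith
  exact le_of_mul_le_mul_left (h1.trans (h4.trans h5)) hN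

theorem IsLarge.norm_exp_le (h : IsLarge lam y N) {z : ℂ} (hz : y ≤ z.im) :
    ‖Complex.exp (Complex.I * z / N)‖ ≤ Real.exp (-y / N) := by
  have := h.cast_pos
  rw [norm_exp_I_mul_div]
  gcongr

theorem IsLarge.differentiableAt_slitJumpDisc (h : IsLarge lam y N) {q : ℂ}
    (hq : ‖q‖ ≤ Real.exp (-y / N)) :
    DifferentiableAt ℂ (slitJumpDisc N (slitParam N lam)) q :=
  CHL.differentiableAt_slitJumpDisc h.slitParam_mem' (h.norm_lt_one hq)
    ((h.norm_slitExcess_le_half hq).trans_lt (by norm_num))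

theorem IsLarge.differentiableAt_jump (h : IsLarge lam y N) {z : ℂ} (hz : y ≤ z.im) :
    DifferentiableAt ℂ (jump lam N) z := by
  have h1 := h.differentiableAt_slitJumpDisc (h.norm_exp_le hz)
  have h2 : DifferentiableAt ℂ (fun z => Complex.exp (Complex.I * z / N)) z := by fun_prop
  have h3 : DifferentiableAt ℂ (slitJumpDisc N (slitParam N lam)
      ∘ fun z => Complex.exp (Complex.I * z / N)) z := h1.comp z h2
  exact h3

theorem IsLarge.slitAt_eq (h : IsLarge lam y N) (x : ℝ) {z : ℂ} (hz : y ≤ z.im) :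
    slitAt N (slitParam N lam) x z = z + jump lam N (z - x) := by
  refine CHL.slitAt_eq h.one_le h.slitParam_mem' x (h.y_pos.trans_le hz) ?_
  exact (h.norm_slitExcess_le_half (h.norm_exp_le (by simpa using hz))).trans_lt (by norm_num)

/-- The slit map does not decrease imaginary parts, so `{Im z ≥ y}` is preserved. -/
theorem IsLarge.jump_im_nonneg (h : IsLarge lam y N) {z : ℂ} (hz : y ≤ z.im) :
    0 ≤ (jump lam N z).im := by
  have hq := h.norm_lt_one (h.norm_exp_le hz)
  have h1 := one_le_norm_one_add_slitExcess h.slitParam_mem' (discToHalf_im_pos hq)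
    (one_add_discToHalf_sq hq (Complex.exp_ne_zero _))
  have h2 := Real.log_nonneg h1
  rw [jump, slitJump, slitJumpDisc]
  simp only [Complex.mul_im, Complex.mul_re, Complex.I_re, Complex.I_im, Complex.natCast_re,
    Complex.natCast_im, Complex.log_re]
  have := h.cast_pos
  ring_nf
  positivity

/-- `N |1 - e^{iz/N}|` dominates the horizontal distance to the lattice of periods; by
`IsLarge.mul_norm_one_sub` it also dominates the height. -/
theorem IsLarge.abs_cylRep_le (h : IsLarge lam y N) (z : ℂ) :
    |cylRep N z.re| / Real.pi ≤ N * ‖1 - Complex.exp (Complex.I * z / N)‖ := by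
  have hN := h.cast_pos
  have hpi := Real.pi_pos
  set d := cylRep N z.re with hd
  set r := Real.exp (-z.im / N) with hr
  have hr0 : 0 < r := Real.exp_pos _
  have hcos : (Complex.exp (Complex.I * z / N)).re = r * Real.cos (d / N) := by
    have e : (Complex.I * z / N) = ((-z.im / N : ℝ) : ℂ) + ((z.re / N : ℝ) : ℂ) * Complex.I := by
      push_cast
      linear_combination (-Complex.I / N) * Complex.re_add_im z + (z.im / N : ℂ) * Complex.I_sq
    have e2 : z.re / N = d / N
        + (⌊(z.re + Real.pi * N) / (2 * Real.pi * N)⌋ : ℤ) * (2 * Real.pi) := by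
      rw [hd, cylRep]; field_simp; ring
    rw [e, Complex.exp_re]
    simp only [Complex.add_re, Complex.ofReal_re, Complex.mul_re, Complex.I_re, mul_zero,
      Complex.ofReal_im, Complex.I_im, mul_one, sub_self, add_zero, Complex.add_im,
      Complex.mul_im, zero_add]
    rw [e2, Real.cos_add_int_mul_two_pi]
  have hnorm : ‖Complex.exp (Complex.I * z / N)‖ = r := norm_exp_I_mul_div N z
  have hsq : ‖1 - Complex.exp (Complex.I * z / N)‖ ^ 2
      = 1 - 2 * (r * Real.cos (d / N)) + r ^ 2 := by
    rw [← hcos, ← hnorm, ← Complex.normSq_eq_norm_sq, ← Complex.normSq_eq_norm_sq,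
      Complex.normSq_apply, Complex.normSq_apply]
    simp
    ring
  have hcs : Real.cos (d / N) = 1 - 2 * Real.sin (d / N / 2) ^ 2 := by
    have h1 := Real.cos_sq_add_sin_sq (d / N / 2)
    have h2 := Real.cos_two_mul (d / N / 2)
    rw [show 2 * (d / N / 2) = d / N by ring] at h2
    rw [h2]; linarith
  have hd1 := abs_cylRep_le_pi h.one_le z.re
  rw [← hd] at hd1
  have hle : |d / N / 2| ≤ Real.pi / 2 := by
    rw [abs_div, abs_div, abs_of_pos hN, abs_two]
    have : |d| / N ≤ Real.pi := by rw [div_le_iff₀ hN]; exact hd1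
    linarith
  -- Jordan's inequality.
  have hs := Real.mul_abs_le_abs_sin hle
  have hs1 : |Real.sin (d / N / 2)| ≤ ‖1 - Complex.exp (Complex.I * z / N)‖ := by
    apply le_of_sq_le_sq _ (norm_nonneg _)
    rw [sq_abs, hsq, hcs]
    have := Real.sin_sq_le_one (d / N / 2)
    have := sq_nonneg (Real.sin (d / N / 2))
    -- The right-hand side is `(1 - r)² + 4 r sin²`.
    by_cases hr4 : 1 / 4 ≤ r
    · nlinarith [sq_nonneg (1 - r)]
    · nlinarith [sq_nonneg (1 - r)]
  have hfin : |d| / Real.pi = N * (2 / Real.pi * |d / N / 2|) := by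
    rw [abs_div, abs_div, abs_of_pos hN, abs_two]; field_simp
  rw [hfin]
  gcongr
  exact hs.trans hs1

/-- The constant in the decay of the displacement on `{Im z ≥ y}`: `17 ≥ 3/2 · 11`, and the minimum
is a factor `c` with `c (1 + dist) ≤ N |1 - e^{iz/N}|`. -/
def jumpConst (lam y : ℝ) : ℝ := 17 * lam ^ 2 / min (y / 4) (1 / (2 * Real.pi))

theorem jumpConst_nonneg (lam : ℝ) {y : ℝ} (hy : 0 < y) : 0 ≤ jumpConst lam y := by
  unfold jumpConst
  have : 0 < min (y / 4) (1 / (2 * Real.pi)) := lt_min (by positivity) (by positivity)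
  positivity

/-- The displacement decays like the inverse of the distance to the slit along the cylinder,
uniformly in the circumference. -/
theorem IsLarge.norm_jump_le (h : IsLarge lam y N) {z : ℂ} (hz : y ≤ z.im) :
    ‖jump lam N z‖ ≤ jumpConst lam y / (1 + |cylRep N z.re|) := by
  have hN := h.cast_pos
  have hy := h.y_pos
  have hpi := Real.pi_pos
  have h1 := h.norm_slitExcess_le (h.norm_exp_le hz)
  have h2 := h.norm_slitExcess_le_half (h.norm_exp_le hz)
  have h3 := h.mul_norm_one_sub (h.norm_exp_le hz)
  have h4 := h.abs_cylRep_le z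
  set c := min (y / 4) (1 / (2 * Real.pi)) with hc
  have hc0 : 0 < c := lt_min (by positivity) (by positivity)
  have hc1 : c ≤ y / 4 := min_le_left _ _
  have hc2 : c ≤ 1 / (2 * Real.pi) := min_le_right _ _
  have h5 : c * (1 + |cylRep N z.re|) ≤ N * ‖1 - Complex.exp (Complex.I * z / N)‖ := by
    have : c * |cylRep N z.re| ≤ 1 / (2 * Real.pi) * |cylRep N z.re| := by gcongr
    have e : 1 / (2 * Real.pi) * |cylRep N z.re| = (|cylRep N z.re| / Real.pi) / 2 := by
      field_simp
    linarith
  have h6 := Complex.norm_log_one_add_half_le_self h2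
  rw [jump, slitJump, slitJumpDisc, norm_mul, norm_mul, Complex.norm_I, one_mul,
    Complex.norm_natCast]
  calc _ ≤ N * (3 / 2 * ‖slitExcess (slitParam N lam)
        (discToHalf (Complex.exp (Complex.I * z / N)))‖) := by gcongr
    _ = 3 / 2 * (N * ‖slitExcess (slitParam N lam)
        (discToHalf (Complex.exp (Complex.I * z / N)))‖) := by ring
    _ ≤ 3 / 2 * (11 * lam ^ 2 / (N * ‖1 - Complex.exp (Complex.I * z / N)‖)) := by gcongr
    _ ≤ 3 / 2 * (11 * lam ^ 2 / (c * (1 + |cylRep N z.re|))) := by gcongr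
    _ = (33 / 2 * lam ^ 2) / c / (1 + |cylRep N z.re|) := by field_simp; ring
    _ ≤ _ := by
      rw [jumpConst, ← hc]
      gcongr
      norm_num

/-- The Lipschitz constant of the displacement on `{Im z ≥ 2y}`. -/
def jumpLip (lam y : ℝ) : ℝ := 2 * jumpConst lam y * (1 + y) / y

theorem jumpLip_nonneg (lam : ℝ) {y : ℝ} (hy : 0 < y) : 0 ≤ jumpLip lam y := by
  have := jumpConst_nonneg lam hy
  unfold jumpLip
  positivity

/-- The displacement is Lipschitz with a constant that decays along the cylinder: by the Schwarz
lemma for nearby points, and by the decay of the displacement itself for distant ones. -/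
theorem IsLarge.norm_jump_sub_le (h : IsLarge lam y N) {z w : ℂ} (hz : 2 * y ≤ z.im)
    (hw : 2 * y ≤ w.im) :
    ‖jump lam N z - jump lam N w‖ ≤ jumpLip lam y * ‖z - w‖
      * (1 / (1 + |cylRep N z.re|) + 1 / (1 + |cylRep N w.re|)) := by
  have hy := h.y_pos
  have hC := jumpConst_nonneg lam hy
  have hL := jumpLip_nonneg lam hy
  have hdz : 0 < 1 + |cylRep N z.re| := by positivity
  have hdw : 0 < 1 + |cylRep N w.re| := by positivity
  by_cases hd : ‖z - w‖ < y
  · have hball : ∀ ζ ∈ Metric.ball z y, y ≤ ζ.im ∧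
        ‖jump lam N ζ‖ ≤ jumpConst lam y * (1 + y) / (1 + |cylRep N z.re|) := by
      intro ζ hζ
      rw [Metric.mem_ball, dist_eq_norm] at hζ
      have h1 : y ≤ ζ.im := by
        have := (abs_le.1 (Complex.abs_im_le_norm (ζ - z))).1
        rw [Complex.sub_im] at this
        linarith
      refine ⟨h1, (h.norm_jump_le h1).trans ?_⟩
      have h2 := abs_cylRep_le_add h.one_le z.re ζ.re
      have h3 := Complex.abs_re_le_norm (ζ - z)
      rw [Complex.sub_re, abs_sub_comm] at h3
      have h4 : 0 ≤ |cylRep N ζ.re| := abs_nonneg _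
      rw [div_le_div_iff₀ (by positivity) hdz, mul_assoc]
      gcongr
      nlinarith
    have hdiff : DifferentiableOn ℂ (jump lam N) (Metric.ball z y) := fun ζ hζ =>
      (h.differentiableAt_jump (hball ζ hζ).1).differentiableWithinAt
    have hmaps : Set.MapsTo (jump lam N) (Metric.ball z y) (Metric.closedBall (jump lam N z)
        (2 * (jumpConst lam y * (1 + y) / (1 + |cylRep N z.re|)))) := by
      intro ζ hζ
      rw [Metric.mem_closedBall, dist_eq_norm]
      have h1 := (hball ζ hζ).2
      have h2 := (hball z (Metric.mem_ball_self hy)).2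
      have h3 := norm_sub_le (jump lam N ζ) (jump lam N z)
      linarith
    have hmem : w ∈ Metric.ball z y := by
      rw [Metric.mem_ball, dist_eq_norm, norm_sub_rev]; exact hd
    have hS := Complex.dist_le_div_mul_dist_of_mapsTo_ball hdiff hmaps hmem
    rw [dist_eq_norm, dist_eq_norm, norm_sub_rev, norm_sub_rev w z] at hS
    refine hS.trans ?_
    have e : 2 * (jumpConst lam y * (1 + y) / (1 + |cylRep N z.re|)) / y * ‖z - w‖
        = jumpLip lam y * ‖z - w‖ * (1 / (1 + |cylRep N z.re|)) := by
      rw [jumpLip]; field_simp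
    rw [e]
    gcongr
    have : 0 ≤ 1 / (1 + |cylRep N w.re|) := by positivity
    linarith
  · have h1 := h.norm_jump_le (z := z) (by linarith)
    have h2 := h.norm_jump_le (z := w) (by linarith)
    have h3 := norm_sub_le (jump lam N z) (jump lam N w)
    have h4 : jumpConst lam y ≤ jumpLip lam y * ‖z - w‖ := by
      calc jumpConst lam y ≤ 2 * jumpConst lam y * (1 + y) := by nlinarith
        _ = jumpLip lam y * y := by rw [jumpLip]; field_simp
        _ ≤ _ := by gcongr; linarith
    calc _ ≤ jumpConst lam y * (1 / (1 + |cylRep N z.re|) + 1 / (1 + |cylRep N w.re|)) := by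
          rw [mul_add, mul_one_div, mul_one_div]; linarith
      _ ≤ _ := by gcongr

end Large

/-! ### Sums over a grid of positions -/

/-- The mesh `π / 2ⁿ` of the grid of positions. -/
def mesh (n : ℕ) : ℝ := Real.pi / 2 ^ n

/-- The indices `i` of the grid points `i · mesh n` in the window `[-πN, πN)`. -/
def window (n N : ℕ) : Finset ℤ := Finset.Ico (-((N : ℤ) * 2 ^ n)) ((N : ℤ) * 2 ^ n)

theorem mesh_pos (n : ℕ) : 0 < mesh n := div_pos Real.pi_pos (by positivity)

theorem mesh_le_pi (n : ℕ) : mesh n ≤ Real.pi :=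
  div_le_self Real.pi_pos.le (one_le_pow₀ one_le_two)

theorem natCast_mul_two_pow_mul_mesh (n N : ℕ) : (N * 2 ^ n : ℝ) * mesh n = Real.pi * N := by
  rw [mesh]; field_simp

theorem mem_window_iff {n N : ℕ} {i : ℤ} :
    i ∈ window n N ↔ i * mesh n ∈ Set.Ico (-(Real.pi * N)) (Real.pi * N) := by
  rw [window, Finset.mem_Ico, Set.mem_Ico, ← natCast_mul_two_pow_mul_mesh n N,
    ← neg_mul (N * 2 ^ n : ℝ) (mesh n),
    mul_le_mul_iff_of_pos_right (mesh_pos n), mul_lt_mul_iff_of_pos_right (mesh_pos n)]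
  have h1 : (-(N * 2 ^ n : ℝ)) = ((-((N : ℤ) * 2 ^ n) : ℤ) : ℝ) := by push_cast; ring
  have h2 : (N * 2 ^ n : ℝ) = (((N : ℤ) * 2 ^ n : ℤ) : ℝ) := by push_cast; ring
  rw [h1, h2, Int.cast_le, Int.cast_lt]

theorem window_mono (n : ℕ) {N M : ℕ} (h : N ≤ M) : window n N ⊆ window n M := by
  intro i hi
  rw [mem_window_iff] at hi ⊢
  have h' : (N : ℝ) ≤ M := by exact_mod_cast h
  have := mul_le_mul_of_nonneg_left h' Real.pi_pos.le
  exact ⟨by linarith [hi.1], by linarith [hi.2]⟩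

theorem sum_Ico_int_integral {E : Type*} [NormedAddCommGroup E] [NormedSpace ℝ E] {f : ℝ → E}
    (hf : Continuous f) (h : ℝ) {a b : ℤ} (hab : a ≤ b) :
    ∑ i ∈ Finset.Ico a b, ∫ x in (i * h)..((i + 1) * h), f x = ∫ x in (a * h)..(b * h), f x := by
  induction b, hab using Int.leInduction with
  | base => simp
  | succ b hab ih =>
    have : Finset.Ico a (b + 1) = insert b (Finset.Ico a b) := by
      ext i; simp only [Finset.mem_Ico, Finset.mem_insert]; omega
    rw [this, Finset.sum_insert (by simp), ih, add_comm]
    push_cast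
    exact intervalIntegral.integral_add_adjacent_intervals (hf.intervalIntegrable _ _)
      (hf.intervalIntegrable _ _)

theorem sum_window_integral {E : Type*} [NormedAddCommGroup E] [NormedSpace ℝ E] {f : ℝ → E}
    (hf : Continuous f) (n N : ℕ) :
    ∑ i ∈ window n N, ∫ x in (i * mesh n)..((i + 1) * mesh n), f x
      = ∫ x in (-(Real.pi * N))..(Real.pi * N), f x := by
  rw [window, sum_Ico_int_integral hf]
  · congr 1
    · rw [← natCast_mul_two_pow_mul_mesh n N]; push_cast; ring
    · rw [← natCast_mul_two_pow_mul_mesh n N]; push_cast; ring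
  · have : (0 : ℤ) ≤ (N : ℤ) * 2 ^ n := by positivity
    omega

theorem integral_inv_sq_le {L b : ℝ} (hL : 0 ≤ L) (hb : 0 ≤ b) :
    ∫ x in (0 : ℝ)..b, 1 / (1 + L + |x|) ^ 2 ≤ 1 / (1 + L) := by
  have h1 : ∫ x in (0 : ℝ)..b, 1 / (1 + L + |x|) ^ 2 = ∫ x in (0 : ℝ)..b, 1 / (1 + L + x) ^ 2 := by
    apply intervalIntegral.integral_congr
    intro x hx
    rw [Set.uIcc_of_le hb] at hx
    simp only [abs_of_nonneg hx.1]
  have h2 : ∫ x in (0 : ℝ)..b, 1 / (1 + L + x) ^ 2 = -(1 + L + b)⁻¹ - -(1 + L + 0)⁻¹ := by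
    apply intervalIntegral.integral_eq_sub_of_hasDerivAt
    · intro x hx
      rw [Set.uIcc_of_le hb] at hx
      have h0 : 1 + L + x ≠ 0 := by linarith [hx.1]
      have := (((hasDerivAt_id x).const_add (1 + L)).inv h0).neg
      exact HasDerivAt.congr_deriv this (by simp only [id]; ring)
    · apply ContinuousOn.intervalIntegrable
      intro x hx
      rw [Set.uIcc_of_le hb] at hx
      have h0 : 1 + L + x ≠ 0 := by linarith [hx.1]
      exact ContinuousAt.continuousWithinAt (by fun_prop (disch := positivity))
  rw [h1, h2]
  have : 0 ≤ (1 + L + b)⁻¹ := by positivity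
  simp only [add_zero, one_div]
  linarith

/-- The decay kernel with an offset `L` has total mass of order `1 / (1 + L)`, uniformly in the
circumference. -/
theorem integral_inv_sq_cylRep_le {N : ℕ} (hN : 1 ≤ N) {L : ℝ} (hL : 0 ≤ L) (u : ℝ) :
    ∫ x in (-(Real.pi * N))..(Real.pi * N), 1 / (1 + L + |cylRep N (u - x)|) ^ 2
      ≤ 2 / (1 + L) := by
  have hp := pi_mul_natCast_pos hN
  have hc := continuous_abs_cylRep hN
  have hper : Function.Periodic (fun x => 1 / (1 + L + |cylRep N x|) ^ 2) (2 * Real.pi * N) := by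
    intro x; simp only [cylRep_add_period hN]
  have e1 : ∫ x in (-(Real.pi * N))..(Real.pi * N), 1 / (1 + L + |cylRep N (u - x)|) ^ 2
      = ∫ x in (u - Real.pi * N)..(u - Real.pi * N + 2 * Real.pi * N),
          1 / (1 + L + |cylRep N x|) ^ 2 := by
    rw [intervalIntegral.integral_comp_sub_left (fun x => 1 / (1 + L + |cylRep N x|) ^ 2)]
    congr 1; ring
  have e2 : ∫ x in (-(Real.pi * N))..(-(Real.pi * N) + 2 * Real.pi * N),
      1 / (1 + L + |cylRep N x|) ^ 2
      = ∫ x in (-(Real.pi * N))..(Real.pi * N), 1 / (1 + L + |x|) ^ 2 := by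
    have : -(Real.pi * N) + 2 * Real.pi * N = Real.pi * N := by ring
    rw [this]
    apply intervalIntegral.integral_congr
    intro x hx
    rw [Set.uIcc_of_le (by linarith)] at hx
    have h1 := abs_cylRep_le_abs hN x
    have h2 := abs_sub_le_abs_cylRep hN (u := 0) (x := -x) (by rw [abs_neg]; exact abs_le.2 hx)
    have h3 : |cylRep N x| = |x| := by
      apply le_antisymm h1
      simpa using h2
    simp only [h3]
  have hcont : Continuous fun x : ℝ => 1 / (1 + L + |x|) ^ 2 := by
    refine continuous_const.div (by fun_prop) fun x => ?_
    positivity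
  rw [e1, hper.intervalIntegral_add_eq _ (-(Real.pi * N)), e2,
    ← intervalIntegral.integral_add_adjacent_intervals (hcont.intervalIntegrable _ 0)
      (hcont.intervalIntegrable 0 _)]
  have e3 : ∫ x in (-(Real.pi * N))..0, 1 / (1 + L + |x|) ^ 2
      = ∫ x in (0 : ℝ)..(Real.pi * N), 1 / (1 + L + |x|) ^ 2 := by
    have := intervalIntegral.integral_comp_neg (a := 0) (b := Real.pi * N)
      (fun x : ℝ => 1 / (1 + L + |x|) ^ 2)
    simp only [abs_neg, neg_zero] at this
    exact this.symm
  rw [e3]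
  have := integral_inv_sq_le hL hp.le
  have e4 : 2 / (1 + L) = 1 / (1 + L) + 1 / (1 + L) := by ring
  linarith

/-- The constant of the comparison between grid sums and integrals of the decay kernel. -/
def gridConst : ℝ := 2 * (1 + Real.pi) ^ 2

theorem gridConst_nonneg : 0 ≤ gridConst := by unfold gridConst; positivity

/-- The kernel varies at most by the factor `(1 + π)²` over a cell, as the mesh is at most `π`. -/
theorem mesh_mul_sum_window_le (n : ℕ) {N : ℕ} (hN : 1 ≤ N) {L : ℝ} (hL : 0 ≤ L) (u : ℝ) :
    mesh n * ∑ i ∈ window n N, 1 / (1 + L + |cylRep N (u - i * mesh n)|) ^ 2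
      ≤ gridConst / (1 + L) := by
  have hh := mesh_pos n
  have hpi := Real.pi_pos
  have hcont : Continuous fun x : ℝ => 1 / (1 + L + |cylRep N (u - x)|) ^ 2 := by
    have := (continuous_abs_cylRep hN).comp (continuous_const.sub continuous_id :
      Continuous fun x : ℝ => u - x)
    refine continuous_const.div ((continuous_const.add this).pow 2) fun x => ?_
    positivity
  have key : ∀ i ∈ window n N, mesh n * (1 / (1 + L + |cylRep N (u - i * mesh n)|) ^ 2)
      ≤ (1 + Real.pi) ^ 2 * ∫ x in (i * mesh n)..((i + 1) * mesh n),
          1 / (1 + L + |cylRep N (u - x)|) ^ 2 := by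
    intro i _
    have hle : (i : ℝ) * mesh n ≤ (i + 1) * mesh n := by nlinarith
    have e : mesh n * (1 / (1 + L + |cylRep N (u - i * mesh n)|) ^ 2)
        = ∫ _ in (i * mesh n)..((i + 1) * mesh n),
            1 / (1 + L + |cylRep N (u - i * mesh n)|) ^ 2 := by
      rw [intervalIntegral.integral_const, smul_eq_mul]; ring
    rw [e, ← intervalIntegral.integral_const_mul]
    apply intervalIntegral.integral_mono_on hle
    · exact continuous_const.intervalIntegrable _ _
    · exact (hcont.const_mul _).intervalIntegrable _ _
    · intro x hx
      have h1 := abs_cylRep_le_add hN (u - x) (u - i * mesh n)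
      have h2 : |u - x - (u - i * mesh n)| ≤ Real.pi := by
        rw [abs_le]
        have := mesh_le_pi n
        constructor <;> nlinarith [hx.1, hx.2]
      have h0 : 0 ≤ |cylRep N (u - i * mesh n)| := abs_nonneg _
      rw [mul_one_div, div_le_div_iff₀ (by positivity) (by positivity), one_mul, ← mul_pow]
      gcongr
      nlinarith
  rw [Finset.mul_sum]
  refine (Finset.sum_le_sum key).trans ?_
  rw [← Finset.mul_sum, sum_window_integral hcont]
  have := integral_inv_sq_cylRep_le hN hL u
  calc _ ≤ (1 + Real.pi) ^ 2 * (2 / (1 + L)) := by gcongr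
    _ = _ := by rw [gridConst]; ring

section Large

variable {lam y : ℝ} {N : ℕ}

/-- The grid analogue of `∫ |S_x(z) - z|² dx ≤ C`. -/
theorem IsLarge.mesh_mul_sum_norm_jump_sq_le (h : IsLarge lam y N) (n : ℕ) {z : ℂ}
    (hz : y ≤ z.im) :
    mesh n * ∑ i ∈ window n N, ‖jump lam N (z - (i * mesh n : ℝ))‖ ^ 2
      ≤ jumpConst lam y ^ 2 * gridConst := by
  have h1 := mesh_mul_sum_window_le n h.one_le le_rfl z.re
  have hh := mesh_pos n
  simp only [add_zero, div_one] at h1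
  have key : ∀ i ∈ window n N, ‖jump lam N (z - (i * mesh n : ℝ))‖ ^ 2
      ≤ jumpConst lam y ^ 2 * (1 / (1 + |cylRep N (z.re - i * mesh n)|) ^ 2) := by
    intro i _
    have := h.norm_jump_le (z := z - (i * mesh n : ℝ))
      (by rw [Complex.sub_im, Complex.ofReal_im]; linarith)
    rw [Complex.sub_re, Complex.ofReal_re] at this
    rw [mul_one_div, ← div_pow]
    gcongr
  calc _ ≤ mesh n * ∑ i ∈ window n N,
        jumpConst lam y ^ 2 * (1 / (1 + |cylRep N (z.re - i * mesh n)|) ^ 2) := by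
        gcongr with i hi; exact key i hi
    _ = jumpConst lam y ^ 2 * (mesh n * ∑ i ∈ window n N,
        1 / (1 + |cylRep N (z.re - i * mesh n)|) ^ 2) := by rw [← Finset.mul_sum]; ring
    _ ≤ _ := by gcongr

/-- The grid analogue of the `L²`-Lipschitz bound
`∫ |(S_x(z) - z) - (S_x(w) - w)|² dx ≤ C |z - w|²`. -/
theorem IsLarge.mesh_mul_sum_norm_jump_sub_sq_le (h : IsLarge lam y N) (n : ℕ) {z w : ℂ}
    (hz : 2 * y ≤ z.im) (hw : 2 * y ≤ w.im) :
    mesh n * ∑ i ∈ window n N,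
        ‖jump lam N (z - (i * mesh n : ℝ)) - jump lam N (w - (i * mesh n : ℝ))‖ ^ 2
      ≤ 4 * jumpLip lam y ^ 2 * gridConst * ‖z - w‖ ^ 2 := by
  have h1 := mesh_mul_sum_window_le n h.one_le le_rfl z.re
  have h2 := mesh_mul_sum_window_le n h.one_le le_rfl w.re
  have hh := mesh_pos n
  simp only [add_zero, div_one] at h1 h2
  have key : ∀ i ∈ window n N,
      ‖jump lam N (z - (i * mesh n : ℝ)) - jump lam N (w - (i * mesh n : ℝ))‖ ^ 2
      ≤ 2 * jumpLip lam y ^ 2 * ‖z - w‖ ^ 2 * (1 / (1 + |cylRep N (z.re - i * mesh n)|) ^ 2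
        + 1 / (1 + |cylRep N (w.re - i * mesh n)|) ^ 2) := by
    intro i _
    have := h.norm_jump_sub_le (z := z - (i * mesh n : ℝ)) (w := w - (i * mesh n : ℝ))
      (by rw [Complex.sub_im, Complex.ofReal_im]; linarith)
      (by rw [Complex.sub_im, Complex.ofReal_im]; linarith)
    rw [Complex.sub_re, Complex.ofReal_re, Complex.sub_re, Complex.ofReal_re,
      sub_sub_sub_cancel_right] at this
    have h3 := pow_le_pow_left₀ (norm_nonneg _) this 2
    refine h3.trans ?_
    rw [mul_pow, mul_pow, ← one_div_pow, ← one_div_pow]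
    have h4 := add_sq_le (a := 1 / (1 + |cylRep N (z.re - i * mesh n)|))
      (b := 1 / (1 + |cylRep N (w.re - i * mesh n)|))
    calc _ ≤ jumpLip lam y ^ 2 * ‖z - w‖ ^ 2 * (2 * ((1 / (1 + |cylRep N (z.re - i * mesh n)|)) ^ 2
      + (1 / (1 + |cylRep N (w.re - i * mesh n)|)) ^ 2)) := by gcongr
      _ = _ := by ring
  calc _ ≤ mesh n * ∑ i ∈ window n N,
        2 * jumpLip lam y ^ 2 * ‖z - w‖ ^ 2 * (1 / (1 + |cylRep N (z.re - i * mesh n)|) ^ 2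
        + 1 / (1 + |cylRep N (w.re - i * mesh n)|) ^ 2) := by
        gcongr with i hi; exact key i hi
    _ = 2 * jumpLip lam y ^ 2 * ‖z - w‖ ^ 2 * (mesh n * ∑ i ∈ window n N,
        1 / (1 + |cylRep N (z.re - i * mesh n)|) ^ 2 + mesh n * ∑ i ∈ window n N,
        1 / (1 + |cylRep N (w.re - i * mesh n)|) ^ 2) := by
        rw [← Finset.mul_sum, Finset.sum_add_distrib]; ring
    _ ≤ 2 * jumpLip lam y ^ 2 * ‖z - w‖ ^ 2 * (gridConst + gridConst) := by gcongr
    _ = _ := by ring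

theorem norm_sub_sq_le_two_mul (a b : ℂ) : ‖a - b‖ ^ 2 ≤ 2 * ‖a‖ ^ 2 + 2 * ‖b‖ ^ 2 := by
  have h1 := norm_sub_le a b
  have h2 := pow_le_pow_left₀ (norm_nonneg _) h1 2
  nlinarith [sq_nonneg (‖a‖ - ‖b‖)]

/-- If the displacements at `N` and `M` are `e`-close where the slit is within distance `L` of the
origin, the grid analogue of `∫ |S^N_x(w) - S^M_x(w)|² dx` is small: the remaining slits contribute
a tail of order `1 / (L - R)`. -/
theorem IsLarge.mesh_mul_sum_norm_jump_diff_sq_le (h : IsLarge lam y N) {M : ℕ}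
    (h' : IsLarge lam y M) (hNM : N ≤ M) (n : ℕ) {w : ℂ} (hw : y ≤ w.im) {R L e : ℝ} (hR : ‖w‖ ≤ R)
    (hRL : R ≤ L) (hL : L < Real.pi * N)
    (hclose : ∀ x : ℝ, |x| ≤ L → ‖jump lam N (w - x) - jump lam M (w - x)‖ ≤ e) :
    mesh n * ∑ i ∈ window n M,
        ‖(if i ∈ window n N then jump lam N (w - (i * mesh n : ℝ)) else 0)
          - jump lam M (w - (i * mesh n : ℝ))‖ ^ 2
      ≤ e ^ 2 * (1 + L + R) ^ 2 * gridConst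
        + 16 * jumpConst lam y ^ 2 * gridConst / (1 + (L - R)) := by
  have hh := mesh_pos n
  have hLR : 0 ≤ L - R := by linarith
  have hR0 : 0 ≤ R := (norm_nonneg _).trans hR
  have hJ := jumpConst_nonneg lam h.y_pos
  have hre : |w.re| ≤ R := (Complex.abs_re_le_norm w).trans hR
  have h1 := mesh_mul_sum_window_le n h'.one_le le_rfl w.re
  have h2 := mesh_mul_sum_window_le n h'.one_le hLR w.re
  have h3 := mesh_mul_sum_window_le n h.one_le hLR w.re
  simp only [add_zero, div_one] at h1
  -- Slits at distance more than `L` from the origin are at distance at least `L - R` from `w`.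
  have tail : ∀ (K : ℕ), IsLarge lam y K → ∀ i ∈ window n K, L < |(i * mesh n : ℝ)| →
      ‖jump lam K (w - (i * mesh n : ℝ))‖ ^ 2
        ≤ 4 * jumpConst lam y ^ 2 * (1 / (1 + (L - R) + |cylRep K (w.re - i * mesh n)|) ^ 2) := by
    intro K hK i hi hiL
    have b1 := hK.norm_jump_le (z := w - (i * mesh n : ℝ))
      (by rw [Complex.sub_im, Complex.ofReal_im]; linarith)
    rw [Complex.sub_re, Complex.ofReal_re] at b1
    have b2 : L - R ≤ |cylRep K (w.re - i * mesh n)| := by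
      have hi' := mem_window_iff.1 hi
      have := abs_sub_le_abs_cylRep hK.one_le (u := w.re) (x := i * mesh n)
        (abs_le.2 ⟨hi'.1, hi'.2.le⟩)
      linarith
    have b3 : jumpConst lam y / (1 + |cylRep K (w.re - i * mesh n)|)
        ≤ 2 * jumpConst lam y / (1 + (L - R) + |cylRep K (w.re - i * mesh n)|) := by
      rw [div_le_div_iff₀ (by positivity) (by positivity)]
      nlinarith
    have b4 := pow_le_pow_left₀ (norm_nonneg _) (b1.trans b3) 2
    refine b4.trans (le_of_eq ?_)
    rw [div_pow]; ring
  have key : ∀ i ∈ window n M,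
      ‖(if i ∈ window n N then jump lam N (w - (i * mesh n : ℝ)) else 0)
          - jump lam M (w - (i * mesh n : ℝ))‖ ^ 2
      ≤ e ^ 2 * (1 + L + R) ^ 2 * (1 / (1 + |cylRep M (w.re - i * mesh n)|) ^ 2)
        + 8 * jumpConst lam y ^ 2 * (if i ∈ window n N then
            1 / (1 + (L - R) + |cylRep N (w.re - i * mesh n)|) ^ 2 else 0)
        + 8 * jumpConst lam y ^ 2 * (1 / (1 + (L - R) + |cylRep M (w.re - i * mesh n)|) ^ 2) := by
    intro i hi
    have n2 : 0 ≤ 8 * jumpConst lam y ^ 2 * (if i ∈ window n N then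
            1 / (1 + (L - R) + |cylRep N (w.re - i * mesh n)|) ^ 2 else 0) := by
      split_ifs <;> positivity
    have n3 : 0 ≤ 8 * jumpConst lam y ^ 2
        * (1 / (1 + (L - R) + |cylRep M (w.re - i * mesh n)|) ^ 2) := by positivity
    have n1 : 0 ≤ e ^ 2 * (1 + L + R) ^ 2
        * (1 / (1 + |cylRep M (w.re - i * mesh n)|) ^ 2) := by positivity
    rcases le_or_gt |(i * mesh n : ℝ)| L with hiL | hiL
    · have hiN : i ∈ window n N := by
        rw [mem_window_iff]
        have := abs_le.1 hiL
        exact ⟨by linarith, by linarith⟩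
      rw [if_pos hiN] at n2 ⊢
      rw [if_pos hiN]
      have c1 := pow_le_pow_left₀ (norm_nonneg _) (hclose (i * mesh n) hiL) 2
      have c2 : |cylRep M (w.re - i * mesh n)| ≤ L + R := by
        refine (abs_cylRep_le_abs h'.one_le _).trans ((abs_sub _ _).trans ?_)
        linarith
      have c3 : e ^ 2 ≤ e ^ 2 * (1 + L + R) ^ 2
          * (1 / (1 + |cylRep M (w.re - i * mesh n)|) ^ 2) := by
        rw [mul_assoc, mul_one_div, ← div_pow]
        apply le_mul_of_one_le_right (sq_nonneg e)
        apply one_le_pow₀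
        rw [one_le_div (by positivity)]
        linarith
      linarith
    · have t2 := tail M h' i hi hiL
      have s := norm_sub_sq_le_two_mul
        (if i ∈ window n N then jump lam N (w - (i * mesh n : ℝ)) else 0)
        (jump lam M (w - (i * mesh n : ℝ)))
      by_cases hiN : i ∈ window n N
      · have t1 := tail N h i hiN hiL
        rw [if_pos hiN] at s ⊢
        rw [if_pos hiN]
        linarith
      · rw [if_neg hiN] at s ⊢
        rw [if_neg hiN]
        rw [norm_zero] at s
        linarith
  have hsub : ∑ i ∈ window n M, (if i ∈ window n N then
      1 / (1 + (L - R) + |cylRep N (w.re - i * mesh n)|) ^ 2 else 0)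
      = ∑ i ∈ window n N, 1 / (1 + (L - R) + |cylRep N (w.re - i * mesh n)|) ^ 2 := by
    rw [← Finset.sum_filter]
    congr 1
    ext i
    simp only [Finset.mem_filter, and_iff_right_iff_imp]
    exact fun hi => window_mono n hNM hi
  calc _ ≤ mesh n * ∑ i ∈ window n M, (e ^ 2 * (1 + L + R) ^ 2
        * (1 / (1 + |cylRep M (w.re - i * mesh n)|) ^ 2)
        + 8 * jumpConst lam y ^ 2 * (if i ∈ window n N then
            1 / (1 + (L - R) + |cylRep N (w.re - i * mesh n)|) ^ 2 else 0)
        + 8 * jumpConst lam y ^ 2 * (1 / (1 + (L - R) + |cylRep M (w.re - i * mesh n)|) ^ 2)) := by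
        gcongr with i hi; exact key i hi
    _ = e ^ 2 * (1 + L + R) ^ 2 * (mesh n * ∑ i ∈ window n M,
          1 / (1 + |cylRep M (w.re - i * mesh n)|) ^ 2)
        + 8 * jumpConst lam y ^ 2 * (mesh n * ∑ i ∈ window n N,
            1 / (1 + (L - R) + |cylRep N (w.re - i * mesh n)|) ^ 2)
        + 8 * jumpConst lam y ^ 2 * (mesh n * ∑ i ∈ window n M,
            1 / (1 + (L - R) + |cylRep M (w.re - i * mesh n)|) ^ 2) := by
        rw [Finset.sum_add_distrib, Finset.sum_add_distrib, ← Finset.mul_sum, ← Finset.mul_sum,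
          ← Finset.mul_sum, hsub]
        ring
    _ ≤ e ^ 2 * (1 + L + R) ^ 2 * gridConst + 8 * jumpConst lam y ^ 2 * (gridConst / (1 + (L - R)))
        + 8 * jumpConst lam y ^ 2 * (gridConst / (1 + (L - R))) := by gcongr
    _ = _ := by ring

end Large

/-! ### The mean displacement -/

section Mean

variable {lam y : ℝ} {N : ℕ}

/-- The integral `∫ (S_x(w) - w) dx` over all positions `x` of the slit, which does not depend
on `w`. -/
def driftConst (lam : ℝ) (N : ℕ) : ℂ := (2 * Real.pi * N : ℝ) * slitJumpDisc N (slitParam N lam) 0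

/-- The mean value property in the variable `q = e^{iz/N}`, on the circle through `e^{iw/N}`. -/
theorem IsLarge.integral_jump (h : IsLarge lam y N) {w : ℂ} (hw : y ≤ w.im) :
    ∫ x in (-(Real.pi * N))..(Real.pi * N), jump lam N (w - (x : ℝ)) = driftConst lam N := by
  have hN := h.cast_pos
  have hNc : (N : ℂ) ≠ 0 := by exact_mod_cast hN.ne'
  set R := Real.exp (-w.im / N) with hR
  have hR0 : 0 < R := Real.exp_pos _
  have hRle : R ≤ Real.exp (-y / N) := by rw [hR]; gcongr
  set f := slitJumpDisc N (slitParam N lam) with hf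
  have hdiff : ∀ q ∈ Metric.closedBall (0 : ℂ) R, DifferentiableAt ℂ f q := by
    intro q hq
    rw [mem_closedBall_zero_iff] at hq
    exact h.differentiableAt_slitJumpDisc (hq.trans hRle)
  have hmean : Real.circleAverage f 0 R = f 0 := by
    apply DiffContOnCl.circleAverage
    rw [abs_of_pos hR0]
    refine ⟨fun q hq => (hdiff q (Metric.ball_subset_closedBall hq)).differentiableWithinAt, ?_⟩
    rw [closure_ball _ hR0.ne']
    exact fun q hq => (hdiff q hq).continuousAt.continuousWithinAt
  have e1 : ∀ x : ℝ, jump lam N (w - (x : ℝ)) = f (circleMap 0 R (w.re / N - x / N)) := by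
    intro x
    rw [jump, slitJump, circleMap, zero_add, hR, Complex.ofReal_exp, ← Complex.exp_add]
    congr 2
    push_cast
    linear_combination (-Complex.I / N) * Complex.re_add_im w + (w.im / N : ℂ) * Complex.I_sq
  have hper : Function.Periodic (fun θ => f (circleMap 0 R θ)) (2 * Real.pi) := by
    intro θ
    simp only [periodic_circleMap 0 R θ]
  have e2 : ∫ x in (-(Real.pi * N))..(Real.pi * N), jump lam N (w - (x : ℝ))
      = (N : ℝ) • ∫ θ in (w.re / N - Real.pi)..(w.re / N - Real.pi + 2 * Real.pi),
          f (circleMap 0 R θ) := by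
    simp only [e1]
    rw [intervalIntegral.integral_comp_sub_div (fun θ => f (circleMap 0 R θ)) hN.ne']
    congr 2
    · field_simp
    · field_simp; ring
  rw [e2, hper.intervalIntegral_add_eq _ 0, zero_add, driftConst, ← hf, ← hmean,
    Real.circleAverage_def]
  have hpi := Real.pi_pos.ne'
  rw [Complex.real_smul, Complex.real_smul, ← mul_assoc]
  congr 1
  push_cast
  have : (Real.pi : ℂ) ≠ 0 := by exact_mod_cast hpi
  field_simp

/-- The grid sum of the displacements differs from the mean displacement by the order of the
mesh. -/
theorem IsLarge.norm_mesh_mul_sum_jump_sub_le (h : IsLarge lam y N) (n : ℕ) {w : ℂ}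
    (hw : 2 * y ≤ w.im) :
    ‖(mesh n : ℂ) * ∑ i ∈ window n N, jump lam N (w - (i * mesh n : ℝ)) - driftConst lam N‖
      ≤ 4 * Real.pi * N * jumpLip lam y * mesh n := by
  have hN := h.cast_pos
  have hy := h.y_pos
  have hh := mesh_pos n
  have hL := jumpLip_nonneg lam hy
  have hcont : Continuous fun x : ℝ => jump lam N (w - (x : ℝ)) := by
    rw [continuous_iff_continuousAt]
    intro x
    have h1 : ContinuousAt (jump lam N) (w - (x : ℝ)) :=
      (h.differentiableAt_jump (by rw [Complex.sub_im, Complex.ofReal_im]; linarith)).continuousAt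
    have h2 : ContinuousAt (fun x : ℝ => w - (x : ℂ)) x := by fun_prop
    exact ContinuousAt.comp (f := fun x : ℝ => w - (x : ℂ)) h1 h2
  rw [← h.integral_jump (by linarith : y ≤ w.im), ← sum_window_integral hcont n N, Finset.mul_sum,
    ← Finset.sum_sub_distrib]
  have key : ∀ i ∈ window n N, ‖(mesh n : ℂ) * jump lam N (w - (i * mesh n : ℝ))
      - ∫ x in (i * mesh n)..((i + 1) * mesh n), jump lam N (w - (x : ℝ))‖
      ≤ 2 * jumpLip lam y * mesh n * mesh n := by
    intro i _
    have hle : (i : ℝ) * mesh n ≤ (i + 1) * mesh n := by nlinarith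
    have e : (mesh n : ℂ) * jump lam N (w - (i * mesh n : ℝ))
        = ∫ _ in (i * mesh n)..((i + 1) * mesh n), jump lam N (w - (i * mesh n : ℝ)) := by
      rw [intervalIntegral.integral_const, Complex.real_smul]
      congr 2; ring
    rw [e, ← intervalIntegral.integral_sub (continuous_const.intervalIntegrable _ _)
      (hcont.intervalIntegrable _ _)]
    have : (2 * jumpLip lam y * mesh n) * |(i + 1) * mesh n - i * mesh n|
        = 2 * jumpLip lam y * mesh n * mesh n := by
      rw [show ((i : ℝ) + 1) * mesh n - i * mesh n = mesh n by ring, abs_of_pos hh]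
    rw [← this]
    apply intervalIntegral.norm_integral_le_of_norm_le_const
    intro x hx
    rw [Set.uIoc_of_le hle] at hx
    have h1 := h.norm_jump_sub_le (z := w - (i * mesh n : ℝ)) (w := w - (x : ℝ))
      (by rw [Complex.sub_im, Complex.ofReal_im]; linarith)
      (by rw [Complex.sub_im, Complex.ofReal_im]; linarith)
    have h2 : ‖w - (i * mesh n : ℝ) - (w - (x : ℝ))‖ ≤ mesh n := by
      rw [sub_sub_sub_cancel_left, ← Complex.ofReal_sub, Complex.norm_real, Real.norm_eq_abs,
        abs_of_nonneg (by linarith [hx.1])]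
      linarith [hx.2]
    have h3 : ∀ u : ℝ, 1 / (1 + |cylRep N u|) ≤ 1 := by
      intro u
      rw [div_le_one (by positivity)]
      linarith [abs_nonneg (cylRep N u)]
    refine h1.trans ?_
    calc _ ≤ jumpLip lam y * mesh n * (1 + 1) := by
          gcongr
          · exact h3 _
          · exact h3 _
      _ = _ := by ring
  refine (norm_sum_le _ _).trans ((Finset.sum_le_sum key).trans (le_of_eq ?_))
  have hcard : ((window n N).card : ℝ) = 2 * (N * 2 ^ n) := by
    rw [window, Int.card_Ico]
    have : ((N : ℤ) * 2 ^ n - -((N : ℤ) * 2 ^ n)).toNat = 2 * (N * 2 ^ n) := by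
      have : (N : ℤ) * 2 ^ n - -((N : ℤ) * 2 ^ n) = ((2 * (N * 2 ^ n) : ℕ) : ℤ) := by
        push_cast; ring
      rw [this, Int.toNat_natCast]
    rw [this]; push_cast; ring
  rw [Finset.sum_const, nsmul_eq_mul, hcard]
  have := natCast_mul_two_pow_mul_mesh n N
  calc 2 * (N * 2 ^ n) * (2 * jumpLip lam y * mesh n * mesh n)
      = 4 * jumpLip lam y * mesh n * ((N * 2 ^ n) * mesh n) := by ring
    _ = _ := by rw [this]; ring

end Mean

/-! ### The limit of infinite circumference -/

section Limit

open Filter Topology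

/-- Replacing `log (1 + g)` by `g` does not change the limit, although `a` is unbounded. -/
theorem tendsto_mul_log_one_add {ι : Type*} {l : Filter ι} {a g : ι → ℂ} {t : ℂ}
    (hg : Tendsto g l (𝓝 0)) (hag : Tendsto (fun i => a i * g i) l (𝓝 t)) :
    Tendsto (fun i => a i * Complex.log (1 + g i)) l (𝓝 t) := by
  have h0 : Tendsto (fun i => a i * g i + a i * (Complex.log (1 + g i) - g i)) l (𝓝 (t + 0)) := by
    refine hag.add (squeeze_zero_norm' (a := fun i => ‖a i * g i‖ * ‖g i‖) ?_ ?_)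
    · have : ∀ᶠ i in l, ‖g i‖ < 1 / 2 := by
        have := hg.norm
        rw [norm_zero] at this
        exact this.eventually_lt_const (by norm_num)
      filter_upwards [this] with i hi
      have h1 := Complex.norm_log_one_add_sub_self_le (show ‖g i‖ < 1 by linarith)
      have h2 : (1 - ‖g i‖)⁻¹ ≤ 2 := by
        rw [inv_le_comm₀ (by linarith) (by norm_num)]; linarith
      rw [norm_mul, norm_mul, mul_assoc]
      gcongr
      refine h1.trans ?_
      nlinarith [sq_nonneg ‖g i‖]
    · have := hag.norm.mul hg.norm
      simpa using this
  rw [add_zero] at h0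
  refine h0.congr fun i => ?_
  ring

theorem tendsto_mul_exp_sub_one {ι : Type*} {l : Filter ι} {a g : ι → ℂ} {t : ℂ}
    (hg : Tendsto g l (𝓝 0)) (hag : Tendsto (fun i => a i * g i) l (𝓝 t)) :
    Tendsto (fun i => a i * (Complex.exp (g i) - 1)) l (𝓝 t) := by
  have h0 : Tendsto (fun i => a i * g i + a i * (Complex.exp (g i) - 1 - g i)) l (𝓝 (t + 0)) := by
    refine hag.add (squeeze_zero_norm' (a := fun i => ‖a i * g i‖ * ‖g i‖) ?_ ?_)
    · have : ∀ᶠ i in l, ‖g i‖ < 1 := by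
        have := hg.norm
        rw [norm_zero] at this
        exact this.eventually_lt_const (by norm_num)
      filter_upwards [this] with i hi
      have h1 := Complex.norm_exp_sub_one_sub_id_le hi.le
      rw [norm_mul, norm_mul, mul_assoc]
      gcongr
      rw [← sq]; exact h1
    · have := hag.norm.mul hg.norm
      simpa using this
  rw [add_zero] at h0
  refine h0.congr fun i => ?_
  ring

theorem tendsto_natCast_mul_slitParam (lam : ℝ) :
    Tendsto (fun N : ℕ => N * slitParam N lam) atTop (𝓝 (lam / 2)) := by
  have h0 : Tendsto (fun N : ℕ => lam / (N : ℝ)) atTop (𝓝 0) :=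
    tendsto_const_div_atTop_nhds_zero_nat lam
  have h1 : Tendsto (fun N : ℕ => Real.exp (lam / N)) atTop (𝓝 1) := by
    have := (Real.continuous_exp.tendsto 0).comp h0
    rw [Real.exp_zero] at this
    exact this
  have h2 : Tendsto (fun N : ℕ => N * (Real.exp (lam / N) - 1)) atTop (𝓝 lam) := by
    refine tendsto_of_tendsto_of_tendsto_of_le_of_le' (g := fun _ => lam)
      (h := fun N : ℕ => lam * Real.exp (lam / N)) tendsto_const_nhds ?_ ?_ ?_
    · simpa using h1.const_mul lam
    · filter_upwards [eventually_ge_atTop 1] with N hN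
      have hN' : (0 : ℝ) < N := by exact_mod_cast hN
      have := Real.add_one_le_exp (lam / N)
      calc lam = N * (lam / N + 1 - 1) := by field_simp; ring
        _ ≤ _ := by gcongr
    · filter_upwards [eventually_ge_atTop 1] with N hN
      exact natCast_mul_exp_sub_one_le lam hN
  have h3 := h2.div (h1.const_add 1) (by norm_num)
  refine (h3.congr fun N => (natCast_mul_slitParam_eq lam N).symm).trans (le_of_eq ?_)
  norm_num

theorem tendsto_slitParam (lam : ℝ) : Tendsto (fun N : ℕ => slitParam N lam) atTop (𝓝 0) := by
  have h := (tendsto_natCast_mul_slitParam lam).mul (tendsto_inv_atTop_nhds_zero_nat (𝕜 := ℝ))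
  rw [mul_zero] at h
  refine h.congr' ?_
  filter_upwards [eventually_ge_atTop 1] with N hN
  have hN' : (N : ℝ) ≠ 0 := by exact_mod_cast (by omega : N ≠ 0)
  field_simp

theorem phiMap_I (δ : ℝ) : phiMap δ Complex.I = Complex.I := by
  rw [phiMap, Complex.I_sq]
  have : (δ : ℂ) ^ 2 - -1 * (1 - (δ : ℂ) ^ 2) = 1 := by ring
  rw [this, Complex.one_cpow, mul_one]

/-- The mean displacements converge: at `q = 0` the excess is exactly `δ² / (1 - δ²)`, and
`N δ → λ / 2`. -/
theorem exists_tendsto_driftConst (lam : ℝ) :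
    ∃ c : ℂ, Tendsto (driftConst lam) atTop (𝓝 c) := by
  have h1 : Tendsto (fun N : ℕ => ((slitParam N lam : ℝ) : ℂ)) atTop (𝓝 ((0 : ℝ) : ℂ)) :=
    (Complex.continuous_ofReal.tendsto _).comp (tendsto_slitParam lam)
  have h2 : Tendsto (fun N : ℕ => (((N * slitParam N lam : ℝ)) : ℂ)) atTop
      (𝓝 ((lam / 2 : ℝ) : ℂ)) :=
    (Complex.continuous_ofReal.tendsto _).comp (tendsto_natCast_mul_slitParam lam)
  have hx : ∀ N : ℕ, slitExcess (slitParam N lam) (discToHalf 0)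
      = ((slitParam N lam : ℝ) : ℂ) ^ 2 * (1 - ((slitParam N lam : ℝ) : ℂ) ^ 2)⁻¹ := by
    intro N
    have : discToHalf 0 = Complex.I := by simp [discToHalf]
    have hI := Complex.I_ne_zero
    rw [this, slitExcess, phiMap_I, ← div_eq_mul_inv]
    have h2I : Complex.I + Complex.I ≠ 0 := by rw [← two_mul]; exact mul_ne_zero two_ne_zero hI
    rw [mul_assoc (1 - _) _ _, mul_comm (1 - _) _, ← div_div]
    congr 1
    rw [div_eq_iff (mul_ne_zero h2I h2I)]
    ring
  have h3 : Tendsto (fun N : ℕ => (1 - ((slitParam N lam : ℝ) : ℂ) ^ 2)⁻¹) atTop (𝓝 1) := by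
    have := ((h1.pow 2).const_sub 1).inv₀ (by simp)
    simpa using this
  have h4 : Tendsto (fun N : ℕ => slitExcess (slitParam N lam) (discToHalf 0)) atTop (𝓝 0) := by
    simp only [hx]
    simpa using (h1.pow 2).mul h3
  have h5 : Tendsto (fun N : ℕ => (N : ℂ) ^ 2 * slitExcess (slitParam N lam) (discToHalf 0)) atTop
      (𝓝 (((lam / 2 : ℝ) : ℂ) ^ 2 * 1)) := by
    simp only [hx]
    refine ((h2.pow 2).mul h3).congr fun N => ?_
    push_cast; ring
  have h6 := (tendsto_mul_log_one_add h4 h5).const_mul (2 * Real.pi * Complex.I)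
  refine ⟨_, h6.congr fun N => ?_⟩
  rw [driftConst, slitJumpDisc]
  push_cast; ring

/-- Positive factors can be moved under the principal square root, which is the one with positive
real part. -/
theorem mul_cpow_half {x : ℂ} (hx : x ∈ Complex.slitPlane) {a : ℝ} (ha : 0 < a) :
    (a : ℂ) * x ^ (1 / 2 : ℂ) = ((a : ℂ) ^ 2 * x) ^ (1 / 2 : ℂ) := by
  have hre : 0 < ((a : ℂ) * x ^ (1 / 2 : ℂ)).re := by
    rw [Complex.re_ofReal_mul]; exact mul_pos ha (re_cpow_half_pos hx)
  have harg := abs_lt.1 (Complex.abs_arg_lt_pi_div_two_iff.2 (Or.inl hre))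
  have h1 := Complex.pow_cpow_nat_inv (x := (a : ℂ) * x ^ (1 / 2 : ℂ)) two_ne_zero
    (by push_cast; exact harg.1) (by push_cast; exact harg.2.le)
  have h2 := Complex.cpow_nat_inv_pow x two_ne_zero
  rw [mul_pow] at h1
  simp only [one_div] at *
  push_cast at h1 h2
  rw [h2] at h1
  exact h1.symm

theorem sq_sub_sq_mem_slitPlane {a : ℝ} (ha : 0 < a) {z : ℂ} (hz : 0 < z.im) :
    (a : ℂ) ^ 2 - z ^ 2 ∈ Complex.slitPlane := by
  have e : (a : ℂ) ^ 2 - z ^ 2 = ((a ^ 2 : ℝ) : ℂ) - z ^ 2 := by push_cast; ring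
  rw [e, Complex.mem_slitPlane_iff]
  by_cases hx : z.re = 0
  · left
    simp only [Complex.sub_re, Complex.ofReal_re, pow_two z, Complex.mul_re, hx]
    nlinarith
  · right
    simp only [Complex.sub_im, Complex.ofReal_im, pow_two z, Complex.mul_im]
    have : z.re * z.im ≠ 0 := mul_ne_zero hx hz.ne'
    intro h
    apply this
    linarith

/-- Half the slit map of the half-plane, `√(z² - λ²) / 2`. -/
def halfSlit (lam : ℝ) (z : ℂ) : ℂ :=
  Complex.I * ((((lam / 2 : ℝ) : ℂ) ^ 2 - (z / 2) ^ 2) ^ (1 / 2 : ℂ))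

/-- The displacement of the slit map of the half-plane, in the form in which it arises as the
limit of `jump`. -/
def jumpLimit (lam : ℝ) (z : ℂ) : ℂ :=
  Complex.I * (2 * Complex.I * ((lam / 2 : ℝ) : ℂ) ^ 2 * (0 + Complex.I)
    / ((1 - 0 ^ 2) * (halfSlit lam z + z / 2) * (0 + Complex.I)))

/-- `jump lam N` converges to its half-plane limit locally uniformly: with `w = g(f_N(z))` one has
`N w → z / 2` and `N δ → λ / 2`, hence `N φ^δ(w) → √(z² - λ²) / 2`. -/
theorem tendsto_jump {lam : ℝ} (hlam : 0 < lam) {z₀ : ℂ} (hz₀ : 0 < z₀.im) :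
    Tendsto (fun p : ℕ × ℂ => jump lam p.1 p.2) (atTop ×ˢ 𝓝 z₀) (𝓝 (jumpLimit lam z₀)) := by
  have hN : Tendsto (fun p : ℕ × ℂ => p.1) (atTop ×ˢ 𝓝 z₀) atTop := tendsto_fst
  have hz : Tendsto (fun p : ℕ × ℂ => p.2) (atTop ×ˢ 𝓝 z₀) (𝓝 z₀) := tendsto_snd
  have hinv : Tendsto (fun p : ℕ × ℂ => ((p.1 : ℕ) : ℂ)⁻¹) (atTop ×ˢ 𝓝 z₀) (𝓝 0) :=
    (tendsto_inv_atTop_nhds_zero_nat (𝕜 := ℂ)).comp hN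
  have hN1 : ∀ᶠ p : ℕ × ℂ in atTop ×ˢ 𝓝 z₀, 1 ≤ p.1 := hN.eventually_ge_atTop 1
  have hzim : ∀ᶠ p : ℕ × ℂ in atTop ×ˢ 𝓝 z₀, 0 < p.2.im :=
    ((Complex.continuous_im.tendsto _).comp hz).eventually_const_lt hz₀
  have hδ : Tendsto (fun p : ℕ × ℂ => ((slitParam p.1 lam : ℝ) : ℂ)) (atTop ×ˢ 𝓝 z₀) (𝓝 0) := by
    have := (Complex.continuous_ofReal.tendsto _).comp ((tendsto_slitParam lam).comp hN)
    rw [Complex.ofReal_zero] at this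
    exact this
  have hNδ : Tendsto (fun p : ℕ × ℂ => ((p.1 : ℕ) : ℂ) * ((slitParam p.1 lam : ℝ) : ℂ))
      (atTop ×ˢ 𝓝 z₀) (𝓝 ((lam / 2 : ℝ) : ℂ)) := by
    have := (Complex.continuous_ofReal.tendsto _).comp
      ((tendsto_natCast_mul_slitParam lam).comp hN)
    refine this.congr fun p => ?_
    simp
  have hu : Tendsto (fun p : ℕ × ℂ => Complex.I * p.2 / (p.1 : ℂ)) (atTop ×ˢ 𝓝 z₀) (𝓝 0) := by
    have := (hz.const_mul Complex.I).mul hinv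
    simpa [div_eq_mul_inv] using this
  have hNu : Tendsto (fun p : ℕ × ℂ => (p.1 : ℂ) * (Complex.I * p.2 / (p.1 : ℂ)))
      (atTop ×ˢ 𝓝 z₀) (𝓝 (Complex.I * z₀)) := by
    refine (hz.const_mul Complex.I).congr' ?_
    filter_upwards [hN1] with p hp
    have : (p.1 : ℂ) ≠ 0 := by exact_mod_cast (by omega : p.1 ≠ 0)
    field_simp
  have hq1 := tendsto_mul_exp_sub_one hu hNu
  have hq : Tendsto (fun p : ℕ × ℂ => Complex.exp (Complex.I * p.2 / (p.1 : ℂ)))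
      (atTop ×ˢ 𝓝 z₀) (𝓝 1) := by
    have := (Complex.continuous_exp.tendsto 0).comp hu
    rw [Complex.exp_zero] at this
    exact this
  set w : ℕ × ℂ → ℂ := fun p => discToHalf (Complex.exp (Complex.I * p.2 / (p.1 : ℂ))) with hw
  have hNw : Tendsto (fun p => (p.1 : ℂ) * w p) (atTop ×ˢ 𝓝 z₀) (𝓝 (z₀ / 2)) := by
    have := (hq1.const_mul (-Complex.I)).div (hq.const_add 1) (by norm_num)
    have e : -Complex.I * (Complex.I * z₀) / (1 + 1) = z₀ / 2 := by
      rw [← mul_assoc, neg_mul, Complex.I_mul_I]; norm_num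
    rw [e] at this
    refine this.congr fun p => ?_
    rw [hw]; simp only [discToHalf, Pi.div_apply]; ring
  have hw0 : Tendsto w (atTop ×ˢ 𝓝 z₀) (𝓝 0) := by
    have := hNw.mul hinv
    rw [mul_zero] at this
    refine this.congr' ?_
    filter_upwards [hN1] with p hp
    have : (p.1 : ℂ) ≠ 0 := by exact_mod_cast (by omega : p.1 ≠ 0)
    field_simp
  have hwim : ∀ᶠ p in atTop ×ˢ 𝓝 z₀, 0 < (w p).im := by
    filter_upwards [hN1, hzim] with p h1 h2
    exact discToHalf_im_pos (norm_exp_I_mul_div_lt_one h1 h2)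
  have hNφ : Tendsto (fun p => (p.1 : ℂ) * phiMap (slitParam p.1 lam) (w p)) (atTop ×ˢ 𝓝 z₀)
      (𝓝 (halfSlit lam z₀)) := by
    have hz2 : 0 < (z₀ / 2).im := by
      rw [show z₀ / 2 = z₀ / ((2 : ℝ) : ℂ) by simp, Complex.div_ofReal_im]; linarith
    have h1 : Tendsto (fun p : ℕ × ℂ => ((p.1 : ℂ) * ((slitParam p.1 lam : ℝ) : ℂ)) ^ 2
        - ((p.1 : ℂ) * w p) ^ 2 * (1 - ((slitParam p.1 lam : ℝ) : ℂ) ^ 2)) (atTop ×ˢ 𝓝 z₀)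
        (𝓝 (((lam / 2 : ℝ) : ℂ) ^ 2 - (z₀ / 2) ^ 2 * (1 - 0 ^ 2))) :=
      (hNδ.pow 2).sub ((hNw.pow 2).mul ((hδ.pow 2).const_sub 1))
    have e : ((lam / 2 : ℝ) : ℂ) ^ 2 - (z₀ / 2) ^ 2 * (1 - 0 ^ 2)
        = ((lam / 2 : ℝ) : ℂ) ^ 2 - (z₀ / 2) ^ 2 := by ring
    rw [e] at h1
    have hslit := sq_sub_sq_mem_slitPlane (half_pos hlam) hz2
    have h2 : Tendsto (fun p : ℕ × ℂ => Complex.I * (((p.1 : ℂ) * ((slitParam p.1 lam : ℝ) : ℂ)) ^ 2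
        - ((p.1 : ℂ) * w p) ^ 2 * (1 - ((slitParam p.1 lam : ℝ) : ℂ) ^ 2)) ^ (1 / 2 : ℂ))
        (atTop ×ˢ 𝓝 z₀) (𝓝 (halfSlit lam z₀)) :=
      ((continuousAt_cpow_const hslit).tendsto.comp h1).const_mul Complex.I
    refine h2.congr' ?_
    filter_upwards [hN1, hwim] with p hp hwp
    have hN' : (0 : ℝ) < p.1 := by exact_mod_cast hp
    have hδp : slitParam p.1 lam ∈ Set.Ioo (0 : ℝ) 1 := by
      refine ⟨slitParam_pos hlam hp, ?_⟩
      rw [slitParam]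
      have : 0 < 2 / (1 + Real.exp (lam / p.1)) := by positivity
      linarith
    have := mul_cpow_half (sq_sub_mem_slitPlane hδp hwp) hN'
    rw [phiMap, mul_left_comm]
    congr 1
    simp only [Complex.ofReal_natCast] at this
    rw [this]
    congr 1
    ring
  have hφ0 : Tendsto (fun p => phiMap (slitParam p.1 lam) (w p)) (atTop ×ˢ 𝓝 z₀) (𝓝 0) := by
    have := hNφ.mul hinv
    rw [mul_zero] at this
    refine this.congr' ?_
    filter_upwards [hN1] with p hp
    have : (p.1 : ℂ) ≠ 0 := by exact_mod_cast (by omega : p.1 ≠ 0)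
    field_simp
  have hden : halfSlit lam z₀ + z₀ / 2 ≠ 0 := by
    have hz2 : 0 < (z₀ / 2).im := by
      rw [show z₀ / 2 = z₀ / ((2 : ℝ) : ℂ) by simp, Complex.div_ofReal_im]; linarith
    have h1 := re_cpow_half_pos (sq_sub_sq_mem_slitPlane (half_pos hlam) hz2)
    intro h
    have h2 := congrArg Complex.im h
    rw [Complex.add_im, halfSlit, Complex.I_mul_im, Complex.zero_im] at h2
    linarith
  have hNs : Tendsto (fun p => (p.1 : ℂ) * slitExcess (slitParam p.1 lam) (w p)) (atTop ×ˢ 𝓝 z₀)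
      (𝓝 (2 * Complex.I * ((lam / 2 : ℝ) : ℂ) ^ 2 * (0 + Complex.I)
        / ((1 - 0 ^ 2) * (halfSlit lam z₀ + z₀ / 2) * (0 + Complex.I)))) := by
    have h1 := (((hNδ.pow 2).const_mul (2 * Complex.I)).mul (hφ0.add_const Complex.I)).div
      ((((hδ.pow 2).const_sub 1).mul (hNφ.add hNw)).mul (hw0.add_const Complex.I))
      (mul_ne_zero (mul_ne_zero (by norm_num) hden) (by simp))
    refine h1.congr' ?_
    filter_upwards [hN1] with p hp
    have hp0 : (p.1 : ℂ) ≠ 0 := by exact_mod_cast (by omega : p.1 ≠ 0)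
    simp only [Pi.div_apply]
    rw [slitExcess, ← mul_add, mul_pow, mul_div_assoc', ← mul_div_mul_left _
      (_ * (phiMap (slitParam p.1 lam) (w p) + w p) * (w p + Complex.I)) hp0]
    congr 1 <;> ring
  have hs0 : Tendsto (fun p => slitExcess (slitParam p.1 lam) (w p)) (atTop ×ˢ 𝓝 z₀) (𝓝 0) := by
    have := hNs.mul hinv
    rw [mul_zero] at this
    refine this.congr' ?_
    filter_upwards [hN1] with p hp
    have : (p.1 : ℂ) ≠ 0 := by exact_mod_cast (by omega : p.1 ≠ 0)
    field_simp
  refine ((tendsto_mul_log_one_add hs0 hNs).const_mul Complex.I).congr fun p => ?_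
  rw [jump, slitJump, slitJumpDisc, hw]
  ring

/-- On compact sets the displacements form a uniform Cauchy sequence. -/
theorem exists_norm_jump_sub_jump_le {lam : ℝ} (hlam : 0 < lam) {K : Set ℂ} (hK : IsCompact K)
    (hKH : K ⊆ {z : ℂ | 0 < z.im}) {e : ℝ} (he : 0 < e) :
    ∃ N₀ : ℕ, ∀ N M : ℕ, N₀ ≤ N → N₀ ≤ M → ∀ z ∈ K, ‖jump lam N z - jump lam M z‖ ≤ e := by
  have hloc : ∀ z ∈ K, ∃ t ∈ 𝓝[K] z, ∃ N₀ : ℕ, ∀ N M : ℕ, N₀ ≤ N → N₀ ≤ M → ∀ w ∈ t,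
      ‖jump lam N w - jump lam M w‖ ≤ e := by
    intro z hz
    have h := (tendsto_jump hlam (hKH hz)).eventually (Metric.ball_mem_nhds _ (half_pos he))
    obtain ⟨p1, hp1, p2, hp2, hp⟩ := Filter.eventually_prod_iff.1 h
    obtain ⟨N₀, hN₀⟩ := eventually_atTop.1 hp1
    refine ⟨{w | p2 w}, mem_nhdsWithin_of_mem_nhds hp2, N₀, fun N M hN hM w hw => ?_⟩
    have h1 : dist (jump lam N w) (jumpLimit lam z) < e / 2 := hp (hN₀ N hN) hw
    have h2 : dist (jump lam M w) (jumpLimit lam z) < e / 2 := hp (hN₀ M hM) hw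
    rw [← dist_eq_norm]
    have := dist_triangle_right (jump lam N w) (jump lam M w) (jumpLimit lam z)
    linarith
  refine hK.induction_on (p := fun t => ∃ N₀ : ℕ, ∀ N M : ℕ, N₀ ≤ N → N₀ ≤ M → ∀ w ∈ t,
      ‖jump lam N w - jump lam M w‖ ≤ e) ⟨0, by simp⟩ ?_ ?_ hloc
  · rintro s t hst ⟨N₀, h⟩
    exact ⟨N₀, fun N M hN hM w hw => h N M hN hM w (hst hw)⟩
  · rintro s t ⟨N₁, h1⟩ ⟨N₂, h2⟩
    refine ⟨max N₁ N₂, fun N M hN hM w hw => ?_⟩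
    rcases hw with hw | hw
    · exact h1 N M ((le_max_left _ _).trans hN) ((le_max_left _ _).trans hM) w hw
    · exact h2 N M ((le_max_right _ _).trans hN) ((le_max_right _ _).trans hM) w hw

end Limit

/-! ### Martingales driven by an array of independent counts -/

section CountArray

variable {Ω : Type*} [MeasurableSpace Ω] {P : Measure Ω} {ι : Type*}

/-- A family of independent natural-number valued random variables with mean and variance `a`. -/
structure IsCountArray (P : Measure Ω) (ξ : ι → Ω → ℕ) (a : ℝ) : Prop where
  measurable : ∀ p, Measurable (ξ p)
  indep : iIndepFun ξ P
  memLp : ∀ p, MemLp (fun ω => (ξ p ω : ℝ)) 2 P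
  integral_eq : ∀ p, ∫ ω, (ξ p ω : ℝ) ∂P = a
  variance_eq : ∀ p, ∫ ω, ((ξ p ω : ℝ) - a) ^ 2 ∂P = a

variable {ξ : ι → Ω → ℕ} {a : ℝ}

/-- A functional of finitely many counts factors through a countable discrete space, which makes
all such functionals measurable. -/
theorem exists_eq_comp_of_dependsOn {E : Type*} [Nonempty E] {V : (ι → ℕ) → E} {S : Finset ι}
    (hV : DependsOn V (S : Set ι)) : ∃ v : (S → ℕ) → E, ∀ k, V k = v fun p => k p := by
  have : Function.FactorsThrough V (fun (k : ι → ℕ) (p : S) => k p) := by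
    intro k k' h
    exact hV fun i hi => congrFun h ⟨i, hi⟩
  obtain ⟨v, hv⟩ := (Function.factorsThrough_iff _).1 this
  exact ⟨v, fun k => congrFun hv k⟩

theorem measurable_of_dependsOn (h : ∀ p, Measurable (ξ p)) {E : Type*} [Nonempty E]
    [MeasurableSpace E] {V : (ι → ℕ) → E} {S : Finset ι} (hV : DependsOn V (S : Set ι)) :
    Measurable fun ω => V fun p => ξ p ω := by
  obtain ⟨v, hv⟩ := exists_eq_comp_of_dependsOn hV
  simp only [hv]
  exact (Measurable.of_discrete (f := v)).comp (measurable_pi_lambda _ fun p => h p)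

theorem IsCountArray.integral_mul (h : IsCountArray P ξ a) {V W : (ι → ℕ) → ℝ} {S T : Finset ι}
    (hV : DependsOn V (S : Set ι)) (hW : DependsOn W (T : Set ι)) (hST : Disjoint S T) :
    ∫ ω, V (fun p => ξ p ω) * W (fun p => ξ p ω) ∂P
      = (∫ ω, V (fun p => ξ p ω) ∂P) * ∫ ω, W (fun p => ξ p ω) ∂P := by
  have hi := h.indep.indepFun_finset S T hST h.measurable
  have mV := measurable_of_dependsOn h.measurable hV
  have mW := measurable_of_dependsOn h.measurable hW
  obtain ⟨v, hv⟩ := exists_eq_comp_of_dependsOn hV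
  obtain ⟨w, hw⟩ := exists_eq_comp_of_dependsOn hW
  simp only [hv, hw] at mV mW ⊢
  exact (hi.comp (Measurable.of_discrete (f := v)) (Measurable.of_discrete
    (f := w))).integral_fun_mul_eq_mul_integral mV.aestronglyMeasurable mW.aestronglyMeasurable

theorem dependsOn_coord_sub (a : ℝ) (p : ι) :
    DependsOn (fun k : ι → ℕ => (k p : ℝ) - a) (({p} : Finset ι) : Set ι) := by
  intro k k' h
  simp only [h p (by simp)]

variable [IsProbabilityMeasure P]

theorem IsCountArray.memLp_sub (h : IsCountArray P ξ a) (p : ι) :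
    MemLp (fun ω => (ξ p ω : ℝ) - a) 2 P := (h.memLp p).sub (memLp_const a)

theorem IsCountArray.integral_sub (h : IsCountArray P ξ a) (p : ι) :
    ∫ ω, ((ξ p ω : ℝ) - a) ∂P = 0 := by
  rw [MeasureTheory.integral_sub ((h.memLp p).integrable (by norm_num)) (integrable_const _),
    h.integral_eq]
  simp

end CountArray

section Compensated

variable {Ω : Type*} [MeasurableSpace Ω] {P : Measure Ω} [IsProbabilityMeasure P] {κ : Type*}
  {ξ : ℕ × κ → Ω → ℕ} {a : ℝ} {I : Finset κ}

/-- The integral `∑_{j < J} ∑_i (k_{j,i} - a) V_{j,i}` of `V` against the compensated counts. -/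
def compSum (a : ℝ) (I : Finset κ) (V : ℕ → κ → (ℕ × κ → ℕ) → ℝ) (J : ℕ) (k : ℕ × κ → ℕ) : ℝ :=
  ∑ j ∈ Finset.range J, ∑ i ∈ I, ((k (j, i) : ℝ) - a) * V j i k

/-- The integrand `V` is predictable (`V j i` only depends on the counts in the slots before `j`)
and bounded. -/
structure IsPredictable (I : Finset κ) (V : ℕ → κ → (ℕ × κ → ℕ) → ℝ) (B : ℝ) : Prop where
  dependsOn : ∀ j, ∀ i ∈ I, DependsOn (V j i) ((Finset.range j ×ˢ I : Finset (ℕ × κ)) : Set (ℕ × κ))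
  bound : ∀ j, ∀ i ∈ I, ∀ k, |V j i k| ≤ B

variable {V : ℕ → κ → (ℕ × κ → ℕ) → ℝ} {B : ℝ}

theorem compSum_succ (a : ℝ) (I : Finset κ) (V : ℕ → κ → (ℕ × κ → ℕ) → ℝ) (J : ℕ)
    (k : ℕ × κ → ℕ) :
    compSum a I V (J + 1) k
      = compSum a I V J k + ∑ i ∈ I, ((k (J, i) : ℝ) - a) * V J i k := by
  rw [compSum, Finset.sum_range_succ, compSum]

theorem range_prod_mono (I : Finset κ) {j J : ℕ} (h : j ≤ J) :
    ((Finset.range j ×ˢ I : Finset (ℕ × κ)) : Set (ℕ × κ))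
      ⊆ (Finset.range J ×ˢ I : Finset (ℕ × κ)) := by
  intro p hp
  simp only [Finset.coe_product, Finset.coe_range, Set.mem_prod, Set.mem_Iio] at hp ⊢
  exact ⟨by omega, hp.2⟩

theorem IsPredictable.dependsOn_compSum (hV : IsPredictable I V B) (a : ℝ) (J : ℕ) :
    DependsOn (compSum a I V J) ((Finset.range J ×ˢ I : Finset (ℕ × κ)) : Set (ℕ × κ)) := by
  intro k k' h
  refine Finset.sum_congr rfl fun j hj => Finset.sum_congr rfl fun i hi => ?_
  have hj' := Finset.mem_range.1 hj
  rw [h (j, i) (by simp [hj', hi]), hV.dependsOn j i hi fun p hp =>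
    h p (range_prod_mono I hj'.le hp)]

theorem IsPredictable.memLp_increment (hV : IsPredictable I V B) (h : IsCountArray P ξ a) (j : ℕ)
    {i : κ} (hi : i ∈ I) :
    MemLp (fun ω => ((ξ (j, i) ω : ℝ) - a) * V j i fun p => ξ p ω) 2 P := by
  have h1 : MemLp (fun ω => V j i fun p => ξ p ω) ∞ P :=
    memLp_top_of_bound (measurable_of_dependsOn h.measurable
      (hV.dependsOn j i hi)).aestronglyMeasurable B
        (Filter.Eventually.of_forall fun ω => hV.bound j i hi _)
  exact h1.mul' (h.memLp_sub (j, i))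

theorem IsPredictable.memLp_compSum (hV : IsPredictable I V B) (h : IsCountArray P ξ a) (J : ℕ) :
    MemLp (fun ω => compSum a I V J fun p => ξ p ω) 2 P := by
  unfold compSum
  exact memLp_finsetSum _ fun j _ => memLp_finsetSum _ fun i hi => hV.memLp_increment h j hi

theorem disjoint_range_prod_singleton (I : Finset κ) (j : ℕ) (i : κ) :
    Disjoint (Finset.range j ×ˢ I) {(j, i)} := by
  rw [Finset.disjoint_singleton_right]
  simp

/-- Increments are orthogonal to the past. -/
theorem IsPredictable.integral_mul_increment (hV : IsPredictable I V B) (h : IsCountArray P ξ a)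
    {j : ℕ} {X : (ℕ × κ → ℕ) → ℝ}
    (hX : DependsOn X ((Finset.range j ×ˢ I : Finset (ℕ × κ)) : Set (ℕ × κ)))
    (hX2 : MemLp (fun ω => X fun p => ξ p ω) 2 P) :
    Integrable (fun ω => X (fun p => ξ p ω)
      * ∑ i ∈ I, ((ξ (j, i) ω : ℝ) - a) * V j i fun p => ξ p ω) P ∧
    ∫ ω, X (fun p => ξ p ω)
      * ∑ i ∈ I, ((ξ (j, i) ω : ℝ) - a) * V j i (fun p => ξ p ω) ∂P = 0 := by
  have hint : ∀ i ∈ I, Integrable (fun ω => X (fun p => ξ p ω)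
      * (((ξ (j, i) ω : ℝ) - a) * V j i fun p => ξ p ω)) P := fun i hi =>
    hX2.integrable_mul (hV.memLp_increment h j hi)
  simp only [Finset.mul_sum]
  refine ⟨integrable_finsetSum _ hint, ?_⟩
  rw [integral_finsetSum _ hint]
  refine Finset.sum_eq_zero fun i hi => ?_
  have e : ∀ ω, X (fun p => ξ p ω) * (((ξ (j, i) ω : ℝ) - a) * V j i fun p => ξ p ω)
      = (X (fun p => ξ p ω) * V j i fun p => ξ p ω) * ((ξ (j, i) ω : ℝ) - a) := fun ω => by ring
  simp only [e]
  have hdep : DependsOn (fun k => X k * V j i k)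
      ((Finset.range j ×ˢ I : Finset (ℕ × κ)) : Set (ℕ × κ)) := by
    intro k k' hk
    simp only [hX hk, hV.dependsOn j i hi hk]
  have := h.integral_mul hdep (dependsOn_coord_sub a (j, i)) (disjoint_range_prod_singleton I j i)
  rw [this, h.integral_sub, mul_zero]

/-- The increments in a slot are orthogonal to each other. -/
theorem IsPredictable.integral_increment_sq (hV : IsPredictable I V B) (h : IsCountArray P ξ a)
    (j : ℕ) :
    ∫ ω, (∑ i ∈ I, ((ξ (j, i) ω : ℝ) - a) * V j i fun p => ξ p ω) ^ 2 ∂P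
      = ∑ i ∈ I, a * ∫ ω, (V j i fun p => ξ p ω) ^ 2 ∂P := by
  classical
  simp only [sq, Finset.sum_mul_sum]
  have hint : ∀ i ∈ I, ∀ i' ∈ I, Integrable (fun ω =>
      (((ξ (j, i) ω : ℝ) - a) * V j i fun p => ξ p ω)
      * (((ξ (j, i') ω : ℝ) - a) * V j i' fun p => ξ p ω)) P := fun i hi i' hi' =>
    (hV.memLp_increment h j hi).integrable_mul (hV.memLp_increment h j hi')
  rw [integral_finsetSum _ fun i hi => integrable_finsetSum _ (hint i hi)]
  refine Finset.sum_congr rfl fun i hi => ?_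
  rw [integral_finsetSum _ (hint i hi), Finset.sum_eq_single i]
  · have e : ∀ ω, (((ξ (j, i) ω : ℝ) - a) * V j i fun p => ξ p ω)
        * (((ξ (j, i) ω : ℝ) - a) * V j i fun p => ξ p ω)
        = ((V j i fun p => ξ p ω) * V j i fun p => ξ p ω) * ((ξ (j, i) ω : ℝ) - a) ^ 2 :=
      fun ω => by ring
    simp only [e]
    have hdep : DependsOn (fun k => V j i k * V j i k)
        ((Finset.range j ×ˢ I : Finset (ℕ × κ)) : Set (ℕ × κ)) := by
      intro k k' hk
      simp only [hV.dependsOn j i hi hk]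
    have hdep2 : DependsOn (fun k : ℕ × κ → ℕ => ((k (j, i) : ℝ) - a) ^ 2)
        (({(j, i)} : Finset (ℕ × κ)) : Set (ℕ × κ)) := by
      intro k k' hk
      simp only [hk (j, i) (by simp)]
    have := h.integral_mul hdep hdep2 (disjoint_range_prod_singleton I j i)
    rw [this, h.variance_eq, mul_comm]
  · intro i' hi' hne
    have e : ∀ ω, (((ξ (j, i) ω : ℝ) - a) * V j i fun p => ξ p ω)
        * (((ξ (j, i') ω : ℝ) - a) * V j i' fun p => ξ p ω)
        = ((V j i fun p => ξ p ω) * (V j i' fun p => ξ p ω) * ((ξ (j, i) ω : ℝ) - a))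
          * ((ξ (j, i') ω : ℝ) - a) :=
      fun ω => by ring
    simp only [e]
    have hdep : DependsOn (fun k : ℕ × κ → ℕ => V j i k * V j i' k * ((k (j, i) : ℝ) - a))
        ((insert (j, i) (Finset.range j ×ˢ I) : Finset (ℕ × κ)) : Set (ℕ × κ)) := by
      intro k k' hk
      have hk' : ∀ p ∈ ((Finset.range j ×ˢ I : Finset (ℕ × κ)) : Set (ℕ × κ)), k p = k' p :=
        fun p hp => hk p (by rw [Finset.coe_insert]; exact Set.mem_insert_of_mem _ hp)
      simp only [hV.dependsOn j i hi hk', hV.dependsOn j i' hi' hk', hk (j, i) (by simp)]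
    have := h.integral_mul hdep (dependsOn_coord_sub a (j, i')) (by
      rw [Finset.disjoint_singleton_right]
      simp [hne])
    rw [this, h.integral_sub, mul_zero]
  · exact fun h => absurd hi h

/-- The Itô isometry for the compensated counts. -/
theorem IsPredictable.integral_compSum_sq (hV : IsPredictable I V B) (h : IsCountArray P ξ a)
    (J : ℕ) :
    ∫ ω, (compSum a I V J fun p => ξ p ω) ^ 2 ∂P
      = ∑ j ∈ Finset.range J, ∑ i ∈ I, a * ∫ ω, (V j i fun p => ξ p ω) ^ 2 ∂P := by
  induction J with
  | zero => simp [compSum]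
  | succ J ih =>
    have hM := hV.memLp_compSum h J
    have hc := hV.integral_mul_increment h (hV.dependsOn_compSum a J) hM
    have hS : MemLp (fun ω => ∑ i ∈ I, ((ξ (J, i) ω : ℝ) - a) * V J i fun p => ξ p ω) 2 P :=
      memLp_finsetSum _ fun i hi => hV.memLp_increment h J hi
    have e : ∀ ω, (compSum a I V (J + 1) fun p => ξ p ω) ^ 2
        = (compSum a I V J fun p => ξ p ω) ^ 2
          + (2 * ((compSum a I V J fun p => ξ p ω)
              * ∑ i ∈ I, ((ξ (J, i) ω : ℝ) - a) * V J i fun p => ξ p ω)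
            + (∑ i ∈ I, ((ξ (J, i) ω : ℝ) - a) * V J i fun p => ξ p ω) ^ 2) := by
      intro ω; rw [compSum_succ]; ring
    have hR : Integrable (fun ω => 2 * ((compSum a I V J fun p => ξ p ω)
        * ∑ i ∈ I, ((ξ (J, i) ω : ℝ) - a) * V J i fun p => ξ p ω)
        + (∑ i ∈ I, ((ξ (J, i) ω : ℝ) - a) * V J i fun p => ξ p ω) ^ 2) P :=
      (hc.1.const_mul 2).add hS.integrable_sq
    simp only [e]
    rw [integral_add hM.integrable_sq hR,
      integral_add (hc.1.const_mul 2) hS.integrable_sq, integral_const_mul, hc.2, mul_zero,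
      zero_add, ih, hV.integral_increment_sq h, Finset.sum_range_succ]

/-- The running maximum of a sequence. -/
def runMax (s : ℕ → ℝ) : ℕ → ℝ
  | 0 => s 0
  | n + 1 => max (runMax s n) (s (n + 1))

theorem le_runMax (s : ℕ → ℝ) {j n : ℕ} (h : j ≤ n) : s j ≤ runMax s n := by
  induction n with
  | zero => rw [Nat.le_zero.1 h]; exact le_rfl
  | succ n ih =>
    rcases Nat.le_succ_iff.1 h with h | h
    · exact (ih h).trans (le_max_left _ _)
    · rw [h]; exact le_max_right _ _

/-- The pathwise form of Doob's `L²` inequality; for a submartingale `s` the last sum has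
nonnegative expectation. -/
theorem runMax_sq_le {s : ℕ → ℝ} (n : ℕ) :
    runMax s n ^ 2
      ≤ 4 * s n ^ 2 - 4 * ∑ j ∈ Finset.range n, runMax s j * (s (j + 1) - s j) := by
  have key : 4 * ∑ j ∈ Finset.range n, runMax s j * (s (j + 1) - s j)
      ≤ 4 * (runMax s n * s n) - 2 * runMax s n ^ 2 := by
    induction n with
    | zero => simp [runMax]; nlinarith [sq_nonneg (s 0)]
    | succ n ih =>
      rw [Finset.sum_range_succ, mul_add]
      have h1 : runMax s (n + 1) = max (runMax s n) (s (n + 1)) := rfl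
      rcases le_total (s (n + 1)) (runMax s n) with h | h
      · rw [h1, max_eq_left h]; nlinarith
      · rw [h1, max_eq_right h]
        nlinarith [sq_nonneg (s (n + 1) - runMax s n)]
  nlinarith [sq_nonneg (2 * s n - runMax s n)]

/-- Doob's `L²` inequality for the integral against the compensated counts. -/
theorem IsPredictable.integral_runMax_sq_le (hV : IsPredictable I V B) (h : IsCountArray P ξ a)
    (n : ℕ) :
    Integrable (fun ω => runMax (fun J => |compSum a I V J fun p => ξ p ω|) n ^ 2) P ∧
    ∫ ω, runMax (fun J => |compSum a I V J fun p => ξ p ω|) n ^ 2 ∂P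
      ≤ 4 * ∑ j ∈ Finset.range n, ∑ i ∈ I, a * ∫ ω, (V j i fun p => ξ p ω) ^ 2 ∂P := by
  set m : ℕ → (ℕ × κ → ℕ) → ℝ := fun J k => runMax (fun J => |compSum a I V J k|) J with hm
  have hdep : ∀ J, DependsOn (m J) ((Finset.range J ×ˢ I : Finset (ℕ × κ)) : Set (ℕ × κ)) := by
    intro J
    induction J with
    | zero => intro k k' hk; simp only [hm, runMax, hV.dependsOn_compSum a 0 hk]
    | succ J ih =>
      intro k k' hk
      have h1 := ih fun p hp => hk p (range_prod_mono I J.le_succ hp)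
      have h2 := hV.dependsOn_compSum a (J + 1) hk
      simp only [hm] at h1 ⊢
      rw [runMax, runMax, h1, h2]
  have hmem : ∀ J, MemLp (fun ω => m J fun p => ξ p ω) 2 P := by
    intro J
    induction J with
    | zero => exact (hV.memLp_compSum h 0).abs
    | succ J ih => exact ih.sup (hV.memLp_compSum h (J + 1)).abs
  refine ⟨(hmem n).integrable_sq, ?_⟩
  -- `m |M|` is compared with the integral of `m · sign M` against the martingale `M` itself, which
  -- has mean zero.
  set X : ℕ → (ℕ × κ → ℕ) → ℝ := fun J k => m J k * SignType.sign (compSum a I V J k) with hX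
  have hXdep : ∀ J, DependsOn (X J) ((Finset.range J ×ˢ I : Finset (ℕ × κ)) : Set (ℕ × κ)) := by
    intro J k k' hk
    simp only [hX, hdep J hk, hV.dependsOn_compSum a J hk]
  have hXmem : ∀ J, MemLp (fun ω => X J fun p => ξ p ω) 2 P := by
    intro J
    refine (hmem J).mono (measurable_of_dependsOn h.measurable (hXdep J)).aestronglyMeasurable
      (Filter.Eventually.of_forall fun ω => ?_)
    simp only [hX, norm_mul]
    refine mul_le_of_le_one_right (norm_nonneg _) ?_
    rcases SignType.sign (compSum a I V J fun p => ξ p ω) with _ | _ | _ <;> simp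
  have hpath : ∀ ω, m n (fun p => ξ p ω) ^ 2
      ≤ 4 * (compSum a I V n fun p => ξ p ω) ^ 2 - 4 * ∑ j ∈ Finset.range n,
        X j (fun p => ξ p ω) * ∑ i ∈ I, ((ξ (j, i) ω : ℝ) - a) * V j i fun p => ξ p ω := by
    intro ω
    have h1 := runMax_sq_le (s := fun J => |compSum a I V J fun p => ξ p ω|) n
    rw [sq_abs] at h1
    refine h1.trans ?_
    refine sub_le_sub_left (mul_le_mul_of_nonneg_left (Finset.sum_le_sum fun j _ => ?_)
      (by norm_num)) _
    have h2 : 0 ≤ runMax (fun J => |compSum a I V J fun p => ξ p ω|) j :=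
      (abs_nonneg _).trans (le_runMax (fun J => |compSum a I V J fun p => ξ p ω|) (Nat.zero_le j))
    simp only [hX, hm, mul_assoc]
    refine mul_le_mul_of_nonneg_left ?_ h2
    have h3 : (SignType.sign (compSum a I V j fun p => ξ p ω) : ℝ)
        * (compSum a I V j fun p => ξ p ω) = |compSum a I V j fun p => ξ p ω| := sign_mul_self _
    have h4 : (SignType.sign (compSum a I V j fun p => ξ p ω) : ℝ)
        * (compSum a I V (j + 1) fun p => ξ p ω) ≤ |compSum a I V (j + 1) fun p => ξ p ω| := by
      rcases SignType.sign (compSum a I V j fun p => ξ p ω) with _ | _ | _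
      · simp
      · simpa using neg_le_abs _
      · simpa using le_abs_self _
    have h5 := compSum_succ a I V j fun p => ξ p ω
    rw [h5, mul_add] at h4
    rw [h5]
    linarith
  have hterm := fun j => hV.integral_mul_increment h (hXdep j) (hXmem j)
  have hS : Integrable (fun ω => ∑ j ∈ Finset.range n,
      X j (fun p => ξ p ω) * ∑ i ∈ I, ((ξ (j, i) ω : ℝ) - a) * V j i fun p => ξ p ω) P :=
    integrable_finsetSum _ fun j _ => (hterm j).1
  have hS0 : ∫ ω, ∑ j ∈ Finset.range n,
      X j (fun p => ξ p ω) * ∑ i ∈ I, ((ξ (j, i) ω : ℝ) - a) * V j i (fun p => ξ p ω) ∂P = 0 := by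
    rw [integral_finsetSum _ fun j _ => (hterm j).1]
    exact Finset.sum_eq_zero fun j _ => (hterm j).2
  have hM := (hV.memLp_compSum h n).integrable_sq
  calc ∫ ω, m n (fun p => ξ p ω) ^ 2 ∂P
      ≤ ∫ ω, (4 * (compSum a I V n fun p => ξ p ω) ^ 2 - 4 * ∑ j ∈ Finset.range n,
        X j (fun p => ξ p ω) * ∑ i ∈ I, ((ξ (j, i) ω : ℝ) - a) * V j i fun p => ξ p ω) ∂P :=
        integral_mono (hmem n).integrable_sq ((hM.const_mul 4).sub (hS.const_mul 4)) hpath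
    _ = _ := by
      rw [MeasureTheory.integral_sub (hM.const_mul 4) (hS.const_mul 4), integral_const_mul,
        integral_const_mul, hS0, mul_zero, sub_zero, hV.integral_compSum_sq h]

end Compensated

/-! ### Processes driven by counts -/

section Driven

variable {Ω : Type*} [MeasurableSpace Ω] {P : Measure Ω} [IsProbabilityMeasure P] {κ : Type*}
  {ξ : ℕ × κ → Ω → ℕ} {a τ : ℝ} {I : Finset κ}

/-- The process `D` jumps by `∑_i k_{J,i} G_{J,i}` in slot `J`, where the bounded integrand `G`
depends on the previous slots only; the mean jump is `τ c` up to an error `τ e`. -/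
structure IsDriven (a τ : ℝ) (I : Finset κ) (D : ℕ → (ℕ × κ → ℕ) → ℂ)
    (G : ℕ → κ → (ℕ × κ → ℕ) → ℂ) (B e : ℝ) (c : ℂ) : Prop where
  succ : ∀ J k, D (J + 1) k = D J k + ∑ i ∈ I, (k (J, i) : ℂ) * G J i k
  dependsOn_zero : DependsOn (D 0) (((Finset.range 0 ×ˢ I : Finset (ℕ × κ)) : Set (ℕ × κ)))
  dependsOn : ∀ j, ∀ i ∈ I, DependsOn (G j i) ((Finset.range j ×ˢ I : Finset (ℕ × κ)) : Set (ℕ × κ))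
  bound : ∀ j, ∀ i ∈ I, ∀ k, ‖G j i k‖ ≤ B
  mean : ∀ j k, ‖(a : ℂ) * ∑ i ∈ I, G j i k - τ * c‖ ≤ τ * e

variable {D : ℕ → (ℕ × κ → ℕ) → ℂ} {G : ℕ → κ → (ℕ × κ → ℕ) → ℂ} {B e : ℝ} {c : ℂ}

theorem IsDriven.dependsOn_apply (hD : IsDriven a τ I D G B e c) (J : ℕ) :
    DependsOn (D J) ((Finset.range J ×ˢ I : Finset (ℕ × κ)) : Set (ℕ × κ)) := by
  induction J with
  | zero => exact hD.dependsOn_zero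
  | succ J ih =>
    intro k k' hk
    have hk' : ∀ p ∈ ((Finset.range J ×ˢ I : Finset (ℕ × κ)) : Set (ℕ × κ)), k p = k' p :=
      fun p hp => hk p (range_prod_mono I J.le_succ hp)
    rw [hD.succ, hD.succ, ih hk']
    congr 1
    refine Finset.sum_congr rfl fun i hi => ?_
    rw [hD.dependsOn J i hi hk', hk (J, i) (by simp [hi])]

theorem IsDriven.isPredictable_re (hD : IsDriven a τ I D G B e c) :
    IsPredictable I (fun j i k => (G j i k).re) B :=
  ⟨fun j i hi k k' hk => by simp only [hD.dependsOn j i hi hk],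
    fun j i hi k => (Complex.abs_re_le_norm _).trans (hD.bound j i hi k)⟩

theorem IsDriven.isPredictable_im (hD : IsDriven a τ I D G B e c) :
    IsPredictable I (fun j i k => (G j i k).im) B :=
  ⟨fun j i hi k k' hk => by simp only [hD.dependsOn j i hi hk],
    fun j i hi k => (Complex.abs_im_le_norm _).trans (hD.bound j i hi k)⟩

/-- The decomposition into the drift and a martingale, written by real and imaginary parts. -/
theorem IsDriven.sub_eq (hD : IsDriven a τ I D G B e c) (J : ℕ) (k : ℕ × κ → ℕ) :
    D J k - D 0 k = ∑ j ∈ Finset.range J, (a : ℂ) * ∑ i ∈ I, G j i k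
      + ((compSum a I (fun j i k => (G j i k).re) J k : ℂ)
        + (compSum a I (fun j i k => (G j i k).im) J k : ℂ) * Complex.I) := by
  induction J with
  | zero => simp [compSum]
  | succ J ih =>
    have hs : ∑ i ∈ I, (k (J, i) : ℂ) * G J i k
        = (a : ℂ) * ∑ i ∈ I, G J i k
          + (((∑ i ∈ I, ((k (J, i) : ℝ) - a) * (G J i k).re : ℝ) : ℂ)
            + ((∑ i ∈ I, ((k (J, i) : ℝ) - a) * (G J i k).im : ℝ) : ℂ) * Complex.I) := by
      push_cast
      rw [Finset.mul_sum, Finset.sum_mul, ← Finset.sum_add_distrib, ← Finset.sum_add_distrib]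
      refine Finset.sum_congr rfl fun i _ => ?_
      conv_lhs => rw [← Complex.re_add_im (G J i k)]
      conv_rhs => rw [← Complex.re_add_im (G J i k)]
      simp only [Complex.add_re, Complex.ofReal_re, Complex.mul_re, Complex.I_re, mul_zero,
        Complex.ofReal_im, Complex.I_im, mul_one, sub_self, add_zero, Complex.add_im,
        Complex.mul_im, zero_add]
      ring
    rw [hD.succ, Finset.sum_range_succ, compSum_succ, compSum_succ, hs]
    push_cast at ih ⊢
    linear_combination ih

theorem norm_add_mul_I_sq (x y : ℝ) : ‖(x : ℂ) + (y : ℂ) * Complex.I‖ ^ 2 = x ^ 2 + y ^ 2 := by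
  rw [← Complex.normSq_eq_norm_sq, Complex.normSq_add_mul_I]

/-- The drift is deterministic up to the error `e`; the rest is a martingale. -/
theorem IsDriven.norm_sub_sq_le (hD : IsDriven a τ I D G B e c) (hτ : 0 ≤ τ) (J : ℕ)
    (k : ℕ × κ → ℕ) :
    ‖D J k - D 0 k‖ ^ 2 ≤ 2 * (J * τ * (‖c‖ + e)) ^ 2
      + 2 * (compSum a I (fun j i k => (G j i k).re) J k ^ 2
        + compSum a I (fun j i k => (G j i k).im) J k ^ 2) := by
  rw [hD.sub_eq, ← norm_add_mul_I_sq]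
  set X := ∑ j ∈ Finset.range J, (a : ℂ) * ∑ i ∈ I, G j i k
  set Y := (compSum a I (fun j i k => (G j i k).re) J k : ℂ)
        + (compSum a I (fun j i k => (G j i k).im) J k : ℂ) * Complex.I
  have hX : ‖X‖ ≤ J * τ * (‖c‖ + e) := by
    refine (norm_sum_le _ _).trans ?_
    have : ∀ j ∈ Finset.range J, ‖(a : ℂ) * ∑ i ∈ I, G j i k‖ ≤ τ * (‖c‖ + e) := by
      intro j _
      have h1 := hD.mean j k
      have h2 := norm_sub_norm_le ((a : ℂ) * ∑ i ∈ I, G j i k) (τ * c)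
      rw [norm_mul (τ : ℂ), Complex.norm_real, Real.norm_of_nonneg hτ] at h2
      linarith
    refine (Finset.sum_le_sum this).trans (le_of_eq ?_)
    simp; ring
  have h1 : ‖X‖ ^ 2 ≤ (J * τ * (‖c‖ + e)) ^ 2 := pow_le_pow_left₀ (norm_nonneg _) hX 2
  have h2 := pow_le_pow_left₀ (norm_nonneg _) (norm_add_le X Y) 2
  nlinarith [sq_nonneg (‖X‖ - ‖Y‖)]

theorem IsDriven.sum_integral_eq (hD : IsDriven a τ I D G B e c) (h : IsCountArray P ξ a) (j : ℕ) :
    Integrable (fun ω => a * ∑ i ∈ I, ‖G j i fun p => ξ p ω‖ ^ 2) P ∧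
    ∑ i ∈ I, a * ∫ ω, (G j i fun p => ξ p ω).re ^ 2 ∂P
      + ∑ i ∈ I, a * ∫ ω, (G j i fun p => ξ p ω).im ^ 2 ∂P
      = ∫ ω, a * ∑ i ∈ I, ‖G j i fun p => ξ p ω‖ ^ 2 ∂P := by
  have hre : ∀ i ∈ I, Integrable (fun ω => (G j i fun p => ξ p ω).re ^ 2) P := fun i hi =>
    MemLp.integrable_sq (MemLp.of_bound (measurable_of_dependsOn h.measurable
      (hD.isPredictable_re.dependsOn j i hi)).aestronglyMeasurable B
      (Filter.Eventually.of_forall fun ω => hD.isPredictable_re.bound j i hi _))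
  have him : ∀ i ∈ I, Integrable (fun ω => (G j i fun p => ξ p ω).im ^ 2) P := fun i hi =>
    MemLp.integrable_sq (MemLp.of_bound (measurable_of_dependsOn h.measurable
      (hD.isPredictable_im.dependsOn j i hi)).aestronglyMeasurable B
      (Filter.Eventually.of_forall fun ω => hD.isPredictable_im.bound j i hi _))
  have e : ∀ z : ℂ, ‖z‖ ^ 2 = z.re ^ 2 + z.im ^ 2 := fun z => by
    rw [← Complex.normSq_eq_norm_sq, Complex.normSq_apply]; ring
  have hs : ∀ i ∈ I, Integrable (fun ω => ‖G j i fun p => ξ p ω‖ ^ 2) P := by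
    intro i hi
    simp only [e]
    exact (hre i hi).add (him i hi)
  refine ⟨(integrable_finsetSum _ hs).const_mul a, ?_⟩
  rw [integral_const_mul, integral_finsetSum _ hs, Finset.mul_sum, ← Finset.sum_add_distrib]
  refine Finset.sum_congr rfl fun i hi => ?_
  simp only [e]
  rw [integral_add (hre i hi) (him i hi), mul_add]

/-- The second moment of a driven process. -/
theorem IsDriven.integral_norm_sub_sq_le (hD : IsDriven a τ I D G B e c) (h : IsCountArray P ξ a)
    (hτ : 0 ≤ τ) (J : ℕ) :
    Integrable (fun ω => ‖D J (fun p => ξ p ω) - D 0 fun p => ξ p ω‖ ^ 2) P ∧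
    ∫ ω, ‖D J (fun p => ξ p ω) - D 0 fun p => ξ p ω‖ ^ 2 ∂P
      ≤ 2 * (J * τ * (‖c‖ + e)) ^ 2
        + 2 * ∑ j ∈ Finset.range J, ∫ ω, a * ∑ i ∈ I, ‖G j i fun p => ξ p ω‖ ^ 2 ∂P := by
  have h1 := (hD.isPredictable_re.memLp_compSum h J).integrable_sq
  have h2 := (hD.isPredictable_im.memLp_compSum h J).integrable_sq
  have h3 : Integrable (fun ω => 2 * (J * τ * (‖c‖ + e)) ^ 2
      + 2 * ((compSum a I (fun j i k => (G j i k).re) J fun p => ξ p ω) ^ 2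
        + (compSum a I (fun j i k => (G j i k).im) J fun p => ξ p ω) ^ 2)) P :=
    (integrable_const _).add ((h1.add h2).const_mul 2)
  have hdep : DependsOn (fun k => ‖D J k - D 0 k‖ ^ 2)
      ((Finset.range J ×ˢ I : Finset (ℕ × κ)) : Set (ℕ × κ)) := by
    intro k k' hk
    simp only [hD.dependsOn_apply J hk, hD.dependsOn_apply 0 fun p hp =>
      hk p (range_prod_mono I J.zero_le hp)]
  have hint : Integrable (fun ω => ‖D J (fun p => ξ p ω) - D 0 fun p => ξ p ω‖ ^ 2) P := by
    refine h3.mono' (measurable_of_dependsOn h.measurable hdep).aestronglyMeasurable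
      (Filter.Eventually.of_forall fun ω => ?_)
    rw [Real.norm_of_nonneg (sq_nonneg _)]
    exact hD.norm_sub_sq_le hτ J _
  refine ⟨hint, (integral_mono hint h3 fun ω => hD.norm_sub_sq_le hτ J _).trans (le_of_eq ?_)⟩
  have h12 : Integrable (fun ω =>
      2 * ((compSum a I (fun j i k => (G j i k).re) J fun p => ξ p ω) ^ 2
        + (compSum a I (fun j i k => (G j i k).im) J fun p => ξ p ω) ^ 2)) P :=
    (h1.add h2).const_mul 2
  rw [integral_add (integrable_const _) h12, integral_const, probReal_univ, one_smul,
    integral_const_mul, integral_add h1 h2, hD.isPredictable_re.integral_compSum_sq h,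
    hD.isPredictable_im.integral_compSum_sq h,
    ← Finset.sum_add_distrib]
  simp only [(hD.sum_integral_eq h _).2]

/-- The second moment of the running maximum of a driven process. -/
theorem IsDriven.exists_integrable_bound (hD : IsDriven a τ I D G B e c) (h : IsCountArray P ξ a)
    (hτ : 0 ≤ τ) (he : 0 ≤ e) (n : ℕ) :
    ∃ H : Ω → ℝ, Integrable H P ∧
      (∀ J ≤ n, ∀ ω, ‖D J (fun p => ξ p ω) - D 0 fun p => ξ p ω‖ ^ 2 ≤ H ω) ∧
      ∫ ω, H ω ∂P ≤ 2 * (n * τ * (‖c‖ + e)) ^ 2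
        + 8 * ∑ j ∈ Finset.range n, ∫ ω, a * ∑ i ∈ I, ‖G j i fun p => ξ p ω‖ ^ 2 ∂P := by
  obtain ⟨h1, h1'⟩ := hD.isPredictable_re.integral_runMax_sq_le h n
  obtain ⟨h2, h2'⟩ := hD.isPredictable_im.integral_runMax_sq_le h n
  have h12 : Integrable (fun ω =>
      2 * (runMax (fun J => |compSum a I (fun j i k => (G j i k).re) J fun p => ξ p ω|) n ^ 2
        + runMax (fun J => |compSum a I (fun j i k => (G j i k).im) J fun p => ξ p ω|) n ^ 2)) P :=
    (h1.add h2).const_mul 2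
  refine ⟨fun ω => 2 * (n * τ * (‖c‖ + e)) ^ 2
      + 2 * (runMax (fun J => |compSum a I (fun j i k => (G j i k).re) J fun p => ξ p ω|) n ^ 2
        + runMax (fun J => |compSum a I (fun j i k => (G j i k).im) J fun p => ξ p ω|) n ^ 2),
    (integrable_const _).add h12, fun J hJ ω => ?_, ?_⟩
  · refine (hD.norm_sub_sq_le hτ J _).trans ?_
    have b1 := le_runMax (fun J => |compSum a I (fun j i k => (G j i k).re) J fun p => ξ p ω|) hJ
    have b2 := le_runMax (fun J => |compSum a I (fun j i k => (G j i k).im) J fun p => ξ p ω|) hJ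
    have c1 := pow_le_pow_left₀ (abs_nonneg _) b1 2
    have c2 := pow_le_pow_left₀ (abs_nonneg _) b2 2
    rw [sq_abs] at c1 c2
    have hJ' : (J : ℝ) ≤ n := by exact_mod_cast hJ
    have c3 : (J * τ * (‖c‖ + e)) ^ 2 ≤ (n * τ * (‖c‖ + e)) ^ 2 := by gcongr
    linarith
  · rw [integral_add (integrable_const _) h12, integral_const, probReal_univ, one_smul,
      integral_const_mul, integral_add h1 h2]
    have hsum : ∑ j ∈ Finset.range n, ∫ ω, a * ∑ i ∈ I, ‖G j i fun p => ξ p ω‖ ^ 2 ∂P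
        = ∑ j ∈ Finset.range n, ∑ i ∈ I, a * ∫ ω, (G j i fun p => ξ p ω).re ^ 2 ∂P
          + ∑ j ∈ Finset.range n, ∑ i ∈ I, a * ∫ ω, (G j i fun p => ξ p ω).im ^ 2 ∂P := by
      rw [← Finset.sum_add_distrib]
      exact Finset.sum_congr rfl fun j _ => ((hD.sum_integral_eq h j).2).symm
    rw [hsum]
    linarith

/-- The discretised flow: in slot `J` the state jumps by `∑_i k_{J,i} u_i`. -/
def gridFlow (I : Finset κ) (u : κ → ℂ → ℂ) (k : ℕ × κ → ℕ) (z : ℂ) : ℕ → ℂ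
  | 0 => z
  | J + 1 => gridFlow I u k z J + ∑ i ∈ I, (k (J, i) : ℂ) * u i (gridFlow I u k z J)

/-- The jumps `u_i` preserve `{Im ≥ y}` and are bounded there; their mean is `τ c / a` up to an
error `τ e / a`, and the mean of their squares is at most `τ C / a`. -/
structure GridJumps (I : Finset κ) (u : κ → ℂ → ℂ) (a τ y B C e : ℝ) (c : ℂ) : Prop where
  im_nonneg : ∀ i ∈ I, ∀ w, y ≤ w.im → 0 ≤ (u i w).im
  bound : ∀ i ∈ I, ∀ w, y ≤ w.im → ‖u i w‖ ≤ B
  mean : ∀ w, y ≤ w.im → ‖(a : ℂ) * ∑ i ∈ I, u i w - τ * c‖ ≤ τ * e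
  sq : ∀ w, y ≤ w.im → a * ∑ i ∈ I, ‖u i w‖ ^ 2 ≤ τ * C

variable {u u' : κ → ℂ → ℂ} {y C : ℝ} {z : ℂ}

theorem le_im_gridFlow (hu : ∀ i ∈ I, ∀ w, y ≤ w.im → 0 ≤ (u i w).im) (hz : y ≤ z.im)
    (k : ℕ × κ → ℕ) (J : ℕ) : y ≤ (gridFlow I u k z J).im := by
  induction J with
  | zero => exact hz
  | succ J ih =>
    rw [gridFlow, Complex.add_im, Complex.im_sum]
    have : 0 ≤ ∑ i ∈ I, ((k (J, i) : ℂ) * u i (gridFlow I u k z J)).im := by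
      refine Finset.sum_nonneg fun i hi => ?_
      rw [show (k (J, i) : ℂ) = ((k (J, i) : ℝ) : ℂ) by simp, Complex.im_ofReal_mul]
      exact mul_nonneg (Nat.cast_nonneg _) (hu i hi _ ih)
    linarith

theorem dependsOn_gridFlow (I : Finset κ) (u : κ → ℂ → ℂ) (z : ℂ) (J : ℕ) :
    DependsOn (fun k => gridFlow I u k z J)
      ((Finset.range J ×ˢ I : Finset (ℕ × κ)) : Set (ℕ × κ)) := by
  induction J with
  | zero => intro k k' _; rfl
  | succ J ih =>
    intro k k' hk
    have h1 := ih fun p hp => hk p (range_prod_mono I J.le_succ hp)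
    simp only at h1
    simp only [gridFlow, h1]
    congr 1
    refine Finset.sum_congr rfl fun i hi => ?_
    rw [hk (J, i) (by simp [hi])]

theorem GridJumps.isDriven (hu : GridJumps I u a τ y B C e c) (hz : y ≤ z.im) :
    IsDriven a τ I (fun J k => gridFlow I u k z J)
      (fun j i k => u i (gridFlow I u k z j)) B e c where
  succ J k := rfl
  dependsOn_zero := dependsOn_gridFlow I u z 0
  dependsOn j i _ := by
    intro k k' hk
    have := dependsOn_gridFlow I u z j hk
    simp only at this
    simp only [this]
  bound j i hi k := hu.bound i hi _ (le_im_gridFlow hu.im_nonneg hz k j)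
  mean j k := hu.mean _ (le_im_gridFlow hu.im_nonneg hz k j)

theorem GridJumps.isDriven_sub {e' : ℝ} {c' : ℂ} (hu : GridJumps I u a τ y B C e c)
    (hu' : GridJumps I u' a τ y B C e' c') (hz : y ≤ z.im) :
    IsDriven a τ I (fun J k => gridFlow I u k z J - gridFlow I u' k z J)
      (fun j i k => u i (gridFlow I u k z j) - u' i (gridFlow I u' k z j)) (B + B) (e + e')
      (c - c') where
  succ J k := by
    simp only [gridFlow, mul_sub, Finset.sum_sub_distrib]
    ring
  dependsOn_zero := by intro k k' _; rfl
  dependsOn j i _ := by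
    intro k k' hk
    have h1 := dependsOn_gridFlow I u z j hk
    have h2 := dependsOn_gridFlow I u' z j hk
    simp only at h1 h2
    simp only [h1, h2]
  bound j i hi k := (norm_sub_le _ _).trans
    (add_le_add (hu.bound i hi _ (le_im_gridFlow hu.im_nonneg hz k j))
      (hu'.bound i hi _ (le_im_gridFlow hu'.im_nonneg hz k j)))
  mean j k := by
    have h1 := hu.mean _ (le_im_gridFlow hu.im_nonneg hz k j)
    have h2 := hu'.mean _ (le_im_gridFlow hu'.im_nonneg hz k j)
    rw [Finset.sum_sub_distrib, mul_add]
    refine le_trans (le_of_eq ?_) ((norm_sub_le _ _).trans (add_le_add h1 h2))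
    congr 1; ring

/-- A discrete Grönwall inequality. -/
theorem le_mul_pow_of_le_add_sum {x : ℕ → ℝ} {α β : ℝ} (hβ : 0 ≤ β)
    (hx : ∀ J, x J ≤ α + β * ∑ j ∈ Finset.range J, x j) (J : ℕ) :
    α + β * ∑ j ∈ Finset.range J, x j ≤ α * (1 + β) ^ J := by
  induction J with
  | zero => simp
  | succ J ih =>
    rw [Finset.sum_range_succ, pow_succ]
    have := hx J
    nlinarith

/-- The bound for the second moment of a discretised flow. -/
def momentBound (t C e : ℝ) (c z : ℂ) : ℝ :=
  2 * ‖z‖ ^ 2 + 2 * (2 * (t * (‖c‖ + e)) ^ 2 + 2 * (t * C))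

theorem GridJumps.integral_norm_gridFlow_sq_le (hu : GridJumps I u a τ y B C e c)
    (h : IsCountArray P ξ a) (hτ : 0 ≤ τ) (he : 0 ≤ e) (hC : 0 ≤ C) (hz : y ≤ z.im) {n : ℕ} {t : ℝ}
    (hn : n * τ ≤ t) {J : ℕ} (hJ : J ≤ n) :
    Integrable (fun ω => ‖gridFlow I u (fun p => ξ p ω) z J‖ ^ 2) P ∧
    ∫ ω, ‖gridFlow I u (fun p => ξ p ω) z J‖ ^ 2 ∂P ≤ momentBound t C e c z := by
  have hD := hu.isDriven hz
  obtain ⟨h1, h2⟩ := hD.integral_norm_sub_sq_le h hτ J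
  have hJt : J * τ ≤ t := by
    have : (J : ℝ) ≤ n := by exact_mod_cast hJ
    exact (mul_le_mul_of_nonneg_right this hτ).trans hn
  have hsum : ∑ j ∈ Finset.range J, ∫ ω, a * ∑ i ∈ I,
      ‖u i (gridFlow I u (fun p => ξ p ω) z j)‖ ^ 2 ∂P ≤ t * C := by
    have : ∀ j ∈ Finset.range J, ∫ ω, a * ∑ i ∈ I,
        ‖u i (gridFlow I u (fun p => ξ p ω) z j)‖ ^ 2 ∂P ≤ τ * C := by
      intro j _
      refine (integral_mono (hD.sum_integral_eq h j).1 (integrable_const (τ * C)) fun ω =>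
        hu.sq _ (le_im_gridFlow hu.im_nonneg hz _ j)).trans (le_of_eq ?_)
      simp
    refine (Finset.sum_le_sum this).trans ?_
    rw [Finset.sum_const, Finset.card_range, nsmul_eq_mul, ← mul_assoc]
    gcongr
  have hdrift : (J * τ * (‖c‖ + e)) ^ 2 ≤ (t * (‖c‖ + e)) ^ 2 := by gcongr
  have hle : ∀ ω, ‖gridFlow I u (fun p => ξ p ω) z J‖ ^ 2
      ≤ 2 * ‖z‖ ^ 2 + 2 * ‖gridFlow I u (fun p => ξ p ω) z J - z‖ ^ 2 := by
    intro ω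
    have b1 := norm_add_le z (gridFlow I u (fun p => ξ p ω) z J - z)
    rw [add_sub_cancel] at b1
    have b2 := pow_le_pow_left₀ (norm_nonneg _) b1 2
    nlinarith [sq_nonneg (‖z‖ - ‖gridFlow I u (fun p => ξ p ω) z J - z‖)]
  have h1' : Integrable (fun ω => 2 * ‖gridFlow I u (fun p => ξ p ω) z J - z‖ ^ 2) P :=
    h1.const_mul 2
  have hint : Integrable (fun ω => ‖gridFlow I u (fun p => ξ p ω) z J‖ ^ 2) P := by
    refine ((integrable_const (2 * ‖z‖ ^ 2)).add h1').mono'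
      (((measurable_of_dependsOn h.measurable (dependsOn_gridFlow I u z J)).norm.pow_const
        2).aestronglyMeasurable) (Filter.Eventually.of_forall fun ω => ?_)
    rw [Real.norm_of_nonneg (sq_nonneg _)]
    exact hle ω
  refine ⟨hint, (integral_mono hint ((integrable_const (2 * ‖z‖ ^ 2)).add h1') hle).trans ?_⟩
  have e1 : ∫ ω, (2 * ‖z‖ ^ 2 + 2 * ‖gridFlow I u (fun p => ξ p ω) z J - z‖ ^ 2) ∂P
      = 2 * ‖z‖ ^ 2 + 2 * ∫ ω, ‖gridFlow I u (fun p => ξ p ω) z J - z‖ ^ 2 ∂P := by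
    rw [integral_add (integrable_const _) h1', integral_const, probReal_univ, one_smul,
      integral_const_mul]
  refine e1.le.trans ?_
  rw [momentBound]
  have h2' : ∫ ω, ‖gridFlow I u (fun p => ξ p ω) z J - z‖ ^ 2 ∂P
      ≤ 2 * (J * τ * (‖c‖ + e)) ^ 2 + 2 * ∑ j ∈ Finset.range J, ∫ ω, a * ∑ i ∈ I,
      ‖u i (gridFlow I u (fun p => ξ p ω) z j)‖ ^ 2 ∂P := h2
  linarith

/-- Two discretised flows driven by the same counts stay close in `L²`, uniformly in time, if
their mean jumps are close, if the jumps of the second one are Lipschitz in `L²`, and if the jumps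
of the two are `η`-close in `L²` at points of norm at most `R`: the martingale parts are compared
by orthogonality and the result follows from Grönwall's inequality; the event that the first flow
leaves the ball of radius `R` is controlled by its second moment. -/
theorem GridJumps.exists_integrable_bound_sub {e' η R t : ℝ} {c' : ℂ}
    (hu : GridJumps I u a τ y B C e c) (hu' : GridJumps I u' a τ y B C e' c')
    (h : IsCountArray P ξ a) (ha : 0 ≤ a) (hτ : 0 ≤ τ) (he : 0 ≤ e) (he' : 0 ≤ e') (hC : 0 ≤ C)
    (hη : 0 ≤ η) (hR : 0 < R) (hz : y ≤ z.im) {n : ℕ} (hn : n * τ ≤ t)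
    (hlip : ∀ w w', y ≤ w.im → y ≤ w'.im →
      a * ∑ i ∈ I, ‖u' i w - u' i w'‖ ^ 2 ≤ τ * C * ‖w - w'‖ ^ 2)
    (hclose : ∀ w, y ≤ w.im → ‖w‖ ≤ R → a * ∑ i ∈ I, ‖u i w - u' i w‖ ^ 2 ≤ τ * η) :
    ∃ H : Ω → ℝ, Integrable H P ∧
      (∀ J ≤ n, ∀ ω, ‖gridFlow I u (fun p => ξ p ω) z J - gridFlow I u' (fun p => ξ p ω) z J‖ ^ 2
        ≤ H ω) ∧
      ∫ ω, H ω ∂P ≤ 4 * (2 * (t * (‖c - c'‖ + (e + e'))) ^ 2 + 4 * (t * η)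
        + 16 * (t * C) * momentBound t C e c z / R ^ 2) * Real.exp (4 * t * C) := by
  have hD := hu.isDriven_sub hu' hz
  set Q := momentBound t C e c z with hQ
  have ht : 0 ≤ t := (by positivity : (0 : ℝ) ≤ n * τ).trans hn
  have hQ0 : 0 ≤ Q := by rw [hQ, momentBound]; positivity
  obtain ⟨H, hH1, hH2, hH3⟩ := hD.exists_integrable_bound h hτ (add_nonneg he he') n
  have h0 : ∀ k : ℕ × κ → ℕ, gridFlow I u k z 0 - gridFlow I u' k z 0 = 0 := fun k => sub_self z
  refine ⟨H, hH1, fun J hJ ω => ?_, ?_⟩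
  · have := hH2 J hJ ω
    simp only [h0, sub_zero] at this
    exact this
  set α := 2 * (t * (‖c - c'‖ + (e + e'))) ^ 2 + 4 * (t * η) + 16 * (t * C) * Q / R ^ 2 with hα
  have hα0 : 0 ≤ α := by positivity
  set x : ℕ → ℝ := fun J => ∫ ω,
    ‖gridFlow I u (fun p => ξ p ω) z J - gridFlow I u' (fun p => ξ p ω) z J‖ ^ 2 ∂P with hx
  set S : ℕ → ℝ := fun j => ∫ ω, a * ∑ i ∈ I, ‖u i (gridFlow I u (fun p => ξ p ω) z j)
    - u' i (gridFlow I u' (fun p => ξ p ω) z j)‖ ^ 2 ∂P with hS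
  have hxint : ∀ J, Integrable (fun ω =>
      ‖gridFlow I u (fun p => ξ p ω) z J - gridFlow I u' (fun p => ξ p ω) z J‖ ^ 2) P := by
    intro J
    have := (hD.integral_norm_sub_sq_le h hτ J).1
    simp only [h0, sub_zero] at this
    exact this
  -- The square of the norm exceeds `R²` off the ball, so the crude bound `4 τ C` is absorbed there.
  have hpt : ∀ w w', y ≤ w.im → y ≤ w'.im → a * ∑ i ∈ I, ‖u i w - u' i w'‖ ^ 2
      ≤ 2 * (τ * η) + 8 * (τ * C) / R ^ 2 * ‖w‖ ^ 2 + 2 * (τ * C) * ‖w - w'‖ ^ 2 := by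
    intro w w' hw hw'
    have h1 : a * ∑ i ∈ I, ‖u i w - u' i w'‖ ^ 2
        ≤ 2 * (a * ∑ i ∈ I, ‖u i w - u' i w‖ ^ 2) + 2 * (a * ∑ i ∈ I, ‖u' i w - u' i w'‖ ^ 2) := by
      calc _ ≤ a * ∑ i ∈ I, (2 * ‖u i w - u' i w‖ ^ 2 + 2 * ‖u' i w - u' i w'‖ ^ 2) := by
            gcongr with i hi
            have := norm_sub_sq_le_two_mul (u i w - u' i w) (u' i w' - u' i w)
            rw [sub_sub_sub_cancel_right, norm_sub_rev (u' i w')] at this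
            exact this
        _ = _ := by rw [Finset.sum_add_distrib, ← Finset.mul_sum, ← Finset.mul_sum]; ring
    have h2 := hlip w w' hw hw'
    have h3 : a * ∑ i ∈ I, ‖u i w - u' i w‖ ^ 2 ≤ τ * η + 4 * (τ * C) / R ^ 2 * ‖w‖ ^ 2 := by
      rcases le_or_gt ‖w‖ R with hwR | hwR
      · have := hclose w hw hwR
        have : 0 ≤ 4 * (τ * C) / R ^ 2 * ‖w‖ ^ 2 := by positivity
        linarith
      · have b1 : a * ∑ i ∈ I, ‖u i w - u' i w‖ ^ 2
            ≤ 2 * (a * ∑ i ∈ I, ‖u i w‖ ^ 2) + 2 * (a * ∑ i ∈ I, ‖u' i w‖ ^ 2) := by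
          calc _ ≤ a * ∑ i ∈ I, (2 * ‖u i w‖ ^ 2 + 2 * ‖u' i w‖ ^ 2) := by
                gcongr with i hi
                exact norm_sub_sq_le_two_mul _ _
            _ = _ := by rw [Finset.sum_add_distrib, ← Finset.mul_sum, ← Finset.mul_sum]; ring
        have b2 := hu.sq w hw
        have b3 := hu'.sq w hw
        have b4 : 4 * (τ * C) ≤ 4 * (τ * C) / R ^ 2 * ‖w‖ ^ 2 := by
          rw [div_mul_eq_mul_div, le_div_iff₀ (by positivity)]
          gcongr
        have : 0 ≤ τ * η := by positivity
        linarith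
    have e1 : 8 * (τ * C) / R ^ 2 * ‖w‖ ^ 2 = 2 * (4 * (τ * C) / R ^ 2 * ‖w‖ ^ 2) := by ring
    rw [e1]
    linarith
  have hSle : ∀ j ≤ n, S j ≤ 2 * (τ * η) + 8 * (τ * C) / R ^ 2 * Q + 2 * (τ * C) * x j := by
    intro j hj
    obtain ⟨m1, m2⟩ := hu.integral_norm_gridFlow_sq_le h hτ he hC hz hn hj
    have i1 : Integrable (fun ω => 2 * (τ * η) + 8 * (τ * C) / R ^ 2
        * ‖gridFlow I u (fun p => ξ p ω) z j‖ ^ 2) P :=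
      (integrable_const _).add (m1.const_mul _)
    have i2 := (hxint j).const_mul (2 * (τ * C))
    refine (integral_mono (hD.sum_integral_eq h j).1 (i1.add i2) fun ω => hpt _ _
      (le_im_gridFlow hu.im_nonneg hz _ j) (le_im_gridFlow hu'.im_nonneg hz _ j)).trans ?_
    have e1 : ∫ ω, (2 * (τ * η) + 8 * (τ * C) / R ^ 2 * ‖gridFlow I u (fun p => ξ p ω) z j‖ ^ 2
        + 2 * (τ * C) * ‖gridFlow I u (fun p => ξ p ω) z j
          - gridFlow I u' (fun p => ξ p ω) z j‖ ^ 2) ∂P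
        = 2 * (τ * η) + 8 * (τ * C) / R ^ 2 * ∫ ω, ‖gridFlow I u (fun p => ξ p ω) z j‖ ^ 2 ∂P
          + 2 * (τ * C) * x j := by
      rw [integral_add i1 i2, integral_add (integrable_const _) (m1.const_mul _), integral_const,
        probReal_univ, one_smul, integral_const_mul, integral_const_mul]
    refine e1.le.trans ?_
    gcongr
  have hSsum : ∀ J ≤ n, 2 * ∑ j ∈ Finset.range J, S j ≤ 4 * (t * η) + 16 * (t * C) * Q / R ^ 2
      + 4 * (τ * C) * ∑ j ∈ Finset.range J, x j := by
    intro J hJ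
    have hJt : J * τ ≤ t := by
      have : (J : ℝ) ≤ n := by exact_mod_cast hJ
      exact (mul_le_mul_of_nonneg_right this hτ).trans hn
    have b1 : ∑ j ∈ Finset.range J, S j ≤ ∑ j ∈ Finset.range J,
        (2 * (τ * η) + 8 * (τ * C) / R ^ 2 * Q + 2 * (τ * C) * x j) :=
      Finset.sum_le_sum fun j hj => hSle j ((Finset.mem_range.1 hj).le.trans hJ)
    rw [Finset.sum_add_distrib, Finset.sum_const, Finset.card_range, nsmul_eq_mul,
      ← Finset.mul_sum] at b1
    have b2 : J * (2 * (τ * η) + 8 * (τ * C) / R ^ 2 * Q)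
        ≤ 2 * (t * η) + 8 * (t * C) / R ^ 2 * Q := by
      have : J * (2 * (τ * η) + 8 * (τ * C) / R ^ 2 * Q)
          = 2 * ((J * τ) * η) + 8 * ((J * τ) * C) / R ^ 2 * Q := by ring
      rw [this]
      gcongr
    have b3 : 16 * (t * C) * Q / R ^ 2 = 2 * (8 * (t * C) / R ^ 2 * Q) := by ring
    rw [b3]
    linarith
  have hxle : ∀ J ≤ n, x J ≤ α + 4 * (τ * C) * ∑ j ∈ Finset.range J, x j := by
    intro J hJ
    have hJt : J * τ ≤ t := by
      have : (J : ℝ) ≤ n := by exact_mod_cast hJ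
      exact (mul_le_mul_of_nonneg_right this hτ).trans hn
    have b1 := (hD.integral_norm_sub_sq_le h hτ J).2
    simp only [h0, sub_zero] at b1
    have b2 := hSsum J hJ
    have b3 : (J * τ * (‖c - c'‖ + (e + e'))) ^ 2 ≤ (t * (‖c - c'‖ + (e + e'))) ^ 2 := by gcongr
    have b4 : x J ≤ 2 * (J * τ * (‖c - c'‖ + (e + e'))) ^ 2 + 2 * ∑ j ∈ Finset.range J, S j := b1
    linarith
  have hgron : α + 4 * (τ * C) * ∑ j ∈ Finset.range n, x j ≤ α * (1 + 4 * (τ * C)) ^ n := by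
    have hx0 : ∀ J, 0 ≤ x J := fun J => integral_nonneg fun ω => sq_nonneg _
    -- Truncating `x` after time `n` makes the hypothesis of Grönwall's inequality hold for all `J`.
    have := le_mul_pow_of_le_add_sum (x := fun J => if J ≤ n then x J else 0) (α := α)
      (β := 4 * (τ * C)) (by positivity) (fun J => by
        have hs : 0 ≤ ∑ j ∈ Finset.range J, (if j ≤ n then x j else 0) :=
          Finset.sum_nonneg fun j _ => by split_ifs; exacts [hx0 j, le_rfl]
        by_cases hJ : J ≤ n
        · rw [if_pos hJ]
          refine (hxle J hJ).trans (le_of_eq ?_)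
          congr 2
          exact Finset.sum_congr rfl fun j hj =>
            (if_pos ((Finset.mem_range.1 hj).le.trans hJ)).symm
        · rw [if_neg hJ]; positivity) n
    refine le_trans (le_of_eq ?_) this
    congr 2
    exact Finset.sum_congr rfl fun j hj => (if_pos (Finset.mem_range.1 hj).le).symm
  have hpow : (1 + 4 * (τ * C)) ^ n ≤ Real.exp (4 * t * C) := by
    have b1 := Real.add_one_le_exp (4 * (τ * C))
    calc (1 + 4 * (τ * C)) ^ n ≤ Real.exp (4 * (τ * C)) ^ n := by
          gcongr; linarith
      _ = Real.exp (n * (4 * (τ * C))) := by rw [← Real.exp_nat_mul]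
      _ ≤ _ := by
          apply Real.exp_le_exp.2
          have : (n : ℝ) * (4 * (τ * C)) = 4 * (n * τ) * C := by ring
          rw [this]
          gcongr
  have hfin := hSsum n le_rfl
  have hnt : (n * τ * (‖c - c'‖ + (e + e'))) ^ 2 ≤ (t * (‖c - c'‖ + (e + e'))) ^ 2 := by gcongr
  have hH3' : ∫ ω, H ω ∂P ≤ 2 * (n * τ * (‖c - c'‖ + (e + e'))) ^ 2
      + 8 * ∑ j ∈ Finset.range n, S j := hH3
  calc ∫ ω, H ω ∂P ≤ 4 * (α + 4 * (τ * C) * ∑ j ∈ Finset.range n, x j) := by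
        have : 0 ≤ (t * (‖c - c'‖ + (e + e'))) ^ 2 := sq_nonneg _
        linarith
    _ ≤ 4 * (α * Real.exp (4 * t * C)) := by
        gcongr
        exact hgron.trans (by gcongr)
    _ = _ := by ring

end Driven

/-! ### Counts of a Poisson point process -/

open scoped NNReal Nat in
/-- The identity `E[n F(n - 1)] = r E[F(n)]` for the Poisson distribution with mean `r`. -/
theorem hasSum_poisson_mul {r : ℝ≥0} {F : ℕ → ℝ} {S : ℝ}
    (h : HasSum (fun n => Real.exp (-r) * r ^ n / (n)! * F n) S) :
    HasSum (fun n : ℕ => Real.exp (-r) * r ^ n / (n)! * (n * F (n - 1))) (r * S) := by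
  rw [← hasSum_nat_add_iff' 1]
  simp only [Finset.range_one, Finset.sum_singleton, Nat.cast_zero, zero_mul, mul_zero, sub_zero,
    Nat.add_sub_cancel]
  refine (h.mul_left (r : ℝ)).congr_fun fun n => ?_
  rw [Nat.factorial_succ]
  have h1 : ((n)! : ℝ) ≠ 0 := by positivity
  have h2 : ((n : ℝ) + 1) ≠ 0 := by positivity
  push_cast
  field_simp
  ring

open scoped NNReal Nat in
theorem poissonMeasure_moments (r : ℝ≥0) :
    MemLp (fun n : ℕ => (n : ℝ)) 2 (poissonMeasure r) ∧ ∫ n, (n : ℝ) ∂poissonMeasure r = r ∧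
      ∫ n, ((n : ℝ) - r) ^ 2 ∂poissonMeasure r = r := by
  have h0 : HasSum (fun n => Real.exp (-r) * r ^ n / (n)! * (fun _ : ℕ => (1 : ℝ)) n) 1 := by
    simpa using hasSum_one_poissonMeasure r
  have h1 := hasSum_poisson_mul h0
  have h2 := hasSum_poisson_mul h1
  simp only [mul_one] at h0 h1 h2
  have h1' : HasSum (fun n : ℕ => Real.exp (-r) * r ^ n / (n)! * (n : ℝ) ^ 2) (r * r + r) := by
    refine (h2.add h1).congr_fun fun n => ?_
    rcases n with _ | n
    · simp
    · push_cast [Nat.add_sub_cancel]; ring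
  have hint : Integrable (fun n : ℕ => (n : ℝ) ^ 2) (poissonMeasure r) := by
    rw [integrable_poissonMeasure_iff]
    simpa using h1'.summable
  refine ⟨(memLp_two_iff_integrable_sq Measurable.of_discrete.aestronglyMeasurable).2 hint, ?_, ?_⟩
  · rw [integral_poissonMeasure]
    simpa using h1.tsum_eq
  · rw [integral_poissonMeasure]
    have : HasSum (fun n : ℕ => Real.exp (-r) * r ^ n / (n)! * ((n : ℝ) - r) ^ 2)
        (r * r + r - 2 * r * r + r ^ 2 * 1) := by
      refine ((h1'.sub (h1.mul_left (2 * (r : ℝ)))).add (h0.mul_left ((r : ℝ) ^ 2))).congr_fun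
        fun n => ?_
      ring
    simp only [smul_eq_mul]
    rw [this.tsum_eq]
    ring

section PoissonCounts

variable {X Ω : Type*} [MeasurableSpace X] [MeasurableSpace Ω] {ν : Measure X} {P : Measure Ω}
  {A : Ω → Set X}

theorem IsPoissonPointProcess.ae_finite (hA : IsPoissonPointProcess ν P A) {B : Set X}
    (hB : MeasurableSet B) (hν : ν B ≠ ∞) : ∀ᵐ ω ∂P, (A ω ∩ B).Finite := by
  have h1 : P.map (fun ω => (A ω ∩ B).encard) {⊤} = 0 := by
    rw [hA.map_count B hB hν, Measure.map_apply Measurable.of_discrete .of_discrete]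
    convert! measure_empty (μ := poissonMeasure (ν B).toNNReal)
    ext n
    exact iff_of_false (ENat.natCast_ne_top n) (Set.notMem_empty n)
  rw [Measure.map_apply (hA.measurable_count B hB) .of_discrete] at h1
  filter_upwards [measure_eq_zero_iff_ae_notMem.1 h1] with ω hω
  exact Set.encard_ne_top_iff.1 hω

theorem IsPoissonPointProcess.measurable_ncard (hA : IsPoissonPointProcess ν P A) {B : Set X}
    (hB : MeasurableSet B) : Measurable fun ω => (A ω ∩ B).ncard :=
  (Measurable.of_discrete (f := ENat.toNat)).comp (hA.measurable_count B hB)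

theorem IsPoissonPointProcess.map_ncard (hA : IsPoissonPointProcess ν P A) {B : Set X}
    (hB : MeasurableSet B) (hν : ν B ≠ ∞) :
    P.map (fun ω => (A ω ∩ B).ncard) = poissonMeasure (ν B).toNNReal := by
  have h1 := Measure.map_map (μ := P) (Measurable.of_discrete (f := ENat.toNat))
    (hA.measurable_count B hB)
  rw [hA.map_count B hB hν, Measure.map_map Measurable.of_discrete Measurable.of_discrete] at h1
  have h2 : ENat.toNat ∘ (Nat.cast : ℕ → ℕ∞) = id := by ext n; simp
  rw [h2, Measure.map_id] at h1
  exact h1.symm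

/-- The counts of a Poisson process in disjoint cells of equal measure. -/
theorem IsPoissonPointProcess.isCountArray (hA : IsPoissonPointProcess ν P A) {ι : Type*}
    {B : ι → Set X} (hB : ∀ i, MeasurableSet (B i))
    (hdisj : Pairwise fun i j => Disjoint (B i) (B j)) {a : ℝ} (ha : 0 ≤ a)
    (hν : ∀ i, ν (B i) = ENNReal.ofReal a) :
    IsCountArray P (fun i ω => (A ω ∩ B i).ncard) a := by
  have hfin : ∀ i, ν (B i) ≠ ∞ := fun i => by rw [hν]; exact ENNReal.ofReal_ne_top
  have hm := fun i => hA.measurable_ncard (hB i)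
  have hmap := fun i => hA.map_ncard (hB i) (hfin i)
  have hr : ∀ i, (((ν (B i)).toNNReal : NNReal) : ℝ) = a := fun i => by
    rw [hν, ENNReal.coe_toNNReal_eq_toReal, ENNReal.toReal_ofReal ha]
  have hmom := fun i => poissonMeasure_moments (ν (B i)).toNNReal
  refine ⟨hm, ?_, fun i => ?_, fun i => ?_, fun i => ?_⟩
  · have hind : iIndepFun (fun i ω => (A ω ∩ B i).encard) P := by
      rw [iIndepFun_iff_finset]
      intro s
      have h1 := hA.indep_count s.card (fun k => B (s.equivFin.symm k)) (fun _ => hB _)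
        (fun k l hkl => hdisj fun h => hkl (s.equivFin.symm.injective (Subtype.ext h)))
      have h2 := h1.precomp s.equivFin.injective
      simpa [Finset.restrict_def] using h2
    exact hind.comp (fun _ => ENat.toNat) fun _ => Measurable.of_discrete
  · have := (hmom i).1
    rw [← hmap i] at this
    exact this.comp_measurePreserving ⟨hm i, rfl⟩
  · have h1 := integral_map (μ := P) (hm i).aemeasurable
      (f := fun n : ℕ => (n : ℝ)) Measurable.of_discrete.aestronglyMeasurable
    rw [hmap i, (hmom i).2.1, hr] at h1
    exact h1.symm
  · have h1 := integral_map (μ := P) (hm i).aemeasurable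
      (f := fun n : ℕ => ((n : ℝ) - a) ^ 2) Measurable.of_discrete.aestronglyMeasurable
    have h2 := (hmom i).2.2
    rw [hr] at h2
    rw [hmap i, h2] at h1
    exact h1.symm

end PoissonCounts

/-- The cell `[ih, (i+1)h) × (jτ, (j+1)τ]` with `h = mesh n`, indexed by `(j, i)`. -/
def cell (n : ℕ) (τ : ℝ) (p : ℕ × ℤ) : Set (ℝ × ℝ) :=
  Set.Ico (p.2 * mesh n) ((p.2 + 1) * mesh n) ×ˢ Set.Ioc (p.1 * τ) ((p.1 + 1) * τ)

/-- The index `j` of the time slot `(jτ, (j+1)τ]` of a positive time; the truncated subtraction is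
harmless because `⌈s / τ⌉₊` is positive. -/
def timeSlot (τ s : ℝ) : ℕ := ⌈s / τ⌉₊ - 1

theorem measurableSet_cell (n : ℕ) (τ : ℝ) (p : ℕ × ℤ) : MeasurableSet (cell n τ p) :=
  measurableSet_Ico.prod measurableSet_Ioc

theorem timeSlot_lt_iff {τ s : ℝ} (hτ : 0 < τ) (hs : 0 < s) {J : ℕ} :
    timeSlot τ s < J ↔ s ≤ J * τ := by
  have h1 : 0 < ⌈s / τ⌉₊ := Nat.ceil_pos.2 (div_pos hs hτ)
  rw [timeSlot, show ⌈s / τ⌉₊ - 1 < J ↔ ⌈s / τ⌉₊ ≤ J by omega, Nat.ceil_le, div_le_iff₀ hτ]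

theorem timeSlot_eq_iff {τ s : ℝ} (hτ : 0 < τ) (hs : 0 < s) {J : ℕ} :
    timeSlot τ s = J ↔ s ∈ Set.Ioc (J * τ) ((J + 1) * τ) := by
  have h1 := timeSlot_lt_iff hτ hs (J := J)
  have h2 := timeSlot_lt_iff hτ hs (J := J + 1)
  push_cast at h2
  rw [Set.mem_Ioc, ← h2, ← not_le, ← h1]
  omega

theorem mem_cell_iff {n : ℕ} {τ : ℝ} (hτ : 0 < τ) {q : ℝ × ℝ} (hq : 0 < q.2) {j : ℕ} {i : ℤ} :
    q ∈ cell n τ (j, i) ↔ timeSlot τ q.2 = j ∧ ⌊q.1 / mesh n⌋ = i := by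
  rw [cell, Set.mem_prod, timeSlot_eq_iff hτ hq, Int.floor_eq_iff, le_div_iff₀ (mesh_pos n),
    div_lt_iff₀ (mesh_pos n), Set.mem_Ico]
  exact and_comm

theorem pos_of_mem_cell {n : ℕ} {τ : ℝ} (hτ : 0 < τ) {p : ℕ × ℤ} {q : ℝ × ℝ} (h : q ∈ cell n τ p) :
    0 < q.2 :=
  (show (0 : ℝ) ≤ p.1 * τ by positivity).trans_lt h.2.1

theorem pairwise_disjoint_cell (n : ℕ) {τ : ℝ} (hτ : 0 < τ) :
    Pairwise fun p p' => Disjoint (cell n τ p) (cell n τ p') := by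
  intro p p' hne
  rw [Set.disjoint_left]
  intro q h h'
  have hq := pos_of_mem_cell hτ h
  obtain ⟨j, i⟩ := p
  obtain ⟨j', i'⟩ := p'
  rw [mem_cell_iff hτ hq] at h h'
  exact hne (by rw [← h.1, ← h.2, ← h'.1, ← h'.2])

theorem halfPlaneIntensity_cell (n : ℕ) {τ : ℝ} (hτ : 0 < τ) (p : ℕ × ℤ) :
    halfPlaneIntensity (cell n τ p) = ENNReal.ofReal (τ * mesh n) := by
  rw [halfPlaneIntensity, Measure.restrict_apply (measurableSet_cell n τ p),
    Set.inter_eq_left.2 (show cell n τ p ⊆ {q | 0 < q.2} from fun q hq => pos_of_mem_cell hτ hq),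
    cell, Measure.volume_eq_prod,
    Measure.prod_prod, Real.volume_Ico, Real.volume_Ioc, ← ENNReal.ofReal_mul]
  · congr 1; ring
  · have := mesh_pos n
    have : (p.2 + 1) * mesh n - p.2 * mesh n = mesh n := by ring
    linarith

/-- The numbers of points of the configuration in the cells. -/
def cellCount (A : Set (ℝ × ℝ)) (n : ℕ) (τ : ℝ) (p : ℕ × ℤ) : ℕ := (A ∩ cell n τ p).ncard

theorem IsPoissonPointProcess.isCountArray_cellCount {Ω : Type*} [MeasurableSpace Ω] {P : Measure Ω}
    {A : Ω → Set (ℝ × ℝ)} (hA : IsPoissonPointProcess halfPlaneIntensity P A) (n : ℕ) {τ : ℝ}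
    (hτ : 0 < τ) : IsCountArray P (fun p ω => cellCount (A ω) n τ p) (τ * mesh n) :=
  hA.isCountArray (measurableSet_cell n τ) (pairwise_disjoint_cell n hτ)
    (mul_nonneg hτ.le (mesh_pos n).le) (halfPlaneIntensity_cell n hτ)

theorem IsPoissonPointProcess.ae_finite_pointsUpTo {Ω : Type*} [MeasurableSpace Ω] {P : Measure Ω}
    {A : Ω → Set (ℝ × ℝ)} (hA : IsPoissonPointProcess halfPlaneIntensity P A) (N : ℕ) (t : ℝ) :
    ∀ᵐ ω ∂P, (pointsUpTo (A ω) N t).Finite := by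
  refine hA.ae_finite (measurableSet_Ico.prod measurableSet_Ioc) (ne_top_of_le_ne_top ?_
    (Measure.restrict_apply_le _ _))
  rw [Measure.volume_eq_prod, Measure.prod_prod]
  exact ENNReal.mul_ne_top (by simp) (by simp)

/-! ### The backward flow as a limit of discretised flows -/

/-- The displacement by a slit at the grid point `i · mesh n`, if that point lies in the window
`[-πN, πN)`; it stands for the slits in the interval `[i · mesh n, (i + 1) · mesh n)`. -/
def gridJump (lam : ℝ) (n N : ℕ) (i : ℤ) (w : ℂ) : ℂ :=
  if i ∈ window n N then jump lam N (w - (i * mesh n : ℝ)) else 0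

theorem floor_mem_window_iff {n N : ℕ} {x : ℝ} :
    ⌊x / mesh n⌋ ∈ window n N ↔ x ∈ Set.Ico (-(Real.pi * N)) (Real.pi * N) := by
  rw [window, Finset.mem_Ico, Int.le_floor, Int.floor_lt, le_div_iff₀ (mesh_pos n),
    div_lt_iff₀ (mesh_pos n), Set.mem_Ico, ← natCast_mul_two_pow_mul_mesh n N]
  push_cast
  rw [neg_mul]

theorem tendsto_mesh : Filter.Tendsto mesh Filter.atTop (nhds 0) :=
  tendsto_const_nhds.div_atTop (tendsto_pow_atTop_atTop_of_one_lt one_lt_two)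

theorem tendsto_floor_mul_mesh (x : ℝ) :
    Filter.Tendsto (fun n => ⌊x / mesh n⌋ * mesh n) Filter.atTop (nhds x) := by
  have h : Filter.Tendsto (fun n => x - mesh n) Filter.atTop (nhds x) := by
    simpa using tendsto_mesh.const_sub x
  refine tendsto_of_tendsto_of_tendsto_of_le_of_le h tendsto_const_nhds (fun n => ?_) fun n => ?_
  · have h1 := Int.lt_floor_add_one (x / mesh n)
    rw [div_lt_iff₀ (mesh_pos n)] at h1
    simp only
    linarith
  · have h1 := Int.floor_le (x / mesh n)
    rwa [le_div_iff₀ (mesh_pos n)] at h1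

theorem timeSlot_mem {τ s : ℝ} (hτ : 0 < τ) (hs : 0 < s) :
    s ∈ Set.Ioc (timeSlot τ s * τ) ((timeSlot τ s + 1) * τ) :=
  (timeSlot_eq_iff hτ hs).1 rfl

section Flow

variable {lam y t : ℝ} {N : ℕ} {z : ℂ} {A : Set (ℝ × ℝ)} {F : Finset (ℝ × ℝ)}

/-- A discretised flow as a sum over the points of the configuration. -/
theorem gridFlow_eq_sum (hF : ∀ p, p ∈ F ↔ p ∈ pointsUpTo A N t) {n : ℕ} {τ : ℝ} (hτ : 0 < τ)
    {I : Finset ℤ} (hI : window n N ⊆ I) (z : ℂ) {J : ℕ} (hJ : J * τ ≤ t) :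
    gridFlow I (gridJump lam n N) (cellCount A n τ) z J
      = z + ∑ p ∈ F with p.2 ≤ J * τ,
        jump lam N (gridFlow I (gridJump lam n N) (cellCount A n τ) z (timeSlot τ p.2)
          - (⌊p.1 / mesh n⌋ * mesh n : ℝ)) := by
  have hF0 : ∀ p ∈ F, 0 < p.2 := fun p hp => ((hF p).1 hp).2.2.1
  set Y := gridFlow I (gridJump lam n N) (cellCount A n τ) z with hY
  have key : ∀ J : ℕ, J * τ ≤ t → Y J = z + ∑ p ∈ F with timeSlot τ p.2 < J,
      jump lam N (Y (timeSlot τ p.2) - (⌊p.1 / mesh n⌋ * mesh n : ℝ)) := by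
    intro J
    induction J with
    | zero => intro _; simp [hY, gridFlow]
    | succ J ih =>
      intro hJ
      have hJ' : J * τ ≤ t := by push_cast at hJ; linarith
      have hsplit : ∑ p ∈ F with timeSlot τ p.2 < J + 1,
            jump lam N (Y (timeSlot τ p.2) - (⌊p.1 / mesh n⌋ * mesh n : ℝ))
          = ∑ p ∈ F with timeSlot τ p.2 < J,
            jump lam N (Y (timeSlot τ p.2) - (⌊p.1 / mesh n⌋ * mesh n : ℝ))
          + ∑ p ∈ F with timeSlot τ p.2 = J,
            jump lam N (Y J - (⌊p.1 / mesh n⌋ * mesh n : ℝ)) := by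
        rw [Finset.sum_filter, Finset.sum_filter, Finset.sum_filter, ← Finset.sum_add_distrib]
        refine Finset.sum_congr rfl fun p _ => ?_
        rcases lt_trichotomy (timeSlot τ p.2) J with h | h | h
        · rw [if_pos (by omega), if_pos h, if_neg (by omega), add_zero]
        · rw [if_pos (by omega), if_neg (by omega), if_pos h, zero_add, h]
        · rw [if_neg (by omega), if_neg (by omega), if_neg (by omega), add_zero]
      have hstep : Y (J + 1) = Y J + ∑ i ∈ I, (cellCount A n τ (J, i) : ℂ)
          * gridJump lam n N i (Y J) := rfl
      rw [hsplit, ← add_assoc, ← ih hJ', hstep]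
      congr 1
      have hmaps : ∀ p ∈ F.filter (fun p => timeSlot τ p.2 = J), ⌊p.1 / mesh n⌋ ∈ I := fun p hp =>
        hI (floor_mem_window_iff.2 ((hF p).1 (Finset.mem_filter.1 hp).1).2.1)
      rw [← Finset.sum_fiberwise_of_maps_to hmaps]
      refine Finset.sum_congr rfl fun i _ => ?_
      have hcell : ∀ p ∈ F, (timeSlot τ p.2 = J ∧ ⌊p.1 / mesh n⌋ = i ↔ p ∈ cell n τ (J, i)) :=
        fun p hp => (mem_cell_iff hτ (hF0 p hp)).symm
      by_cases hi : i ∈ window n N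
      · have hcount : cellCount A n τ (J, i)
            = ((F.filter (fun p => timeSlot τ p.2 = J)).filter
              fun p => ⌊p.1 / mesh n⌋ = i).card := by
          rw [cellCount, ← Set.ncard_coe_finset]
          congr 1
          ext p
          simp only [Finset.coe_filter, Finset.mem_filter, Set.mem_ofPred_eq, Set.mem_inter_iff,
            and_assoc]
          constructor
          · rintro ⟨hpA, hp⟩
            have hp0 := pos_of_mem_cell hτ hp
            have hm := (mem_cell_iff hτ hp0).1 hp
            have hpt : p.2 ≤ t := by
              refine hp.2.2.trans ?_
              push_cast at hJ
              exact hJ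
            refine ⟨(hF p).2 ⟨hpA, ?_, hp0, hpt⟩, hm⟩
            rw [← floor_mem_window_iff (n := n), hm.2]
            exact hi
          · rintro ⟨hpF, hp⟩
            exact ⟨((hF p).1 hpF).1, (hcell p hpF).1 hp⟩
        rw [Finset.sum_congr rfl (g := fun _ => gridJump lam n N i (Y J)), Finset.sum_const,
          nsmul_eq_mul, hcount]
        intro p hp
        rw [gridJump, if_pos hi, (Finset.mem_filter.1 hp).2]
      · rw [gridJump, if_neg hi, mul_zero, Finset.sum_eq_zero]
        intro p hp
        simp only [Finset.mem_filter] at hp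
        exact absurd (hp.2 ▸ floor_mem_window_iff.2 ((hF p).1 hp.1.1).2.1) hi
  rw [key J hJ]
  congr 2
  exact Finset.filter_congr fun p hp => timeSlot_lt_iff hτ (hF0 p hp)

open Classical in
/-- The backward flow stays in `{Im ≥ y}`, where its jumps are values of `jump`, and it depends
continuously on the starting point. -/
theorem IsLarge.backwardFlow_props (h : IsLarge lam y N) (F : Finset (ℝ × ℝ)) :
    (∀ z : ℂ, y ≤ z.im → y ≤ (backwardFlow N (slitParam N lam) F z).im ∧
      backwardFlow N (slitParam N lam) F z = z + ∑ p ∈ F,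
        jump lam N (backwardFlow N (slitParam N lam) (F.filter fun q => q.2 < p.2) z - p.1)) ∧
    ContinuousOn (backwardFlow N (slitParam N lam) F) {z | y ≤ z.im} := by
  induction F using Finset.strongInduction with
  | H F ih =>
    have ih' := fun p (hp : p ∈ F) => ih (F.filter fun q => q.2 < p.2)
      (Finset.filter_ssubset.2 ⟨p, hp, lt_irrefl _⟩)
    have him : ∀ p ∈ F, ∀ z : ℂ, y ≤ z.im →
        y ≤ (backwardFlow N (slitParam N lam) (F.filter fun q => q.2 < p.2) z - p.1).im := by
      intro p hp z hz
      simpa using ((ih' p hp).1 z hz).1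
    have heq : ∀ z : ℂ, y ≤ z.im → backwardFlow N (slitParam N lam) F z = z + ∑ p ∈ F,
        jump lam N (backwardFlow N (slitParam N lam) (F.filter fun q => q.2 < p.2) z - p.1) := by
      intro z hz
      rw [backwardFlow_eq]
      congr 1
      refine Finset.sum_congr rfl fun p hp => ?_
      rw [h.slitAt_eq p.1 ((ih' p hp).1 z hz).1, add_sub_cancel_left]
    refine ⟨fun z hz => ⟨?_, heq z hz⟩, ?_⟩
    · rw [heq z hz, Complex.add_im, Complex.im_sum]
      have := Finset.sum_nonneg fun p hp => h.jump_im_nonneg (him p hp z hz)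
      linarith
    · refine ContinuousOn.congr (continuousOn_id.add (continuousOn_finsetSum _ fun p hp => ?_)) heq
      intro z hz
      have h1 := (h.differentiableAt_jump (him p hp z hz)).continuousAt
      exact ContinuousAt.comp_continuousWithinAt (g := jump lam N) h1
        (((ih' p hp).2 z hz).sub continuousWithinAt_const)

open Classical in
/-- The values of the discretised flows in the slots of the points converge to the left limits of
the backward flow: once the slots are shorter than the gaps between different times, the points in
earlier slots are exactly the points with earlier times. Points with equal times share a slot, and
neither of them acts on the other. -/
theorem IsLarge.tendsto_gridFlow_timeSlot (h : IsLarge lam y N) (hz : y ≤ z.im)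
    (hF : ∀ p, p ∈ F ↔ p ∈ pointsUpTo A N t) (ht : 0 < t) {I : ℕ → Finset ℤ}
    (hI : ∀ n, window n N ⊆ I n) (p : ℝ × ℝ) (hp : p ∈ F) :
    Filter.Tendsto (fun n => gridFlow (I n) (gridJump lam n N) (cellCount A n (t / 2 ^ n)) z
        (timeSlot (t / 2 ^ n) p.2)) Filter.atTop
      (nhds (backwardFlow N (slitParam N lam) (F.filter fun q => q.2 < p.2) z)) := by
  have hτ : ∀ n : ℕ, 0 < t / 2 ^ n := fun n => by positivity
  have hτ0 : Filter.Tendsto (fun n : ℕ => t / 2 ^ n) Filter.atTop (nhds 0) :=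
    tendsto_const_nhds.div_atTop (tendsto_pow_atTop_atTop_of_one_lt one_lt_two)
  have hF0 : ∀ p ∈ F, 0 < p.2 := fun p hp => ((hF p).1 hp).2.2.1
  induction hc : (F.filter fun q => q.2 < p.2).card using Nat.strong_induction_on
    generalizing p with
  | _ c ih =>
    have hev : ∀ᶠ n : ℕ in Filter.atTop, ∀ p' ∈ F,
        (p'.2 ≤ timeSlot (t / 2 ^ n) p.2 * (t / 2 ^ n) ↔ p'.2 < p.2) := by
      rw [Filter.eventually_all_finset]
      intro p' hp'
      by_cases hlt : p'.2 < p.2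
      · filter_upwards [hτ0.eventually_lt_const (sub_pos.2 hlt)] with n hn
        have h1 := (timeSlot_mem (hτ n) (hF0 p hp)).2
        exact iff_of_true (by linarith) hlt
      · refine Filter.Eventually.of_forall fun n => iff_of_false ?_ hlt
        have h1 := (timeSlot_mem (hτ n) (hF0 p hp)).1
        linarith
    have hfil : ∀ p' ∈ F.filter (fun q => q.2 < p.2),
        (F.filter fun q => q.2 < p.2).filter (fun q => q.2 < p'.2)
          = F.filter fun q => q.2 < p'.2 := by
      intro p' hp'
      have := (Finset.mem_filter.1 hp').2
      ext q
      simp only [Finset.mem_filter]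
      exact ⟨fun hq => ⟨hq.1.1, hq.2⟩, fun hq => ⟨⟨hq.1, hq.2.trans this⟩, hq.2⟩⟩
    rw [((h.backwardFlow_props _).1 z hz).2]
    have hlim : Filter.Tendsto (fun n => z + ∑ p' ∈ F.filter (fun q => q.2 < p.2),
        jump lam N (gridFlow (I n) (gridJump lam n N) (cellCount A n (t / 2 ^ n)) z
          (timeSlot (t / 2 ^ n) p'.2) - (⌊p'.1 / mesh n⌋ * mesh n : ℝ))) Filter.atTop
        (nhds (z + ∑ p' ∈ F.filter (fun q => q.2 < p.2), jump lam N (backwardFlow N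
          (slitParam N lam) ((F.filter fun q => q.2 < p.2).filter fun q => q.2 < p'.2) z
          - p'.1))) := by
      refine tendsto_const_nhds.add (tendsto_finsetSum _ fun p' hp' => ?_)
      rw [hfil p' hp']
      have hp'F := (Finset.mem_filter.1 hp').1
      have hlt := (Finset.mem_filter.1 hp').2
      have hcard : (F.filter fun q => q.2 < p'.2).card < c := by
        rw [← hc, ← hfil p' hp']
        exact Finset.card_lt_card (Finset.filter_ssubset.2 ⟨p', hp', lt_irrefl _⟩)
      have h1 := ih _ hcard p' hp'F rfl
      have h2 : y ≤ (backwardFlow N (slitParam N lam) (F.filter fun q => q.2 < p'.2) z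
          - (p'.1 : ℂ)).im := by
        simpa using ((h.backwardFlow_props (F.filter fun q => q.2 < p'.2)).1 z hz).1
      exact (h.differentiableAt_jump h2).continuousAt.tendsto.comp (h1.sub
        ((Complex.continuous_ofReal.tendsto _).comp (tendsto_floor_mul_mesh p'.1)))
    refine hlim.congr' ?_
    filter_upwards [hev] with n hn
    have hle : timeSlot (t / 2 ^ n) p.2 * (t / 2 ^ n) ≤ t :=
      (timeSlot_mem (hτ n) (hF0 p hp)).1.le.trans ((hF p).1 hp).2.2.2
    rw [gridFlow_eq_sum hF (hτ n) (hI n) z hle]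
    congr 2
    exact (Finset.filter_congr fun p' hp' => (hn p' hp').symm)

open Classical in
/-- The discretised flows converge to the backward flow along dyadic times. -/
theorem IsLarge.tendsto_gridFlow (h : IsLarge lam y N) (hz : y ≤ z.im)
    (hF : ∀ p, p ∈ F ↔ p ∈ pointsUpTo A N t) (ht : 0 < t) {I : ℕ → Finset ℤ}
    (hI : ∀ n, window n N ⊆ I n) {q : ℝ} (hq : q ≤ t) {J : ℕ → ℕ}
    (hJ : ∀ᶠ n in Filter.atTop, J n * (t / 2 ^ n) = q) :
    Filter.Tendsto (fun n => gridFlow (I n) (gridJump lam n N) (cellCount A n (t / 2 ^ n)) z (J n))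
      Filter.atTop (nhds (backwardFlow N (slitParam N lam) (F.filter fun p => p.2 ≤ q) z)) := by
  have hτ : ∀ n : ℕ, 0 < t / 2 ^ n := fun n => by positivity
  rw [((h.backwardFlow_props _).1 z hz).2]
  have hlim : Filter.Tendsto (fun n => z + ∑ p ∈ F.filter (fun p => p.2 ≤ q),
      jump lam N (gridFlow (I n) (gridJump lam n N) (cellCount A n (t / 2 ^ n)) z
        (timeSlot (t / 2 ^ n) p.2) - (⌊p.1 / mesh n⌋ * mesh n : ℝ))) Filter.atTop
      (nhds (z + ∑ p ∈ F.filter (fun p => p.2 ≤ q), jump lam N (backwardFlow N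
        (slitParam N lam) ((F.filter fun p => p.2 ≤ q).filter fun q => q.2 < p.2) z - p.1))) := by
    refine tendsto_const_nhds.add (tendsto_finsetSum _ fun p hp => ?_)
    have hpF := (Finset.mem_filter.1 hp).1
    have hpq := (Finset.mem_filter.1 hp).2
    have hfil : (F.filter fun p => p.2 ≤ q).filter (fun q => q.2 < p.2)
        = F.filter fun q => q.2 < p.2 := by
      ext r
      simp only [Finset.mem_filter]
      exact ⟨fun hr => ⟨hr.1.1, hr.2⟩, fun hr => ⟨⟨hr.1, hr.2.le.trans hpq⟩, hr.2⟩⟩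
    rw [hfil]
    have h2 : y ≤ (backwardFlow N (slitParam N lam) (F.filter fun q => q.2 < p.2) z
        - (p.1 : ℂ)).im := by
      simpa using ((h.backwardFlow_props (F.filter fun q => q.2 < p.2)).1 z hz).1
    exact (h.differentiableAt_jump h2).continuousAt.tendsto.comp
      ((h.tendsto_gridFlow_timeSlot hz hF ht hI p hpF).sub
        ((Complex.continuous_ofReal.tendsto _).comp (tendsto_floor_mul_mesh p.1)))
  refine hlim.congr' ?_
  filter_upwards [hJ] with n hn
  rw [gridFlow_eq_sum hF (hτ n) (hI n) z (hn.le.trans hq), hn]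

open Classical in
theorem backwardCHL_eq_backwardFlow (hF : ∀ p, p ∈ F ↔ p ∈ pointsUpTo A N t) (δ : ℝ) {s : ℝ}
    (hs : s ≤ t) (z : ℂ) :
    backwardCHL N δ A s z = backwardFlow N δ (F.filter fun p => p.2 ≤ s) z := by
  have hset : pointsUpTo A N s = ↑(F.filter fun p => p.2 ≤ s) := by
    ext p
    simp only [Finset.coe_filter, Set.mem_ofPred_eq, hF, pointsUpTo, Set.mem_inter_iff,
      Set.mem_prod, Set.mem_Ioc]
    constructor
    · rintro ⟨h1, h2, h3, h4⟩; exact ⟨⟨h1, h2, h3, h4.trans hs⟩, h4⟩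
    · rintro ⟨⟨h1, h2, h3, -⟩, h4⟩; exact ⟨h1, h2, h3, h4⟩
  have hfin : (pointsUpTo A N s).Finite := by rw [hset]; exact Finset.finite_toSet _
  rw [backwardCHL, dif_pos hfin]
  congr 1
  rw [← Finset.coe_inj, Set.Finite.coe_toFinset, hset]

end Flow

section GridFlow

variable {κ : Type*} {I : Finset κ} {u : κ → ℂ → ℂ} {y : ℝ}

theorem differentiableAt_gridFlow (hu : ∀ i ∈ I, ∀ w, y ≤ w.im → 0 ≤ (u i w).im)
    (hd : ∀ i ∈ I, ∀ w : ℂ, y ≤ w.im → DifferentiableAt ℂ (u i) w) (k : ℕ × κ → ℕ) {z : ℂ}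
    (hz : y ≤ z.im) (J : ℕ) : DifferentiableAt ℂ (fun z => gridFlow I u k z J) z := by
  induction J with
  | zero => exact differentiableAt_id
  | succ J ih =>
    simp only [gridFlow]
    refine ih.add (DifferentiableAt.fun_sum fun i hi => DifferentiableAt.const_mul ?_ _)
    exact DifferentiableAt.comp (g := u i) z (hd i hi _ (le_im_gridFlow hu hz k J)) ih

/-- Joint measurability in the counts and the starting point. -/
theorem measurable_gridFlow {Ω : Type*} [MeasurableSpace Ω] {ξ : ℕ × κ → Ω → ℕ}
    (hξ : ∀ p, Measurable (ξ p)) (hu : ∀ i, Measurable (u i)) (J : ℕ) :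
    Measurable (fun x : Ω × ℂ => gridFlow I u (fun p => ξ p x.1) x.2 J) := by
  induction J with
  | zero => exact measurable_snd
  | succ J ih =>
    simp only [gridFlow]
    exact ih.add (Finset.measurable_fun_sum _ fun i _ => (Measurable.of_discrete
      (f := Nat.cast).comp ((hξ (J, i)).comp measurable_fst)).mul ((hu i).comp ih))

theorem measurable_gridJump (lam : ℝ) (n N : ℕ) (i : ℤ) : Measurable (gridJump lam n N i) := by
  unfold gridJump
  split_ifs
  · unfold jump slitJump slitJumpDisc slitExcess discToHalf phiMap
    fun_prop
  · exact measurable_const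

end GridFlow

/-! ### Suprema of holomorphic functions over compact sets -/

/-- The Cauchy formula for `f ^ 2` on a circle. -/
theorem norm_sq_le_circle_integral {f : ℂ → ℂ} {c z : ℂ} {r : ℝ} (hr : 0 < r)
    (hf : ∀ w ∈ Metric.closedBall c r, DifferentiableAt ℂ f w) (hz : z ∈ Metric.ball c (r / 2)) :
    ‖f z‖ ^ 2 ≤ 1 / Real.pi * ∫ θ in (0 : ℝ)..(2 * Real.pi), ‖f (circleMap c r θ)‖ ^ 2 := by
  have hd : DiffContOnCl ℂ (fun w => f w ^ 2) (Metric.ball c r) := by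
    refine DifferentiableOn.diffContOnCl fun w hw => ?_
    exact ((hf w (Metric.closure_ball_subset_closedBall hw)).pow 2).differentiableWithinAt
  have hzr : z ∈ Metric.ball c r := Metric.ball_subset_ball (by linarith) hz
  have h1 := hd.two_pi_i_inv_smul_circleIntegral_sub_inv_smul hzr
  have hpi := Real.pi_pos
  have hcont : Continuous fun θ => ‖f (circleMap c r θ)‖ ^ 2 := by
    refine (Continuous.norm ?_).pow 2
    rw [continuous_iff_continuousAt]
    intro θ
    exact ContinuousAt.comp (hf _ (circleMap_mem_closedBall c hr.le θ)).continuousAt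
      (continuous_circleMap c r).continuousAt
  have h2 : ‖∮ w in C(c, r), (w - z)⁻¹ • f w ^ 2‖
      ≤ ∫ θ in (0 : ℝ)..(2 * Real.pi), 2 * ‖f (circleMap c r θ)‖ ^ 2 := by
    refine intervalIntegral.norm_integral_le_of_norm_le (by positivity)
      (Filter.Eventually.of_forall fun θ _ => ?_) ((hcont.const_mul 2).intervalIntegrable _ _)
    have h3 : r / 2 ≤ ‖circleMap c r θ - z‖ := by
      have h4 : ‖circleMap c r θ - c‖ = r := by
        simp [abs_of_pos hr]
      have h5 : ‖z - c‖ < r / 2 := by simpa [dist_eq_norm] using hz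
      have h6 := norm_sub_norm_le (circleMap c r θ - c) (z - c)
      rw [sub_sub_sub_cancel_right] at h6
      linarith
    have h7 : r * ‖circleMap c r θ - z‖⁻¹ ≤ 2 := by
      rw [← div_eq_mul_inv, div_le_iff₀ (by linarith)]
      linarith
    have h8 : ‖deriv (circleMap c r) θ‖ = r := by simp [abs_of_pos hr]
    rw [norm_smul, norm_smul, h8, norm_inv, norm_pow, ← mul_assoc]
    gcongr
  rw [← norm_pow, ← h1, norm_smul]
  rw [intervalIntegral.integral_const_mul] at h2
  have h9 : ‖(2 * Real.pi * Complex.I : ℂ)⁻¹‖ = 1 / (2 * Real.pi) := by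
    simp [abs_of_pos hpi]
  rw [h9]
  calc _ ≤ 1 / (2 * Real.pi) * (2 * ∫ θ in (0 : ℝ)..(2 * Real.pi), ‖f (circleMap c r θ)‖ ^ 2) := by
        gcongr
    _ = _ := by field_simp

/-- The supremum over `K` of the square of a function that is holomorphic near `K` is bounded by an
integral over finitely many circles. -/
theorem exists_measure_enorm_sq_le {K : Set ℂ} (hK : IsCompact K) {v : ℝ} (hv : 0 < v)
    (hKv : ∀ z ∈ K, 2 * v ≤ z.im) :
    ∃ (μ : Measure ℂ) (R : ℝ), IsFiniteMeasure μ ∧ (∀ᵐ w ∂μ, v ≤ w.im ∧ ‖w‖ ≤ R) ∧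
      ∀ f : ℂ → ℂ, Measurable f → (∀ w, v ≤ w.im → DifferentiableAt ℂ f w) →
        ∀ z ∈ K, ‖f z‖ₑ ^ 2 ≤ ∫⁻ w, ‖f w‖ₑ ^ 2 ∂μ := by
  obtain ⟨s, hsK, hs⟩ := hK.elim_nhds_subcover (fun z => Metric.ball z (v / 2))
    fun z _ => Metric.ball_mem_nhds z (by positivity)
  obtain ⟨R, hR⟩ := hK.exists_bound_of_continuousOn continuousOn_id
  set m : ℂ → Measure ℂ := fun c =>
    (volume.restrict (Set.Ioc 0 (2 * Real.pi))).map (circleMap c v) with hm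
  have hmeas : ∀ c, Measurable (circleMap c v) := fun c => (continuous_circleMap c v).measurable
  have hball : ∀ c ∈ K, ∀ w ∈ Metric.closedBall c v, v ≤ w.im := by
    intro c hc w hw
    have h1 := hKv c hc
    have h2 : ‖w - c‖ ≤ v := by simpa [dist_eq_norm] using hw
    have h3 := (abs_le.1 ((Complex.abs_im_le_norm (w - c)).trans h2)).1
    rw [Complex.sub_im] at h3
    linarith
  refine ⟨∑ c ∈ s, ENNReal.ofReal (1 / Real.pi) • m c, R + v, ?_, ?_, ?_⟩
  · refine ⟨?_⟩
    rw [Measure.finsetSum_apply]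
    refine ENNReal.sum_lt_top.2 fun c _ => ?_
    rw [Measure.smul_apply, smul_eq_mul, hm, Measure.map_apply (hmeas c) .univ]
    refine ENNReal.mul_lt_top ENNReal.ofReal_lt_top ?_
    rw [Set.preimage_univ, Measure.restrict_apply_univ]
    exact measure_Ioc_lt_top
  · have hset : MeasurableSet {w : ℂ | v ≤ w.im ∧ ‖w‖ ≤ R + v} :=
      (measurableSet_le measurable_const Complex.measurable_im).inter
        (measurableSet_le measurable_norm measurable_const)
    rw [ae_iff, Measure.finsetSum_apply]
    refine Finset.sum_eq_zero fun c hc => ?_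
    rw [← Set.compl_ofPred, Measure.smul_apply, smul_eq_mul, hm,
      Measure.map_apply (hmeas c) hset.compl]
    have : circleMap c v ⁻¹' {w : ℂ | v ≤ w.im ∧ ‖w‖ ≤ R + v}ᶜ = ∅ := by
      rw [Set.preimage_compl, Set.compl_empty_iff, Set.eq_univ_iff_forall]
      intro θ
      have h1 := circleMap_mem_closedBall c hv.le θ
      refine ⟨hball c (hsK c hc) _ h1, ?_⟩
      have h2 : ‖circleMap c v θ - c‖ ≤ v := by simpa [dist_eq_norm] using h1
      have h3 : ‖c‖ ≤ R := hR c (hsK c hc)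
      have h4 := norm_le_norm_add_norm_sub' (circleMap c v θ) c
      rw [norm_sub_rev] at h4
      have h5 := norm_add_le (circleMap c v θ - c) c
      rw [sub_add_cancel] at h5
      linarith
    rw [this, measure_empty, mul_zero]
  · intro f hfm hf z hz
    obtain ⟨c, hc, hzc⟩ := Set.mem_iUnion₂.1 (hs hz)
    have hfc : ∀ w ∈ Metric.closedBall c v, DifferentiableAt ℂ f w := fun w hw =>
      hf w (hball c (hsK c hc) w hw)
    have h1 := norm_sq_le_circle_integral hv hfc hzc
    have hcont : Continuous fun θ => ‖f (circleMap c v θ)‖ ^ 2 := by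
      refine (Continuous.norm ?_).pow 2
      rw [continuous_iff_continuousAt]
      intro θ
      exact ContinuousAt.comp (hfc _ (circleMap_mem_closedBall c hv.le θ)).continuousAt
        (continuous_circleMap c v).continuousAt
    have h2 : ∫⁻ w, ‖f w‖ₑ ^ 2 ∂(ENNReal.ofReal (1 / Real.pi) • m c)
        = ENNReal.ofReal (1 / Real.pi * ∫ θ in (0 : ℝ)..(2 * Real.pi),
          ‖f (circleMap c v θ)‖ ^ 2) := by
      rw [lintegral_smul_measure, hm, lintegral_map (hfm.enorm.pow_const 2) (hmeas c), smul_eq_mul,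
        ENNReal.ofReal_mul (by positivity), intervalIntegral.integral_of_le (by positivity),
        ofReal_integral_eq_lintegral_ofReal]
      · congr 2
        ext θ
        rw [ENNReal.ofReal_pow (norm_nonneg _), ofReal_norm]
      · exact (hcont.integrableOn_Icc).mono_set Set.Ioc_subset_Icc_self
      · exact Filter.Eventually.of_forall fun θ => sq_nonneg _
    calc ‖f z‖ₑ ^ 2 = ENNReal.ofReal (‖f z‖ ^ 2) := by
          rw [ENNReal.ofReal_pow (norm_nonneg _), ofReal_norm]
      _ ≤ ∫⁻ w, ‖f w‖ₑ ^ 2 ∂(ENNReal.ofReal (1 / Real.pi) • m c) := by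
          rw [h2]; exact ENNReal.ofReal_le_ofReal h1
      _ ≤ _ := by
          rw [lintegral_finsetSum_measure]
          exact Finset.single_le_sum (f := fun c => ∫⁻ w, ‖f w‖ₑ ^ 2
            ∂(ENNReal.ofReal (1 / Real.pi) • m c)) (fun _ _ => zero_le) hc

/-! ### The discretised slit process -/

section GridJump

variable {lam y : ℝ} {N M : ℕ}

/-- Sums over a larger set of indices reduce to sums over the window. -/
theorem sum_gridJump {E : Type*} [AddCommMonoid E] {n : ℕ} {I : Finset ℤ} (hI : window n N ⊆ I)
    (g : ℤ → ℂ → E) (hg : ∀ i, g i 0 = 0) (w : ℂ) :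
    ∑ i ∈ I, g i (gridJump lam n N i w)
      = ∑ i ∈ window n N, g i (jump lam N (w - (i * mesh n : ℝ))) := by
  rw [← Finset.sum_subset hI fun i _ hi => by rw [gridJump, if_neg hi, hg]]
  exact Finset.sum_congr rfl fun i hi => by rw [gridJump, if_pos hi]

/-- The bound for the mean square of the displacements and of their Lipschitz constants. -/
def gridBound (lam y : ℝ) : ℝ := (jumpConst lam y ^ 2 + 4 * jumpLip lam y ^ 2) * gridConst

theorem gridBound_nonneg (lam y : ℝ) : 0 ≤ gridBound lam y :=
  mul_nonneg (by positivity) gridConst_nonneg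

theorem IsLarge.gridJump_im_nonneg (h : IsLarge lam y N) (n : ℕ) (i : ℤ) {w : ℂ} (hw : y ≤ w.im) :
    0 ≤ (gridJump lam n N i w).im := by
  rw [gridJump]
  split_ifs
  · exact h.jump_im_nonneg (by simpa using hw)
  · simp

theorem IsLarge.differentiableAt_gridJump (h : IsLarge lam y N) (n : ℕ) (i : ℤ) {w : ℂ}
    (hw : y ≤ w.im) : DifferentiableAt ℂ (gridJump lam n N i) w := by
  unfold gridJump
  split_ifs
  · have hw' : y ≤ (w - (i * mesh n : ℝ)).im := by simpa using hw
    exact DifferentiableAt.comp (g := jump lam N) w (h.differentiableAt_jump hw')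
      (differentiableAt_id.sub_const _)
  · exact differentiableAt_const _

theorem IsLarge.gridJumps (h : IsLarge lam y N) {n : ℕ} {I : Finset ℤ} (hI : window n N ⊆ I)
    {τ : ℝ} (hτ : 0 ≤ τ) :
    GridJumps I (gridJump lam n N) (τ * mesh n) τ (2 * y) (jumpConst lam y) (gridBound lam y)
      (4 * Real.pi * N * jumpLip lam y * mesh n) (driftConst lam N) := by
  have hy := h.y_pos
  refine ⟨fun i _ w hw => h.gridJump_im_nonneg n i (by linarith), fun i _ w hw => ?_,
    fun w hw => ?_, fun w hw => ?_⟩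
  · have hC := jumpConst_nonneg lam hy
    rw [gridJump]
    split_ifs
    · have hw' : y ≤ (w - (i * mesh n : ℝ)).im := by
        rw [Complex.sub_im, Complex.ofReal_im]; linarith
      exact (h.norm_jump_le hw').trans (div_le_self hC (by linarith [abs_nonneg (cylRep N
        (w - (i * mesh n : ℝ)).re)]))
    · simpa using hC
  · have h1 := h.norm_mesh_mul_sum_jump_sub_le n hw
    rw [sum_gridJump hI (fun _ v => v) (fun _ => rfl)]
    have h2 : ((τ * mesh n : ℝ) : ℂ) * ∑ i ∈ window n N, jump lam N (w - (i * mesh n : ℝ))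
        - τ * driftConst lam N
        = τ * ((mesh n : ℂ) * ∑ i ∈ window n N, jump lam N (w - (i * mesh n : ℝ))
          - driftConst lam N) := by
      rw [Complex.ofReal_mul]; ring
    rw [h2, norm_mul, Complex.norm_real, Real.norm_of_nonneg hτ]
    exact mul_le_mul_of_nonneg_left h1 hτ
  · have h1 := h.mesh_mul_sum_norm_jump_sq_le (n := n) (show y ≤ w.im by linarith)
    rw [sum_gridJump hI (fun _ v => ‖v‖ ^ 2) (fun _ => by simp), mul_assoc]
    refine mul_le_mul_of_nonneg_left (h1.trans ?_) hτ
    have := gridConst_nonneg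
    exact mul_le_mul_of_nonneg_right (by linarith [sq_nonneg (jumpLip lam y)]) this

theorem IsLarge.sum_norm_gridJump_sub_sq_le (h : IsLarge lam y N) {n : ℕ} {τ : ℝ} (hτ : 0 ≤ τ)
    {w w' : ℂ} (hw : 2 * y ≤ w.im) (hw' : 2 * y ≤ w'.im) :
    τ * mesh n * ∑ i ∈ window n N, ‖gridJump lam n N i w - gridJump lam n N i w'‖ ^ 2
      ≤ τ * gridBound lam y * ‖w - w'‖ ^ 2 := by
  have h1 := h.mesh_mul_sum_norm_jump_sub_sq_le (n := n) hw hw'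
  have h2 : ∑ i ∈ window n N, ‖gridJump lam n N i w - gridJump lam n N i w'‖ ^ 2
      = ∑ i ∈ window n N,
        ‖jump lam N (w - (i * mesh n : ℝ)) - jump lam N (w' - (i * mesh n : ℝ))‖ ^ 2 :=
    Finset.sum_congr rfl fun i hi => by rw [gridJump, if_pos hi, gridJump, if_pos hi]
  rw [h2, mul_assoc, mul_assoc]
  refine mul_le_mul_of_nonneg_left (h1.trans ?_) hτ
  have := gridConst_nonneg
  refine mul_le_mul_of_nonneg_right ?_ (sq_nonneg _)
  exact mul_le_mul_of_nonneg_right (by linarith [sq_nonneg (jumpConst lam y)]) this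

theorem exists_pos_le_one_mul_lt {a ε : ℝ} (ha : 0 ≤ a) (hε : 0 < ε) :
    ∃ x : ℝ, 0 < x ∧ x ≤ 1 ∧ a * x < ε := by
  refine ⟨min 1 (ε / (a + 1)), lt_min one_pos (by positivity), min_le_left _ _, ?_⟩
  calc a * min 1 (ε / (a + 1)) ≤ a * (ε / (a + 1)) := by gcongr; exact min_le_right _ _
    _ < ε := by
      rw [← mul_div_assoc, div_lt_iff₀ (by positivity)]
      linarith

/-- The displacements on the cylinders of circumferences `2πN` and `2πM` are close in mean square
on bounded sets: close to the point they converge, far away they are square-summable uniformly. -/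
theorem exists_sum_norm_gridJump_sub_sq_le (hlam : 0 < lam) (hy : 0 < y) {R η : ℝ} (hR : 0 ≤ R)
    (hη : 0 < η) :
    ∃ N₀, ∀ N M : ℕ, N₀ ≤ N → N ≤ M → IsLarge lam y N ∧ IsLarge lam y M ∧
      ∀ (n : ℕ) (τ : ℝ), 0 ≤ τ → ∀ w : ℂ, 2 * y ≤ w.im → ‖w‖ ≤ R →
        τ * mesh n * ∑ i ∈ window n M, ‖gridJump lam n N i w - gridJump lam n M i w‖ ^ 2
          ≤ τ * η := by
  have hg := gridConst_nonneg
  obtain ⟨x, hx0, -, hx⟩ := exists_pos_le_one_mul_lt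
    (show 0 ≤ 16 * jumpConst lam y ^ 2 * gridConst by positivity) (half_pos hη)
  set L := R + 1 / x with hL
  have hRL : R ≤ L := by rw [hL]; linarith [show 0 < 1 / x by positivity]
  obtain ⟨e, he0, he1, he⟩ := exists_pos_le_one_mul_lt
    (show 0 ≤ (1 + L + R) ^ 2 * gridConst by positivity) (half_pos hη)
  have hcomp : IsCompact (Set.Icc (-(L + R)) (L + R) ×ℂ Set.Icc (2 * y) R) :=
    isCompact_Icc.reProdIm isCompact_Icc
  obtain ⟨N₁, hN₁⟩ := exists_norm_jump_sub_jump_le hlam hcomp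
    (fun z hz => lt_of_lt_of_le (by positivity : (0 : ℝ) < 2 * y) hz.2.1) he0
  obtain ⟨N₂, hN₂⟩ := Filter.eventually_atTop.1 ((eventually_isLarge hlam hy).and
    ((tendsto_natCast_atTop_atTop (R := ℝ)).eventually_gt_atTop (L / Real.pi)))
  refine ⟨max N₁ N₂, fun N M hN hNM => ?_⟩
  have h1 := hN₂ N ((le_max_right _ _).trans hN)
  have h2 := hN₂ M ((le_max_right _ _).trans (hN.trans hNM))
  refine ⟨h1.1, h2.1, fun n τ hτ w hw hwR => ?_⟩
  have hLN : L < Real.pi * N := by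
    have := h1.2
    rwa [div_lt_iff₀ Real.pi_pos, mul_comm] at this
  have hclose : ∀ x : ℝ, |x| ≤ L → ‖jump lam N (w - x) - jump lam M (w - x)‖ ≤ e := by
    intro x hx
    refine hN₁ N M ((le_max_left _ _).trans hN) ((le_max_left _ _).trans (hN.trans hNM)) _ ?_
    have hre := abs_le.1 ((Complex.abs_re_le_norm w).trans hwR)
    have him := abs_le.1 ((Complex.abs_im_le_norm w).trans hwR)
    have hx' := abs_le.1 hx
    rw [Complex.mem_reProdIm]
    simp only [Complex.sub_re, Complex.ofReal_re, Complex.sub_im, Complex.ofReal_im, sub_zero,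
      Set.mem_Icc]
    exact ⟨⟨by linarith, by linarith⟩, hw, him.2⟩
  have hmain := h1.1.mesh_mul_sum_norm_jump_diff_sq_le h2.1 hNM n
    (show y ≤ w.im by linarith) hwR hRL hLN hclose
  have hsum : ∑ i ∈ window n M, ‖gridJump lam n N i w - gridJump lam n M i w‖ ^ 2
      = ∑ i ∈ window n M, ‖(if i ∈ window n N then jump lam N (w - (i * mesh n : ℝ)) else 0)
        - jump lam M (w - (i * mesh n : ℝ))‖ ^ 2 :=
    Finset.sum_congr rfl fun i hi => by rw [gridJump, gridJump, if_pos hi]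
  rw [hsum, mul_assoc]
  refine mul_le_mul_of_nonneg_left (hmain.trans ?_) hτ
  have e1 : e ^ 2 * (1 + L + R) ^ 2 * gridConst ≤ (1 + L + R) ^ 2 * gridConst * e := by
    have : e ^ 2 ≤ e := by nlinarith
    calc _ = (1 + L + R) ^ 2 * gridConst * e ^ 2 := by ring
      _ ≤ _ := by gcongr
  have e2 : 16 * jumpConst lam y ^ 2 * gridConst / (1 + (L - R))
      ≤ 16 * jumpConst lam y ^ 2 * gridConst * x := by
    rw [div_le_iff₀ (by linarith), mul_assoc _ x]
    have : 1 ≤ x * (1 + (L - R)) := by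
      rw [hL, add_sub_cancel_left, mul_add, mul_one_div_cancel hx0.ne']
      linarith
    exact le_mul_of_one_le_right (by positivity) this
  linarith

end GridJump

/-! ### The supremum over times and starting points -/

section Sup

open Filter

variable {lam y t : ℝ} {N M : ℕ} {A : Set (ℝ × ℝ)} {K S : Set ℂ}

/-- The difference of the discretised flows for `N` and `M`, at the grid of level `n`, after `J`
slots. -/
def gridDiff (lam : ℝ) (N M : ℕ) (A : Set (ℝ × ℝ)) (t : ℝ) (n : ℕ) (z : ℂ) (J : ℕ) : ℂ :=
  gridFlow (window n M) (gridJump lam n N) (cellCount A n (t / 2 ^ n)) z J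
    - gridFlow (window n M) (gridJump lam n M) (cellCount A n (t / 2 ^ n)) z J

/-- The difference of the two backward processes at time `s`. -/
def processDiff (lam : ℝ) (N M : ℕ) (A : Set (ℝ × ℝ)) (s : ℝ) (z : ℂ) : ℂ :=
  backwardCHL N (slitParam N lam) A s z - backwardCHL M (slitParam M lam) A s z

theorem pointsUpTo_mono (A : Set (ℝ × ℝ)) (hNM : N ≤ M) (t : ℝ) :
    pointsUpTo A N t ⊆ pointsUpTo A M t := by
  have h : Real.pi * N ≤ Real.pi * M := by gcongr
  exact Set.inter_subset_inter_right _ (Set.prod_mono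
    (Set.Ico_subset_Ico (neg_le_neg h) h) subset_rfl)

theorem natCast_mul_div_two_pow_mem (ht : 0 ≤ t) {p k : ℕ} (hk : k ≤ 2 ^ p) :
    (k : ℝ) * (t / 2 ^ p) ∈ Set.Icc 0 t := by
  refine ⟨by positivity, ?_⟩
  have : (k : ℝ) ≤ 2 ^ p := by exact_mod_cast hk
  calc (k : ℝ) * (t / 2 ^ p) ≤ 2 ^ p * (t / 2 ^ p) := by gcongr
    _ = t := by field_simp

theorem IsLarge.tendsto_gridFlow_backwardCHL (h : IsLarge lam y N) {z : ℂ} (hz : y ≤ z.im)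
    (hfin : (pointsUpTo A N t).Finite) (ht : 0 < t) {I : ℕ → Finset ℤ}
    (hI : ∀ n, window n N ⊆ I n) {p k : ℕ} (hk : k ≤ 2 ^ p) :
    Tendsto (fun n => gridFlow (I n) (gridJump lam n N) (cellCount A n (t / 2 ^ n)) z
      (k * 2 ^ (n - p))) atTop
      (nhds (backwardCHL N (slitParam N lam) A (k * (t / 2 ^ p)) z)) := by
  have hF : ∀ x, x ∈ hfin.toFinset ↔ x ∈ pointsUpTo A N t := fun x => hfin.mem_toFinset
  have hq := (natCast_mul_div_two_pow_mem ht.le hk).2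
  rw [backwardCHL_eq_backwardFlow hF _ hq]
  refine h.tendsto_gridFlow hz hF ht hI hq ?_
  filter_upwards [eventually_ge_atTop p] with n hn
  obtain ⟨m, rfl⟩ := Nat.exists_eq_add_of_le hn
  rw [Nat.add_sub_cancel_left]
  push_cast
  rw [pow_add]
  field_simp

theorem tendsto_gridDiff (h : IsLarge lam y N) (h' : IsLarge lam y M) (hNM : N ≤ M) {z : ℂ}
    (hz : y ≤ z.im) (hfin : (pointsUpTo A M t).Finite) (ht : 0 < t) {p k : ℕ} (hk : k ≤ 2 ^ p) :
    Tendsto (fun n => gridDiff lam N M A t n z (k * 2 ^ (n - p))) atTop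
      (nhds (processDiff lam N M A (k * (t / 2 ^ p)) z)) :=
  (h.tendsto_gridFlow_backwardCHL hz (hfin.subset (pointsUpTo_mono A hNM t)) ht
    (fun n => window_mono n hNM) hk).sub
    (h'.tendsto_gridFlow_backwardCHL hz hfin ht (fun _ => subset_rfl) hk)

theorem exists_dyadic_time (F : Finset (ℝ × ℝ)) (ht : 0 < t) {s : ℝ} (hs : s ∈ Set.Icc 0 t) :
    ∃ p k : ℕ, k ≤ 2 ^ p ∧ ∀ x ∈ F, (x.2 ≤ s ↔ x.2 ≤ k * (t / 2 ^ p)) := by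
  have hτ : ∀ p : ℕ, 0 < t / 2 ^ p := fun p => by positivity
  have hτ0 : Tendsto (fun p : ℕ => t / 2 ^ p) atTop (nhds 0) :=
    tendsto_const_nhds.div_atTop (tendsto_pow_atTop_atTop_of_one_lt one_lt_two)
  have hev : ∀ᶠ p : ℕ in atTop, ∀ x ∈ F, s < x.2 → s + t / 2 ^ p < x.2 := by
    rw [eventually_all_finset]
    intro x _
    by_cases hlt : s < x.2
    · filter_upwards [hτ0.eventually_lt_const (sub_pos.2 hlt)] with p hp _
      linarith
    · exact Eventually.of_forall fun p h => absurd h hlt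
  obtain ⟨p, hp⟩ := hev.exists
  have h1 : s ≤ ⌈s / (t / 2 ^ p)⌉₊ * (t / 2 ^ p) := by
    rw [← div_le_iff₀ (hτ p)]
    exact Nat.le_ceil _
  have h2 : ⌈s / (t / 2 ^ p)⌉₊ * (t / 2 ^ p) < s + t / 2 ^ p := by
    have := Nat.ceil_lt_add_one (div_nonneg hs.1 (hτ p).le)
    have h3 := mul_lt_mul_of_pos_right this (hτ p)
    rwa [add_mul, div_mul_cancel₀ _ (hτ p).ne', one_mul] at h3
  refine ⟨p, ⌈s / (t / 2 ^ p)⌉₊, ?_, fun x hx => ⟨fun h => h.trans h1, fun h => ?_⟩⟩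
  · rw [Nat.ceil_le, div_le_iff₀ (hτ p)]
    push_cast
    rw [mul_div_cancel₀ _ (by positivity)]
    exact hs.2
  · by_contra hlt
    have := hp x hx (not_le.1 hlt)
    linarith

/-- The process is a step function of time: each of its values is attained at a dyadic time. -/
theorem exists_processDiff_eq (hNM : N ≤ M) (hfin : (pointsUpTo A M t).Finite) (ht : 0 < t) {s : ℝ}
    (hs : s ∈ Set.Icc 0 t) :
    ∃ p k : ℕ, k ≤ 2 ^ p ∧
      processDiff lam N M A s = processDiff lam N M A (k * (t / 2 ^ p)) := by
  obtain ⟨p, k, hk, hF⟩ := exists_dyadic_time hfin.toFinset ht hs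
  have hq := (natCast_mul_div_two_pow_mem ht.le hk).2
  refine ⟨p, k, hk, funext fun z => ?_⟩
  have hfin' := hfin.subset (pointsUpTo_mono A hNM t)
  have hM : ∀ x, x ∈ hfin.toFinset ↔ x ∈ pointsUpTo A M t := fun x => hfin.mem_toFinset
  have hN : ∀ x, x ∈ hfin'.toFinset ↔ x ∈ pointsUpTo A N t := fun x => hfin'.mem_toFinset
  rw [processDiff, processDiff, backwardCHL_eq_backwardFlow hN _ hs.2,
    backwardCHL_eq_backwardFlow hM _ hs.2, backwardCHL_eq_backwardFlow hN _ hq,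
    backwardCHL_eq_backwardFlow hM _ hq, Finset.filter_congr hF,
    Finset.filter_congr fun x hx =>
      hF x ((hM x).2 (pointsUpTo_mono A hNM t ((hN x).1 hx)))]

theorem continuousOn_processDiff (h : IsLarge lam y N) (h' : IsLarge lam y M) (hNM : N ≤ M)
    (hfin : (pointsUpTo A M t).Finite) {s : ℝ} (hs : s ≤ t) :
    ContinuousOn (processDiff lam N M A s) {z | y ≤ z.im} := by
  have hfin' := hfin.subset (pointsUpTo_mono A hNM t)
  refine ContinuousOn.congr ((h.backwardFlow_props (hfin'.toFinset.filter fun p => p.2 ≤ s)).2.sub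
    (h'.backwardFlow_props (hfin.toFinset.filter fun p => p.2 ≤ s)).2) fun z _ => ?_
  rw [processDiff, backwardCHL_eq_backwardFlow (fun x => hfin'.mem_toFinset) _ hs,
    backwardCHL_eq_backwardFlow (fun x => hfin.mem_toFinset) _ hs]
  rfl

/-- The supremum over all times and starting points is a countable one. -/
theorem supSqDist_eq_iSup (h : IsLarge lam y N) (h' : IsLarge lam y M) (hNM : N ≤ M)
    (hfin : (pointsUpTo A M t).Finite) (ht : 0 < t) (hKy : ∀ z ∈ K, y ≤ z.im) (hSK : S ⊆ K)
    (hKS : K ⊆ closure S) :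
    supSqDist lam N M A t K = ⨆ x ∈ {x : (ℕ × ℕ) × ℂ | x.1.2 ≤ 2 ^ x.1.1 ∧ x.2 ∈ S},
      ‖processDiff lam N M A (x.1.2 * (t / 2 ^ x.1.1)) x.2‖ₑ ^ 2 := by
  refine le_antisymm (iSup₂_le fun s hs => iSup₂_le fun z hz => ?_) (iSup₂_le fun x hx => ?_)
  · obtain ⟨p, k, hk, hpk⟩ := exists_processDiff_eq (lam := lam) hNM hfin ht hs
    change ‖processDiff lam N M A s z‖ₑ ^ 2 ≤ _
    rw [hpk]
    -- By continuity in the starting point a dense set suffices.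
    obtain ⟨v, hvS, hv⟩ := mem_closure_iff_seq_limit.1 (hKS hz)
    have hcont := continuousOn_processDiff h h' hNM hfin
      (natCast_mul_div_two_pow_mem ht.le hk).2 z (hKy z hz)
    have hv' : Tendsto v atTop (nhdsWithin z {z | y ≤ z.im}) :=
      tendsto_nhdsWithin_iff.2 ⟨hv, Eventually.of_forall fun j => hKy _ (hSK (hvS j))⟩
    refine le_of_tendsto (((ENNReal.continuous_pow 2).tendsto _).comp
      (hcont.tendsto.comp hv').enorm) (Eventually.of_forall fun j => ?_)
    exact le_iSup₂_of_le (f := fun (x : (ℕ × ℕ) × ℂ)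
      (_ : x ∈ {x : (ℕ × ℕ) × ℂ | x.1.2 ≤ 2 ^ x.1.1 ∧ x.2 ∈ S}) =>
      ‖processDiff lam N M A (x.1.2 * (t / 2 ^ x.1.1)) x.2‖ₑ ^ 2) ((p, k), v j) ⟨hk, hvS j⟩ le_rfl
  · exact le_iSup₂_of_le (f := fun s (_ : s ∈ Set.Icc 0 t) => ⨆ z ∈ K,
      ‖backwardCHL N (slitParam N lam) A s z - backwardCHL M (slitParam M lam) A s z‖ₑ ^ 2)
      _ (natCast_mul_div_two_pow_mem ht.le hx.1) (le_iSup₂_of_le (f := fun z (_ : z ∈ K) =>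
      ‖backwardCHL N (slitParam N lam) A (x.1.2 * (t / 2 ^ x.1.1)) z
        - backwardCHL M (slitParam M lam) A (x.1.2 * (t / 2 ^ x.1.1)) z‖ₑ ^ 2)
      x.2 (hSK hx.2) le_rfl)

/-- If the measure `μ` controls holomorphic functions on `K`, then the supremum over times and
starting points is bounded by the integrals over `μ` of the discretised suprema over time. -/
theorem supSqDist_le_liminf (h : IsLarge lam y N) (h' : IsLarge lam y M) (hNM : N ≤ M)
    (hfin : (pointsUpTo A M t).Finite) (ht : 0 < t) (hKy : ∀ z ∈ K, y ≤ z.im) {μ : Measure ℂ}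
    (hμ : ∀ n J, ∀ z ∈ K, ‖gridDiff lam N M A t n z J‖ₑ ^ 2
      ≤ ∫⁻ w, ‖gridDiff lam N M A t n w J‖ₑ ^ 2 ∂μ) :
    supSqDist lam N M A t K ≤ liminf (fun n => ∫⁻ w, ⨆ J ∈ Finset.range (2 ^ n + 1),
      ‖gridDiff lam N M A t n w J‖ₑ ^ 2 ∂μ) atTop := by
  refine iSup₂_le fun s hs => iSup₂_le fun z hz => ?_
  obtain ⟨p, k, hk, hpk⟩ := exists_processDiff_eq (lam := lam) hNM hfin ht hs
  change ‖processDiff lam N M A s z‖ₑ ^ 2 ≤ _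
  rw [hpk, ← (((ENNReal.continuous_pow 2).tendsto _).comp
    (tendsto_gridDiff h h' hNM (hKy z hz) hfin ht hk).enorm).liminf_eq]
  refine liminf_le_liminf ?_
  filter_upwards [eventually_ge_atTop p] with n hn
  refine (hμ n _ z hz).trans (lintegral_mono fun w => ?_)
  refine le_iSup₂_of_le (f := fun J (_ : J ∈ Finset.range (2 ^ n + 1)) =>
    ‖gridDiff lam N M A t n w J‖ₑ ^ 2) (k * 2 ^ (n - p)) ?_ le_rfl
  rw [Finset.mem_range, Nat.lt_succ_iff]
  calc k * 2 ^ (n - p) ≤ 2 ^ p * 2 ^ (n - p) := Nat.mul_le_mul_right _ hk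
    _ = 2 ^ n := by rw [← pow_add, Nat.add_sub_cancel' hn]

end Sup

section Expectation

open Filter

variable {Ω : Type*} [MeasurableSpace Ω] {P : Measure Ω}
  {A : Ω → Set (ℝ × ℝ)} {lam y t : ℝ} {N M : ℕ} {K : Set ℂ}

theorem measurable_gridDiff (hA : IsPoissonPointProcess halfPlaneIntensity P A) (n J : ℕ) :
    Measurable fun x : Ω × ℂ => gridDiff lam N M (A x.1) t n x.2 J :=
  (measurable_gridFlow (fun _ => hA.measurable_ncard (measurableSet_cell _ _ _))
    (fun i => measurable_gridJump lam n N i) J).sub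
    (measurable_gridFlow (fun _ => hA.measurable_ncard (measurableSet_cell _ _ _))
    (fun i => measurable_gridJump lam n M i) J)

theorem measurable_gridDiff_right (lam : ℝ) (N M : ℕ) (A : Set (ℝ × ℝ)) (t : ℝ) (n J : ℕ) :
    Measurable fun z => gridDiff lam N M A t n z J := by
  have h : ∀ L : ℕ, Measurable fun z =>
      gridFlow (window n M) (gridJump lam n L) (cellCount A n (t / 2 ^ n)) z J := fun L =>
    (measurable_gridFlow (Ω := Unit) (ξ := fun p _ => cellCount A n (t / 2 ^ n) p)
      (fun _ => measurable_const) (fun i => measurable_gridJump lam n L i) J).comp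
      (measurable_prodMk_left (x := ()))
  exact (h N).sub (h M)

theorem differentiableAt_gridDiff (h : IsLarge lam y N) (h' : IsLarge lam y M)
    (A : Set (ℝ × ℝ)) (t : ℝ) (n J : ℕ) {z : ℂ} (hz : y ≤ z.im) :
    DifferentiableAt ℂ (fun z => gridDiff lam N M A t n z J) z :=
  (differentiableAt_gridFlow (fun i _ _ hw => h.gridJump_im_nonneg n i hw)
    (fun i _ _ hw => h.differentiableAt_gridJump n i hw) _ hz J).sub
    (differentiableAt_gridFlow (fun i _ _ hw => h'.gridJump_im_nonneg n i hw)
    (fun i _ _ hw => h'.differentiableAt_gridJump n i hw) _ hz J)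

theorem aemeasurable_supSqDist (hA : IsPoissonPointProcess halfPlaneIntensity P A)
    (h : IsLarge lam y N) (h' : IsLarge lam y M) (hNM : N ≤ M) (ht : 0 < t) (hK : IsCompact K)
    (hKy : ∀ z ∈ K, y ≤ z.im) : AEMeasurable (fun ω => supSqDist lam N M (A ω) t K) P := by
  obtain ⟨S, hSK, hS, hKS⟩ := hK.isSeparable.exists_countable_dense_subset
  have hfin := hA.ae_finite_pointsUpTo M t
  have hT : {x : (ℕ × ℕ) × ℂ | x.1.2 ≤ 2 ^ x.1.1 ∧ x.2 ∈ S}.Countable :=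
    (Set.countable_univ.prod hS).mono
      (show _ ⊆ Set.univ ×ˢ S from fun x hx => ⟨Set.mem_univ _, hx.2⟩)
  refine AEMeasurable.congr (AEMeasurable.biSup (f := fun (x : (ℕ × ℕ) × ℂ) ω =>
    ‖processDiff lam N M (A ω) (x.1.2 * (t / 2 ^ x.1.1)) x.2‖ₑ ^ 2) _ hT fun x hx => ?_)
    (hfin.mono fun ω hω => (supSqDist_eq_iSup h h' hNM hω ht hKy hSK hKS).symm)
  refine AEMeasurable.pow_const (AEMeasurable.enorm ?_) 2
  refine aemeasurable_of_tendsto_metrizable_ae atTop (f := fun n ω =>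
    gridDiff lam N M (A ω) t n x.2 (x.1.2 * 2 ^ (n - x.1.1))) (fun n =>
    ((measurable_gridDiff hA n _).comp measurable_prodMk_right).aemeasurable) ?_
  filter_upwards [hfin] with ω hω
  exact tendsto_gridDiff h h' hNM (hKy _ (hSK hx.2)) hω ht hx.1

/-- Fatou's lemma and Tonelli's theorem. -/
theorem lintegral_liminf_lintegral_le [SFinite P] {μ : Measure ℂ} [SFinite μ]
    {G : ℕ → Ω × ℂ → ℝ≥0∞} (hG : ∀ n, Measurable (G n)) {b : ℝ≥0∞}
    (hb : ∀ᶠ n in atTop, ∀ᵐ w ∂μ, ∫⁻ ω, G n (ω, w) ∂P ≤ b) :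
    ∫⁻ ω, liminf (fun n => ∫⁻ w, G n (ω, w) ∂μ) atTop ∂P ≤ b * μ Set.univ := by
  refine (lintegral_liminf_le fun n => (hG n).lintegral_prod_right').trans
    (liminf_le_of_frequently_le' (Eventually.frequently ?_))
  filter_upwards [hb] with n hn
  rw [lintegral_lintegral_swap (f := fun ω w => G n (ω, w)) (hG n).aemeasurable, ← lintegral_const]
  exact lintegral_mono_ae hn

/-- The expected supremum over times and starting points is bounded by the expected discretised
supremum over time at a fixed starting point. -/
theorem lintegral_supSqDist_le [SFinite P] (hA : IsPoissonPointProcess halfPlaneIntensity P A)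
    (h : IsLarge lam y N) (h' : IsLarge lam y M) (hNM : N ≤ M) (ht : 0 < t)
    (hKy : ∀ z ∈ K, y ≤ z.im) {μ : Measure ℂ} [IsFiniteMeasure μ]
    (hμ : ∀ f : ℂ → ℂ, Measurable f → (∀ w, y ≤ w.im → DifferentiableAt ℂ f w) →
      ∀ z ∈ K, ‖f z‖ₑ ^ 2 ≤ ∫⁻ w, ‖f w‖ₑ ^ 2 ∂μ) {b : ℝ≥0∞}
    (hb : ∀ᶠ n in atTop, ∀ᵐ w ∂μ,
      ∫⁻ ω, ⨆ J ∈ Finset.range (2 ^ n + 1), ‖gridDiff lam N M (A ω) t n w J‖ₑ ^ 2 ∂P ≤ b) :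
    ∫⁻ ω, supSqDist lam N M (A ω) t K ∂P ≤ b * μ Set.univ := by
  have hmeas : ∀ n, Measurable fun x : Ω × ℂ =>
      ⨆ J ∈ Finset.range (2 ^ n + 1), ‖gridDiff lam N M (A x.1) t n x.2 J‖ₑ ^ 2 := fun n =>
    Measurable.biSup _ (Finset.countable_toSet _) fun J _ =>
      (measurable_gridDiff hA n J).enorm.pow_const 2
  refine (lintegral_mono_ae ?_).trans (lintegral_liminf_lintegral_le hmeas hb)
  filter_upwards [hA.ae_finite_pointsUpTo M t] with ω hω
  have hm : ∀ n J, Measurable fun z => gridDiff lam N M (A ω) t n z J := fun n J =>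
    measurable_gridDiff_right lam N M (A ω) t n J
  have hd : ∀ n J, ∀ w, y ≤ w.im → DifferentiableAt ℂ (fun z => gridDiff lam N M (A ω) t n z J) w :=
    fun n J w hw => differentiableAt_gridDiff h h' (A ω) t n J hw
  exact supSqDist_le_liminf h h' hNM hω ht hKy fun n J => hμ _ (hm n J) (hd n J)

/-- The discretised supremum over time at a fixed starting point is small in mean. -/
theorem lintegral_iSup_gridDiff_le [IsProbabilityMeasure P]
    (hA : IsPoissonPointProcess halfPlaneIntensity P A)
    (h : IsLarge lam y N) (h' : IsLarge lam y M) (hNM : N ≤ M) (ht : 0 < t) {R η : ℝ} (hR : 0 < R)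
    (hη : 0 ≤ η)
    (hclose : ∀ (n : ℕ) (τ : ℝ), 0 ≤ τ → ∀ w : ℂ, 2 * y ≤ w.im → ‖w‖ ≤ R →
      τ * mesh n * ∑ i ∈ window n M, ‖gridJump lam n N i w - gridJump lam n M i w‖ ^ 2 ≤ τ * η)
    {R₀ c₀ Δ : ℝ} (hc : ‖driftConst lam N‖ ≤ c₀)
    (hΔ : 0 < Δ) (hΔ1 : Δ ≤ 1) (hd : ‖driftConst lam N - driftConst lam M‖ ≤ Δ) :
    ∀ᶠ n in atTop, ∀ z : ℂ, 2 * y ≤ z.im → ‖z‖ ≤ R₀ →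
      ∫⁻ ω, ⨆ J ∈ Finset.range (2 ^ n + 1), ‖gridDiff lam N M (A ω) t n z J‖ₑ ^ 2 ∂P
        ≤ ENNReal.ofReal (4 * (2 * (t * (3 * Δ)) ^ 2 + 4 * (t * η)
          + 16 * (t * gridBound lam y) * (2 * R₀ ^ 2 + 2 * (2 * (t * (c₀ + 1)) ^ 2
            + 2 * (t * gridBound lam y))) / R ^ 2) * Real.exp (4 * t * gridBound lam y)) := by
  have hlim : ∀ N : ℕ, ∀ᶠ n in atTop, 4 * Real.pi * N * jumpLip lam y * mesh n < Δ := fun N => by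
    have := tendsto_mesh.const_mul (4 * Real.pi * N * jumpLip lam y)
    rw [mul_zero] at this
    exact this.eventually_lt_const hΔ
  have hL := jumpLip_nonneg lam h.y_pos
  have hB := gridBound_nonneg lam y
  filter_upwards [hlim N, hlim M] with n hnN hnM z hz hzR
  have hm := (mesh_pos n).le
  have hτ : 0 < t / 2 ^ n := by positivity
  have hpi := Real.pi_pos
  have he : 0 ≤ 4 * Real.pi * N * jumpLip lam y * mesh n := by positivity
  have he' : 0 ≤ 4 * Real.pi * M * jumpLip lam y * mesh n := by positivity
  obtain ⟨H, hH1, hH2, hH3⟩ := (h.gridJumps (window_mono n hNM) hτ.le).exists_integrable_bound_sub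
    (h'.gridJumps subset_rfl hτ.le) (hA.isCountArray_cellCount n hτ) (mul_nonneg hτ.le hm) hτ.le
    he he' hB hη hR hz (n := 2 ^ n) (t := t) (by push_cast; rw [mul_div_cancel₀ _ (by positivity)])
    (fun w w' hw hw' => h'.sum_norm_gridJump_sub_sq_le hτ.le hw hw')
    (fun w hw hwR => hclose n _ hτ.le w hw hwR)
  have hH0 : ∀ ω, 0 ≤ H ω := fun ω => (sq_nonneg _).trans (hH2 0 (Nat.zero_le _) ω)
  calc ∫⁻ ω, ⨆ J ∈ Finset.range (2 ^ n + 1), ‖gridDiff lam N M (A ω) t n z J‖ₑ ^ 2 ∂P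
      ≤ ∫⁻ ω, ENNReal.ofReal (H ω) ∂P := by
        refine lintegral_mono fun ω => iSup₂_le fun J hJ => ?_
        rw [← ofReal_norm, ← ENNReal.ofReal_pow (norm_nonneg _)]
        exact ENNReal.ofReal_le_ofReal (hH2 J (Nat.lt_succ_iff.1 (Finset.mem_range.1 hJ)) ω)
    _ = ENNReal.ofReal (∫ ω, H ω ∂P) :=
        (ofReal_integral_eq_lintegral_ofReal hH1 (Eventually.of_forall hH0)).symm
    _ ≤ _ := by
        refine ENNReal.ofReal_le_ofReal (hH3.trans ?_)
        rw [momentBound]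
        gcongr
        · linarith
        · linarith

end Expectation

theorem supSqDist_zero (lam : ℝ) (N M : ℕ) (A : Set (ℝ × ℝ)) (K : Set ℂ) :
    supSqDist lam N M A 0 K = 0 := by
  have h0 : ∀ (N : ℕ) (δ : ℝ) (z : ℂ), backwardCHL N δ A 0 z = z := by
    intro N δ z
    rw [backwardCHL_eq_backwardFlow (F := ∅) (t := 0) (by simp [pointsUpTo]) δ le_rfl,
      backwardFlow_eq]
    simp
  simp only [supSqDist, ENNReal.iSup_eq_zero]
  intro s hs z _
  rw [show s = 0 from le_antisymm hs.2 hs.1, h0, h0]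
  simp

end CHL

end

theorem mainTheorem2 {Ω : Type*} [MeasurableSpace Ω] (P : Measure Ω) [IsProbabilityMeasure P]
    (A : Ω → Set (ℝ × ℝ)) (hA : CHL.IsPoissonPointProcess CHL.halfPlaneIntensity P A)
    (lam : ℝ) (hlam : 0 < lam) (t : ℝ) (ht : 0 ≤ t)
    (K : Set ℂ) (hK : IsCompact K) (hKH : K ⊆ {z : ℂ | 0 < z.im})
    (ε : ℝ) (hε : 0 < ε) :
    ∃ N₀ : ℕ, ∀ M N : ℕ, M > N → N > N₀ →
      AEMeasurable (fun ω => CHL.supSqDist lam N M (A ω) t K) P ∧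
      ∫⁻ ω, CHL.supSqDist lam N M (A ω) t K ∂P < ENNReal.ofReal ε := by
  open CHL in
  rcases ht.eq_or_lt with rfl | ht
  · refine ⟨0, fun M N _ _ => ?_⟩
    simp only [supSqDist_zero]
    exact ⟨aemeasurable_const, by simpa using hε⟩
  obtain ⟨y, hy, hKy⟩ : ∃ y : ℝ, 0 < y ∧ ∀ z ∈ K, 4 * y ≤ z.im := by
    rcases K.eq_empty_or_nonempty with rfl | hne
    · exact ⟨1, one_pos, by simp⟩
    · obtain ⟨z₀, hz₀, hmin⟩ := hK.exists_isMinOn hne Complex.continuous_im.continuousOn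
      have h0 : 0 < z₀.im := hKH hz₀
      exact ⟨z₀.im / 4, by positivity, fun z hz => by linarith [isMinOn_iff.1 hmin z hz]⟩
  obtain ⟨μ, R₀, hμfin, hμ, hμK⟩ := exists_measure_enorm_sq_le hK (v := 2 * y) (by positivity)
    fun z hz => by linarith [hKy z hz]
  obtain ⟨c, hc⟩ := exists_tendsto_driftConst lam
  set C := gridBound lam y with hC
  have hC0 : 0 ≤ C := gridBound_nonneg lam y
  set X := Real.exp (4 * t * C) with hX
  set m := (μ Set.univ).toReal with hm
  have hm0 : 0 ≤ m := ENNReal.toReal_nonneg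
  set Q := 2 * R₀ ^ 2 + 2 * (2 * (t * (‖c‖ + 1 + 1)) ^ 2 + 2 * (t * C)) with hQ
  have hQ0 : 0 ≤ Q := by positivity
  -- `Δ` bounds the distance of the mean displacements and the error of the grid, `η` the distance
  -- of the displacements in mean square on the ball of radius `1 / x`; each gets a third of `ε`.
  obtain ⟨Δ, hΔ0, hΔ1, hΔ⟩ := exists_pos_le_one_mul_lt
    (show 0 ≤ 72 * t ^ 2 * X * m by positivity) (show 0 < ε / 3 by positivity)
  obtain ⟨η, hη0, -, hη⟩ := exists_pos_le_one_mul_lt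
    (show 0 ≤ 16 * t * X * m by positivity) (show 0 < ε / 3 by positivity)
  obtain ⟨x, hx0, hx1, hx⟩ := exists_pos_le_one_mul_lt
    (show 0 ≤ 64 * (t * C) * Q * X * m by positivity) (show 0 < ε / 3 by positivity)
  obtain ⟨N₁, hN₁⟩ := exists_sum_norm_gridJump_sub_sq_le hlam hy (R := 1 / x) (by positivity) hη0
  obtain ⟨N₂, hN₂⟩ := Filter.eventually_atTop.1
    (hc.eventually (Metric.ball_mem_nhds c (half_pos hΔ0)))
  refine ⟨max N₁ N₂, fun M N hMN hN => ?_⟩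
  obtain ⟨hN', hM', hclose⟩ := hN₁ N M ((le_max_left _ _).trans hN.le) hMN.le
  have hKy' : ∀ z ∈ K, 2 * y ≤ z.im := fun z hz => by linarith [hKy z hz]
  have hKy'' : ∀ z ∈ K, y ≤ z.im := fun z hz => by linarith [hKy z hz]
  refine ⟨aemeasurable_supSqDist hA hN' hM' hMN.le ht hK hKy'', ?_⟩
  have hcN : ‖driftConst lam N - c‖ < Δ / 2 := by
    simpa [dist_eq_norm] using hN₂ N ((le_max_right _ _).trans hN.le)
  have hcM : ‖driftConst lam M - c‖ < Δ / 2 := by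
    simpa [dist_eq_norm] using hN₂ M ((le_max_right _ _).trans (hN.le.trans hMN.le))
  have hcN' : ‖driftConst lam N‖ ≤ ‖c‖ + 1 := by
    have := norm_le_norm_add_norm_sub' (driftConst lam N) c
    linarith
  have hd : ‖driftConst lam N - driftConst lam M‖ ≤ Δ := by
    have := norm_sub_le (driftConst lam N - c) (driftConst lam M - c)
    rw [sub_sub_sub_cancel_right] at this
    linarith
  have hb := lintegral_iSup_gridDiff_le hA hN' hM' hMN.le ht (R := 1 / x) (by positivity) hη0.le
    hclose (R₀ := R₀) hcN' hΔ0 hΔ1 hd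
  have hfinal := lintegral_supSqDist_le hA hN' hM' hMN.le ht hKy''
    (fun f hf hf' => hμK f hf fun w hw => hf' w (by linarith))
    (hb.mono fun n hn => hμ.mono fun w hw => hn w hw.1 hw.2)
  refine hfinal.trans_lt ?_
  rw [← hC, ← hX, ← hQ, ← ENNReal.ofReal_toReal (measure_ne_top μ Set.univ), ← hm,
    ← ENNReal.ofReal_mul (by positivity), ENNReal.ofReal_lt_ofReal_iff hε]
  have e1 : 72 * t ^ 2 * X * m * Δ ^ 2 ≤ 72 * t ^ 2 * X * m * Δ := by
    gcongr
    nlinarith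
  have e2 : 64 * (t * C) * Q * X * m * x ^ 2 ≤ 64 * (t * C) * Q * X * m * x := by
    gcongr
    nlinarith
  have e3 : 16 * (t * C) * Q / (1 / x) ^ 2 = 16 * (t * C) * Q * x ^ 2 := by
    field_simp
  rw [e3]
  calc _ = 72 * t ^ 2 * X * m * Δ ^ 2 + 16 * t * X * m * η + 64 * (t * C) * Q * X * m * x ^ 2 := by
        ring
    _ < ε := by linarith
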